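/- Let $F_n$ be the free group with basis $a_1,\dots,a_n$, let $H\le F_n$ be a subgroup with basis $h_1,\dots,h_r$, let $g\in F_n$ and let $d\ge 0$ be an integer. Let $\mathfrak I_g$ be the kernel of the homomorphism $H*\langle x\rangle\to F_n$ that is the inclusion on $H$ and sends $x$ to $g$. The degree of $w\in H*\langle x\rangle$ is the number of occurrences of $x$ and $x^{-1}$ in the cyclic reduction of the reduced word in $h_1,\dots,h_r,x$ that represents $w$. Let $\mathfrak J_{g,d}$ be the set of elements of $\mathfrak I_g$ of degree $d$, and let $L$ be the maximal length of the reduced words in $a_1^{\pm1},\dots,a_n^{\pm1}$ that represent $h_1,\dots,h_r,g$. Put $\bar m=\max(m,1)$ for $m\in\mathbb N$. There are a random access machine (over the integers, each addition, subtraction, multiplication, direct or indirect memory access, comparison with $0$ and output of a number taking one unit of time) and a constant $C$ such that, for all $n,r,H,h_1,\dots,h_r,g,d$ as above, the machine, on input $n,r,d$ and the reduced words representing $h_1,\dots,h_r,g$, does the following. (i) Within time $C\,\bar n\,\bar r^{15}\bar L^{3}\bar d^{6}$ it writes whether $\mathfrak J_{g,d}$ is empty; if it is empty, the machine also halts within this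 time. (ii) If $\mathfrak J_{g,d}\neq\emptyset$, then within the same time $C\,\bar n\,\bar r^{15}\bar L^{3}\bar d^{6}$ it also writes data describing an element of $\mathfrak J_{g,d}$, namely a list of production rules $N_1\to u_1,\dots,N_m\to u_m$ ($m\ge1$), where $u_i$ is a word in the letters $h_1^{\pm1},\dots,h_r^{\pm1},x^{\pm1}$ and the symbols $N_1,\dots,N_{i-1}$, such that the word in $h_1^{\pm1},\dots,h_r^{\pm1},x^{\pm1}$ derived from $N_m$ is cyclically reduced and represents an element of $\mathfrak J_{g,d}$. (iii) If $\mathfrak J_{g,d}\neq\emptyset$, then the machine continues, explicitly writes down an element of $\mathfrak J_{g,d}$, and halts, all within time $C\,\bar n\,\bar r^{15}\bar L^{11}\bar d^{10}$. Here an element of $H*\langle x\rangle\subseteq F_n*\langle x\rangle$ is written as a reduced word in the letters $a_1^{\pm1},\dots,a_n^{\pm1},x^{\pm1}$, that is, its coefficients in $H$ are written out as elements of $F_n$. -/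

import Mathlib

/-! ### Random access machines

The memory cells are indexed by the integers and each cell holds an integer.  Every instruction,
in particular every addition and every multiplication of two integers, takes one unit of time. -/

namespace RAM

/-- The instructions of the machine; `M[i]` denotes the content of the cell `i`. -/
inductive Instr where
  /-- `M[i] := c` -/
  | const (i c : ℤ)
  /-- `M[i] := M[j] + M[k]` -/
  | add (i j k : ℤ)
  /-- `M[i] := M[j] - M[k]` -/
  | sub (i j k : ℤ)
  /-- `M[i] := M[j] * M[k]` -/
  | mul (i j k : ℤ)
  /-- `M[i] := M[M[j]]` -/
  | load (i j : ℤ)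
  /-- `M[M[i]] := M[j]` -/
  | store (i j : ℤ)
  /-- if `0 < M[i]`, continue with the instruction number `t` -/
  | jumpPos (i : ℤ) (t : ℕ)
  /-- append `M[i]` to the output -/
  | write (i : ℤ)

/-- A program is a finite list of instructions, numbered from `0`. -/
abbrev Program := List Instr

/-- A configuration: number of the next instruction, memory, and output written so far. -/
structure Config where
  pc : ℕ
  mem : ℤ → ℤ
  out : List ℤ

/-- The effect of one instruction. -/
def Instr.exec (I : Instr) (c : Config) : Config :=
  match I with
  | .const i a => ⟨c.pc + 1, Function.update c.mem i a, c.out⟩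
  | .add i j k => ⟨c.pc + 1, Function.update c.mem i (c.mem j + c.mem k), c.out⟩
  | .sub i j k => ⟨c.pc + 1, Function.update c.mem i (c.mem j - c.mem k), c.out⟩
  | .mul i j k => ⟨c.pc + 1, Function.update c.mem i (c.mem j * c.mem k), c.out⟩
  | .load i j => ⟨c.pc + 1, Function.update c.mem i (c.mem (c.mem j)), c.out⟩
  | .store i j => ⟨c.pc + 1, Function.update c.mem (c.mem i) (c.mem j), c.out⟩
  | .jumpPos i t => ⟨if 0 < c.mem i then t else c.pc + 1, c.mem, c.out⟩
  | .write i => ⟨c.pc + 1, c.mem, c.out ++ [c.mem i]⟩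

/-- One step of the machine; a machine without a next instruction has halted and stays put. -/
def step (P : Program) (c : Config) : Config :=
  match P[c.pc]? with
  | none => c
  | some I => I.exec c

/-- The starting configuration: the input occupies the cells `0, 1, 2, …`, all other cells are
`0`, and nothing has been written. -/
def start (input : List ℤ) : Config where
  pc := 0
  mem a := if 0 ≤ a then input.getD a.toNat 0 else 0
  out := []

/-- The configuration after `t` steps. -/
def run (P : Program) (input : List ℤ) (t : ℕ) : Config := (step P)^[t] (start input)

/-- After `t` steps, what has been written so far is exactly `output`. -/
def HasWritten (P : Program) (input : List ℤ) (t : ℕ) (output : List ℤ) : Prop :=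
  (run P input t).out = output

/-- After `t` steps the machine has halted and its output is `output`. -/
def HaltsWith (P : Program) (input : List ℤ) (t : ℕ) (output : List ℤ) : Prop :=
  P.length ≤ (run P input t).pc ∧ (run P input t).out = output

end RAM

/-! ### Equations over a subgroup of a free group

Words are lists of pairs `(a, ε)`, where `(a, true)` stands for the letter `a` and `(a, false)` for
its inverse.  In the alphabets `Option (Fin k)` the letter `none` is the unknown `x`. -/

namespace FreeEq

/-- The group `H * ⟨x⟩`. -/
abbrev EquationGroup {n : ℕ} (H : Subgroup (FreeGroup (Fin n))) :=
  Monoid.Coprod H (Multiplicative ℤ)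

/-- The unknown `x`. -/
def unknown {n : ℕ} (H : Subgroup (FreeGroup (Fin n))) : EquationGroup H :=
  Monoid.Coprod.inr (Multiplicative.ofAdd 1)

/-- The evaluation homomorphism `H * ⟨x⟩ → F_n`: the inclusion on `H`, and `x ↦ g`. -/
def evalHom {n : ℕ} (H : Subgroup (FreeGroup (Fin n))) (g : FreeGroup (Fin n)) :
    EquationGroup H →* FreeGroup (Fin n) :=
  Monoid.Coprod.lift H.subtype (zpowersHom (FreeGroup (Fin n)) g)

/-- The ideal of equations for `g` with coefficients in `H`. -/
def ideal {n : ℕ} (H : Subgroup (FreeGroup (Fin n))) (g : FreeGroup (Fin n)) :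
    Subgroup (EquationGroup H) :=
  (evalHom H g).ker

/-- The element of `H * ⟨x⟩` represented by a word in the letters `h_1, …, h_r, x` and their
inverses, where `h_1, …, h_r` is the basis `b` of `H`. -/
def ofWord {n r : ℕ} {H : Subgroup (FreeGroup (Fin n))} (b : FreeGroupBasis (Fin r) H)
    (u : List (Option (Fin r) × Bool)) : EquationGroup H :=
  FreeGroup.lift (fun o => o.elim (unknown H) (fun i => Monoid.Coprod.inl (b i))) (FreeGroup.mk u)

/-- The number of occurrences of `x` and `x⁻¹` in a word. -/
def countUnknown {k : ℕ} (u : List (Option (Fin k) × Bool)) : ℕ :=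
  u.countP (fun p => p.1.isNone)

/-- `w` has degree `d`: the cyclic reduction of the reduced word in `h_1, …, h_r, x` that represents
`w` contains exactly `d` occurrences of `x` and `x⁻¹`. -/
def HasDegree {n r : ℕ} {H : Subgroup (FreeGroup (Fin n))} (b : FreeGroupBasis (Fin r) H)
    (w : EquationGroup H) (d : ℕ) : Prop :=
  ∃ u : List (Option (Fin r) × Bool), FreeGroup.IsReduced u ∧ ofWord b u = w ∧
    countUnknown (FreeGroup.reduceCyclically u) = d

/-- The set of all equations for `g` of degree `d` with coefficients in `H`. -/
def equationsOfDegree {n r : ℕ} {H : Subgroup (FreeGroup (Fin n))} (b : FreeGroupBasis (Fin r) H)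
    (g : FreeGroup (Fin n)) (d : ℕ) : Set (EquationGroup H) :=
  {w | w ∈ ideal H g ∧ HasDegree b w d}

/-- The embedding of `H * ⟨x⟩` into `F_n * ⟨x⟩`, the free group on `a_1, …, a_n, x`. -/
def toAmbient {n : ℕ} (H : Subgroup (FreeGroup (Fin n))) :
    EquationGroup H →* FreeGroup (Option (Fin n)) :=
  Monoid.Coprod.lift ((FreeGroup.map some).comp H.subtype)
    (zpowersHom (FreeGroup (Option (Fin n))) (FreeGroup.of none))

/-- The maximal length `L` of the reduced words representing `h_1, …, h_r, g`. -/
def maxLength {n r : ℕ} {H : Subgroup (FreeGroup (Fin n))} (b : FreeGroupBasis (Fin r) H)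
    (g : FreeGroup (Fin n)) : ℕ :=
  max (Finset.univ.sup fun i => (b i : FreeGroup (Fin n)).norm) g.norm

/-! ### Lists of production rules describing a single word -/

/-- A list of production rules `N_0 → u_0, …, N_{m-1} → u_{m-1}`, one for each of the non-terminal
symbols `N_0, …, N_{m-1}`; the letter `p` is `Sum.inl p` and the symbol `N_j` is `Sum.inr j`.  The
initial symbol is the last one. -/
abbrev Rules (r : ℕ) := List (List ((Option (Fin r) × Bool) ⊕ ℕ))

/-- There is at least one rule, and the right-hand side `u_i` contains only letters and symbols
`N_j` with `j < i`. -/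
def Rules.WellFormed {r : ℕ} (G : Rules r) : Prop :=
  G ≠ [] ∧ ∀ (i : ℕ) (hi : i < G.length) (j : ℕ), Sum.inr j ∈ G[i] → j < i

/-- The words derived from `N_0, …, N_{m-1}`, in this order. -/
def Rules.words {r : ℕ} (G : Rules r) : List (List (Option (Fin r) × Bool)) :=
  G.foldl (fun ws u => ws ++ [u.flatMap (Sum.elim (fun p => [p]) (fun j => ws.getD j []))]) []

/-- The word derived from the initial symbol. -/
def Rules.word {r : ℕ} (G : Rules r) : List (Option (Fin r) × Bool) :=
  G.words.getLastD []

/-! ### Encoding of inputs and outputs as lists of integers -/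

/-- The `i`-th letter (counted from `0`) is written `i + 1`, and its inverse `-(i + 1)`. -/
def signed (i : ℕ) (ε : Bool) : ℤ := if ε then (i : ℤ) + 1 else -((i : ℤ) + 1)

/-- The code of a letter of the alphabet with `k` letters and the unknown `x`, which comes last. -/
def encodeLetter {k : ℕ} (p : Option (Fin k) × Bool) : ℤ :=
  signed (p.1.elim k Fin.val) p.2

/-- A list of integers preceded by its length. -/
def withLength (l : List ℤ) : List ℤ := (l.length : ℤ) :: l

/-- The code of a word in `k` letters and `x`. -/
def encodeWord {k : ℕ} (u : List (Option (Fin k) × Bool)) : List ℤ :=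
  withLength (u.map encodeLetter)

/-- The code of an element of `F_n`: its reduced word. -/
def encodeElement {n : ℕ} (g : FreeGroup (Fin n)) : List ℤ :=
  withLength (g.toWord.map fun p => signed p.1 p.2)

/-- The code of the input `n, r, d, h_1, …, h_r, g`. -/
def encodeInput {n r : ℕ} {H : Subgroup (FreeGroup (Fin n))} (b : FreeGroupBasis (Fin r) H)
    (g : FreeGroup (Fin n)) (d : ℕ) : List ℤ :=
  [(n : ℤ), (r : ℤ), (d : ℤ)] ++
    (List.ofFn fun i => encodeElement (b i : FreeGroup (Fin n))).flatten ++ encodeElement g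

/-- The code of a symbol on the right-hand side of a rule: letters have the codes
`±1, …, ±(r + 1)`, and `N_j` has the code `r + 2 + j`. -/
def encodeSymbol {r : ℕ} : (Option (Fin r) × Bool) ⊕ ℕ → ℤ
  | .inl p => encodeLetter p
  | .inr j => (r : ℤ) + 2 + j

/-- The code of a list of rules: the number of rules, and then the right-hand sides, each
preceded by its length. -/
def encodeRules {r : ℕ} (G : Rules r) : List ℤ :=
  (G.length : ℤ) :: G.flatMap fun u => withLength (u.map encodeSymbol)

end FreeEq

/-! Lay the reduced words of all letters `h_i^{±1}`, `x^{±1}` (with `x` spelled like `g`) side by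
side as a tape of `M` positions. A reduced word in these letters becomes a walk on the positions:
inside a letter it reads one `a_i^{±1}` at a time, and from the end of a letter `s` it may jump
silently to the start of any letter `t ≠ s⁻¹`. Up to rotation and inversion, a cyclically reduced
equation containing `x` is a closed walk at the start of `x` whose label is trivial in `F_n`; the
empty walk accounts for degree `0`.

Trivial labels have the structure of a Dyck language: the first letter cancels against a later
inverse, and the label between the two and the label after them are again trivial
(`exists_split_of_mk_cons_eq_one`). Hence the facts "some walk with trivial label and weight `k`
leads from `p` to `q`" are generated by empty walks and single jumps under two operations, wrapping
into a letter and its inverse, and concatenation (`Path.derivable`). Conversely these operations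
preserve facts (`IsFact.wrap`, `IsFact.concat`). The weight of a walk counts, for every jump, the
occurrences of `x^{±1}` at both of its ends. It is additive under concatenation, and on a closed
walk at `x` it is twice the degree (`pathWeight_add`). So only `M * M * (2 * d + 1)` facts matter. A
worklist that keeps one table entry per fact finds all derivable ones (`Processed.known`), and the
way in which a fact was first found is a production rule with at most two symbols, which refers only
to earlier rules. This settles the decision problem and yields the list of rules.

For the explicit equation a walk gets a value in `F_n * ⟨x⟩`: letters read inside coefficients
count, letters read inside the word of `x` do not, and entering `x^{±1}` contributes `x^{±1}`. A
walk of weight `0` either makes no jump or never meets `x`; in both cases its value is trivial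
(`IsFact.pathValue_eq_one`). Unfolding the rules may therefore drop every rule of weight `0`, and a
potential shows that the number of remaining steps is of order `d * M * M * (2 * d + 1)`
(`HasRules.potential_lt`). The output is freely reduced while it is produced.

With `R`, `K`, `D` for the truncated parameters `r`, `L`, `d` one has `M ≤ 8 * (R * K)`. The closure
dominates with order `M ^ 3 * (2 * d + 1) ^ 2`, so the total is of order `R ^ 3 * K ^ 3 * D ^ 2`,
which lies within both required bounds. To obtain statements about the machine itself, the algorithm
is written in a small structured language whose compiler is proved correct with exact running times
(`Cmd.compiles`), and its parts are verified by Hoare triples with time bounds (`Cmd.Ens`). -/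

namespace RAM

/-! ### A structured language for the random access machine -/

/-- The cell that holds the entry `i` of the array `c`. -/
def loc (c : ℕ) (i : ℤ) : ℤ := -((2 * i ^ 2 + i + c) ^ 2 + c + 1)

theorem loc_neg (c : ℕ) (i : ℤ) : loc c i < 0 := by
  unfold loc
  have := sq_nonneg (2 * i ^ 2 + i + c)
  omega

/-- The numbers `2 * i ^ 2 + i` are nonnegative and pairwise distinct for integral `i`, and `s ^ 2 +
c` with `0 ≤ c ≤ s` determines `s` and `c`, being smaller than `(s + 1) ^ 2`. So scalars, arrays and
auxiliary cells never collide; as all of them are negative, they also avoid the input in the cells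
`0, 1, 2, …`. The address is polynomial, hence computable in constant time. -/
theorem loc_inj {c c' : ℕ} {i i' : ℤ} : loc c i = loc c' i' ↔ c = c' ∧ i = i' := by
  refine ⟨fun h => ?_, by rintro ⟨rfl, rfl⟩; rfl⟩
  have key (j : ℤ) : 0 ≤ 2 * j ^ 2 + j := by
    rcases lt_trichotomy j 0 with h | h | h <;> nlinarith
  unfold loc at h
  obtain ⟨s, hs⟩ : ∃ s, s = 2 * i ^ 2 + i + c := ⟨_, rfl⟩
  obtain ⟨s', hs'⟩ : ∃ s, s = 2 * i' ^ 2 + i' + c' := ⟨_, rfl⟩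
  rw [← hs, ← hs'] at h
  have h1 := key i
  have h2 := key i'
  have hss : s = s' := by
    rcases lt_trichotomy s s' with h3 | h3 | h3
    · nlinarith
    · exact h3
    · nlinarith
  subst hss
  have hc : c = c' := by omega
  refine ⟨hc, ?_⟩
  subst hc
  have h3 : (i - i') * (2 * (i + i') + 1) = 0 := by linarith
  rcases mul_eq_zero.1 h3 with h4 | h4 <;> omega

/-- The store of a structured program: scalars, arrays, the unread input and the output. -/
structure Store where
  v : ℕ → ℤ
  a : ℕ → ℤ → ℤ
  inp : List ℤ
  out : List ℤ

/-- Arithmetic expressions. -/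
inductive Expr where
  | lit (c : ℤ)
  | var (x : ℕ)
  | get (a : ℕ) (e : Expr)
  | add (e f : Expr)
  | sub (e f : Expr)
  | mul (e f : Expr)

/-- Structured commands. `ite e c c'` runs `c` if `0 < e`; `loop x e c` runs `c` for
`x = 0, 1, …, e - 1`. -/
inductive Cmd where
  | skip
  | set (x : ℕ) (e : Expr)
  | put (a : ℕ) (i e : Expr)
  | read (x : ℕ)
  | write (e : Expr)
  | seq (c c' : Cmd)
  | ite (e : Expr) (c c' : Cmd)
  | loop (x : ℕ) (e : Expr) (c : Cmd)

/-- The cells for intermediate results, for the administration of loops, and for the position in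
the input. -/
def tmp (k : ℕ) : ℤ := loc 2 k
def hid (k : ℕ) : ℤ := loc 1 k
def ptr : ℤ := loc 3 0

namespace Expr

instance : Add Expr := ⟨Expr.add⟩
instance : Sub Expr := ⟨Expr.sub⟩
instance : Mul Expr := ⟨Expr.mul⟩
instance (k : ℕ) : OfNat Expr k := ⟨Expr.lit k⟩

def eval (s : Store) : Expr → ℤ
  | lit c => c
  | var x => s.v x
  | get a e => s.a a (e.eval s)
  | add e f => e.eval s + f.eval s
  | sub e f => e.eval s - f.eval s
  | mul e f => e.eval s * f.eval s

end Expr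

/-- Instructions that compute `loc c M[i]` in the cell `tmp j`, with the help of `tmp (j + 1)`. -/
def locCode (c : ℕ) (i : ℤ) (j : ℕ) : List Instr :=
  [.mul (tmp j) i i, .add (tmp j) (tmp j) (tmp j), .add (tmp j) (tmp j) i,
    .const (tmp (j + 1)) c, .add (tmp j) (tmp j) (tmp (j + 1)), .mul (tmp j) (tmp j) (tmp j),
    .add (tmp j) (tmp j) (tmp (j + 1)), .const (tmp (j + 1)) (-1),
    .sub (tmp j) (tmp (j + 1)) (tmp j)]

namespace Expr

/-- Instructions that compute the value of an expression in the cell `tmp k`. -/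
def code : Expr → ℕ → List Instr
  | lit c, k => [.const (tmp k) c]
  | var x, k => [.const (tmp k) 0, .add (tmp k) (loc 0 x) (tmp k)]
  | get a e, k => e.code k ++ locCode (4 + a) (tmp k) (k + 1) ++ [.load (tmp k) (tmp (k + 1))]
  | add e f, k => e.code k ++ f.code (k + 1) ++ [.add (tmp k) (tmp k) (tmp (k + 1))]
  | sub e f, k => e.code k ++ f.code (k + 1) ++ [.sub (tmp k) (tmp k) (tmp (k + 1))]
  | mul e f, k => e.code k ++ f.code (k + 1) ++ [.mul (tmp k) (tmp k) (tmp (k + 1))]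

def cost : Expr → ℕ
  | lit _ => 1
  | var _ => 2
  | get _ e => e.cost + 10
  | add e f => e.cost + f.cost + 1
  | sub e f => e.cost + f.cost + 1
  | mul e f => e.cost + f.cost + 1

theorem length_code (e : Expr) (k : ℕ) : (e.code k).length = e.cost := by
  induction e generalizing k <;> simp [code, cost, locCode, *] <;> omega

end Expr

namespace Store

def setVar (s : Store) (x : ℕ) (z : ℤ) : Store := { s with v := Function.update s.v x z }

end Store

namespace Cmd

/-- The effect of a command. -/
def sem : Cmd → Store → Store
  | skip, s => s
  | set x e, s => s.setVar x (e.eval s)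
  | put a i e, s =>
    { s with a := Function.update s.a a (Function.update (s.a a) (i.eval s) (e.eval s)) }
  | read x, s => { s with v := Function.update s.v x (s.inp.headD 0), inp := s.inp.tail }
  | write e, s => { s with out := s.out ++ [e.eval s] }
  | seq c c', s => c'.sem (c.sem s)
  | ite e c c', s => if 0 < e.eval s then c.sem s else c'.sem s
  | loop x e c, s =>
    Nat.rec s (fun i s' => c.sem (s'.setVar x i)) (e.eval s).toNat

/-- The store before the pass number `i` through the loop `loop x _ c`. -/
def pass (x : ℕ) (c : Cmd) (s : Store) (i : ℕ) : Store :=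
  Nat.rec s (fun i s' => c.sem (s'.setVar x i)) i

/-- The running time of a command. -/
def cost : Cmd → Store → ℕ
  | skip, _ => 0
  | set _ e, _ => e.cost + 2
  | put _ i e, _ => i.cost + e.cost + 10
  | read _, _ => 3
  | write e, _ => e.cost + 1
  | seq c c', s => c.cost s + c'.cost (c.sem s)
  | ite e c c', s => e.cost + 1 + if 0 < e.eval s then c.cost s else c'.cost s + 2
  | loop x e c, s =>
    e.cost + 3 + (∑ i ∈ Finset.range (e.eval s).toNat,
      (4 + c.cost ((pass x c s i).setVar x i) + 3)) + 4

/-- The number of instructions of a command. -/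
def size : Cmd → ℕ
  | skip => 0
  | set _ e => e.cost + 2
  | put _ i e => i.cost + e.cost + 10
  | read _ => 3
  | write e => e.cost + 1
  | seq c c' => c.size + c'.size
  | ite e c c' => e.cost + 1 + (c'.size + 2) + c.size
  | loop _ e c => e.cost + 3 + 4 + 2 + c.size + 3

/-- The instructions of a command that is nested in `d` loops, when the first of them has the
number `b`. -/
def code : Cmd → ℕ → ℕ → List Instr
  | skip, _, _ => []
  | set x e, _, _ => e.code 0 ++ [.const (tmp 1) 0, .add (loc 0 x) (tmp 0) (tmp 1)]
  | put a i e, _, _ =>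
    i.code 0 ++ e.code 1 ++ (locCode (4 + a) (tmp 0) 2 ++ [.store (tmp 2) (tmp 1)])
  | read x, _, _ => [.load (loc 0 x) ptr, .const (tmp 0) 1, .add ptr ptr (tmp 0)]
  | write e, _, _ => e.code 0 ++ [.write (tmp 0)]
  | seq c c', d, b => c.code d b ++ c'.code d (b + c.size)
  | ite e c c', d, b =>
    e.code 0 ++ ([.jumpPos (tmp 0) (b + e.cost + 1 + (c'.size + 2))] ++
      (c'.code d (b + e.cost + 1) ++ ([.const (tmp 0) 1,
        .jumpPos (tmp 0) (b + e.cost + 1 + (c'.size + 2) + c.size)] ++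
          c.code d (b + e.cost + 1 + (c'.size + 2)))))
  | loop x e c, d, b =>
    e.code 0 ++ ([.const (tmp 1) 0, .add (hid (2 * d)) (tmp 0) (tmp 1),
      .const (hid (2 * d + 1)) 0] ++
      ([.sub (tmp 0) (hid (2 * d)) (hid (2 * d + 1)), .jumpPos (tmp 0) (b + e.cost + 3 + 4),
        .const (tmp 0) 1, .jumpPos (tmp 0) (b + e.cost + 3 + 4 + 2 + c.size + 3)] ++
        ([.const (tmp 1) 0, .add (loc 0 x) (hid (2 * d + 1)) (tmp 1)] ++
          (c.code (d + 1) (b + e.cost + 3 + 4 + 2) ++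
            [.const (tmp 1) 1, .add (hid (2 * d + 1)) (hid (2 * d + 1)) (tmp 1),
              .jumpPos (tmp 1) (b + e.cost + 3)]))))

theorem length_code (c : Cmd) (d b : ℕ) : (c.code d b).length = c.size := by
  induction c generalizing d b <;>
    simp [code, size, locCode, Expr.length_code, *] <;> omega

theorem sem_loop (x : ℕ) (e : Expr) (c : Cmd) (s : Store) :
    (loop x e c).sem s = pass x c s (e.eval s).toNat := rfl

end Cmd

/-! ### Correctness of the compiler -/

/-- Instructions other than jumps and output. -/
def Instr.IsStraight : Instr → Prop
  | .jumpPos _ _ => False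
  | .write _ => False
  | _ => True

/-- The effect of a straight instruction on the memory. -/
def Instr.eff (I : Instr) (m : ℤ → ℤ) : ℤ → ℤ := (I.exec ⟨0, m, []⟩).mem

/-- The effect of a list of straight instructions on the memory. -/
def effs (l : List Instr) (m : ℤ → ℤ) : ℤ → ℤ := l.foldl (fun m I => I.eff m) m

theorem effs_nil (m : ℤ → ℤ) : effs [] m = m := rfl

theorem effs_cons (I : Instr) (l : List Instr) (m : ℤ → ℤ) :
    effs (I :: l) m = effs l (I.eff m) := rfl

section

variable (m : ℤ → ℤ) (i j k c : ℤ)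

theorem Instr.eff_const : (Instr.const i c).eff m = Function.update m i c := rfl
theorem Instr.eff_add : (Instr.add i j k).eff m = Function.update m i (m j + m k) := rfl
theorem Instr.eff_sub : (Instr.sub i j k).eff m = Function.update m i (m j - m k) := rfl
theorem Instr.eff_mul : (Instr.mul i j k).eff m = Function.update m i (m j * m k) := rfl
theorem Instr.eff_load : (Instr.load i j).eff m = Function.update m i (m (m j)) := rfl
theorem Instr.eff_store : (Instr.store i j).eff m = Function.update m (m i) (m j) := rfl

end

theorem effs_append (l l' : List Instr) (m : ℤ → ℤ) : effs (l ++ l') m = effs l' (effs l m) := by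
  simp [effs]

theorem Instr.IsStraight.exec {I : Instr} (h : I.IsStraight) (c : Config) :
    I.exec c = ⟨c.pc + 1, I.eff c.mem, c.out⟩ := by
  cases I <;> first | rfl | exact h.elim

/-- `t` steps lead from `c` to `c'`. -/
def Runs (P : Program) (c : Config) (t : ℕ) (c' : Config) : Prop := (step P)^[t] c = c'

theorem Runs.refl (P : Program) (c : Config) : Runs P c 0 c := rfl

theorem Runs.trans {P : Program} {c c' c'' : Config} {t t' : ℕ} (h : Runs P c t c')
    (h' : Runs P c' t' c'') : Runs P c (t + t') c'' := by
  rw [Runs, add_comm, Function.iterate_add_apply, h, h']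

/-- The program `P` contains the instructions `l` from number `b` on. -/
def Contains (P : Program) (b : ℕ) (l : List Instr) : Prop :=
  ∀ i, (h : i < l.length) → P[b + i]? = some l[i]

theorem Contains.left {P : Program} {b : ℕ} {l l' : List Instr} (h : Contains P b (l ++ l')) :
    Contains P b l := fun i hi => by
  rw [h i (by rw [List.length_append]; omega), List.getElem_append_left hi]

theorem Contains.right {P : Program} {b : ℕ} {l l' : List Instr} (h : Contains P b (l ++ l')) :
    Contains P (b + l.length) l' := fun i hi => by
  rw [add_assoc, h (l.length + i) (by rw [List.length_append]; omega),
    List.getElem_append_right (by omega)]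
  simp

theorem Contains.runs_one {P : Program} {b : ℕ} {I : Instr} {l : List Instr}
    (h : Contains P b (I :: l)) (m : ℤ → ℤ) (o : List ℤ) :
    Runs P ⟨b, m, o⟩ 1 (I.exec ⟨b, m, o⟩) := by
  have := h 0 (by simp)
  simp only [add_zero, List.getElem_cons_zero] at this
  simp [Runs, step, this]

theorem Contains.tail {P : Program} {b : ℕ} {I : Instr} {l : List Instr}
    (h : Contains P b (I :: l)) : Contains P (b + 1) l :=
  Contains.right (l := [I]) h

theorem Contains.runs {P : Program} {b : ℕ} {l : List Instr} (h : Contains P b l)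
    (hl : ∀ I ∈ l, I.IsStraight) (m : ℤ → ℤ) (o : List ℤ) :
    Runs P ⟨b, m, o⟩ l.length ⟨b + l.length, effs l m, o⟩ := by
  induction l generalizing b m with
  | nil => exact Runs.refl _ _
  | cons I l ih =>
    have h1 := h.runs_one m o
    rw [(hl I (by simp)).exec] at h1
    have h2 := h1.trans (ih h.tail (fun J hJ => hl J (by simp [hJ])) (I.eff m))
    simpa [effs, add_comm, add_left_comm, add_assoc] using h2

/-- Scalars and arrays of the store are represented in the memory. -/
structure Holds (s : Store) (m : ℤ → ℤ) : Prop where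
  v : ∀ x : ℕ, m (loc 0 x) = s.v x
  a : ∀ (a : ℕ) (i : ℤ), m (loc (4 + a) i) = s.a a i

theorem effs_locCode (c : ℕ) (i : ℤ) (j : ℕ) (hi : ∀ k ≥ j, i ≠ tmp k) (m : ℤ → ℤ) :
    effs (locCode c i j) m (tmp j) = loc c (m i) ∧
      ∀ x, (∀ k ≥ j, x ≠ tmp k) → effs (locCode c i j) m x = m x := by
  have h0 := hi j le_rfl
  have h1 := hi (j + 1) (by omega)
  have h2 : tmp j ≠ tmp (j + 1) := by simp [tmp, loc_inj]
  constructor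
  · simp [locCode, effs, Instr.eff, Instr.exec, h0, h2, loc, h2.symm]
    ring
  · intro x hx
    have h3 := hx j le_rfl
    have h4 := hx (j + 1) (by omega)
    simp [locCode, effs, Instr.eff, Instr.exec, Function.update_apply, h3, h4]

theorem straight_locCode (c : ℕ) (i : ℤ) (j : ℕ) : ∀ I ∈ locCode c i j, I.IsStraight := by
  simp [locCode, Instr.IsStraight]

theorem Expr.straight_code (e : Expr) (k : ℕ) : ∀ I ∈ e.code k, I.IsStraight := by
  induction e generalizing k with
  | lit c => simp [code, Instr.IsStraight]
  | var x => simp [code, Instr.IsStraight]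
  | get a e ih =>
    intro I hI
    simp only [code, List.mem_append, List.mem_singleton] at hI
    rcases hI with (h | h) | h
    · exact ih _ _ h
    · exact straight_locCode _ _ _ _ h
    · subst h; trivial
  | _ e f he hf =>
    intro I hI
    simp only [code, List.mem_append, List.mem_singleton] at hI
    rcases hI with (h | h) | h
    · exact he _ _ h
    · exact hf _ _ h
    · subst h; trivial

theorem Holds.congr {s : Store} {m m' : ℤ → ℤ} (h : Holds s m) (k : ℕ)
    (hm : ∀ x, (∀ j ≥ k, x ≠ tmp j) → m' x = m x) : Holds s m' := by
  refine ⟨fun x => ?_, fun a i => ?_⟩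
  · rw [hm _ (fun j _ => by simp [tmp, loc_inj]), h.v]
  · rw [hm _ (fun j _ => by simp [tmp, loc_inj]; omega), h.a]

/-- The cells `tmp j` with `j ≥ k` serve as an evaluation stack: the second operand is computed from
`tmp (k + 1)` upwards, so the first one survives in `tmp k`. -/
theorem Expr.effs_code (e : Expr) (k : ℕ) (s : Store) (m : ℤ → ℤ) (h : Holds s m) :
    effs (e.code k) m (tmp k) = e.eval s ∧
      ∀ x, (∀ j ≥ k, x ≠ tmp j) → effs (e.code k) m x = m x := by
  induction e generalizing k m with
  | lit c =>
    refine ⟨by simp [code, effs, Instr.eff, Instr.exec, eval], fun x hx => ?_⟩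
    simp [code, effs, Instr.eff, Instr.exec, hx k le_rfl]
  | var x =>
    have h1 : loc 0 x ≠ tmp k := by simp [tmp, loc_inj]
    refine ⟨by simp [code, effs, Instr.eff, Instr.exec, eval, h1, h.v], fun x hx => ?_⟩
    simp [code, effs, Instr.eff, Instr.exec, hx k le_rfl]
  | get a e ih =>
    obtain ⟨h1, h2⟩ := ih k m h
    obtain ⟨h3, h4⟩ := effs_locCode (4 + a) (tmp k) (k + 1)
      (fun j hj => by simp [tmp, loc_inj]; omega) (effs (e.code k) m)
    have h5 := (h.congr k h2).congr (k + 1) h4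
    refine ⟨?_, fun x hx => ?_⟩
    · rw [code, effs_append, effs_append]
      simp only [effs_cons, effs_nil, Instr.eff_load, Function.update_self]
      rw [h3, h1, h5.a, eval]
    · rw [code, effs_append, effs_append, ← h2 x hx, ← h4 x (fun j hj => hx j (by omega))]
      simp [effs, Instr.eff, Instr.exec, hx k le_rfl]
  | _ e f he hf =>
    obtain ⟨h1, h2⟩ := he k m h
    obtain ⟨h3, h4⟩ := hf (k + 1) _ (h.congr k h2)
    have h5 := h4 (tmp k) (fun j hj => by simp [tmp, loc_inj]; omega)
    refine ⟨?_, fun x hx => ?_⟩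
    · rw [code, effs_append, effs_append]
      simp only [effs_cons, effs_nil, Instr.eff_add, Instr.eff_sub, Instr.eff_mul,
        Function.update_self]
      rw [h3, h5, h1, eval]
    · rw [code, effs_append, effs_append, ← h2 x hx, ← h4 x (fun j hj => hx j (by omega))]
      simp [effs, Instr.eff, Instr.exec, hx k le_rfl]

/-- The store is represented in the memory. -/
structure Represents (s : Store) (m : ℤ → ℤ) : Prop extends Holds s m where
  ptr_nonneg : 0 ≤ m ptr
  inp : ∀ i : ℕ, m (m ptr + i) = s.inp.getD i 0

theorem Represents.congr {s : Store} {m m' : ℤ → ℤ} (h : Represents s m)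
    (hm : ∀ x, (∀ j, x ≠ tmp j) → (∀ j, x ≠ hid j) → m' x = m x) : Represents s m' := by
  have h1 : m' ptr = m ptr := hm _ (fun j => by simp [ptr, tmp, loc_inj])
    (fun j => by simp [ptr, hid, loc_inj])
  refine ⟨⟨fun x => ?_, fun a i => ?_⟩, h1 ▸ h.ptr_nonneg, fun i => ?_⟩
  · rw [hm _ (fun j => by simp [tmp, loc_inj]) (fun j => by simp [hid, loc_inj]), h.v]
  · rw [hm _ (fun j => by simp [tmp, loc_inj]; omega)
      (fun j => by simp [hid, loc_inj]; omega), h.a]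
  · have h2 := h.ptr_nonneg
    rw [h1, hm, h.inp]
    · intro j h3
      have := loc_neg 2 j
      rw [tmp] at h3
      omega
    · intro j h3
      have := loc_neg 1 j
      rw [hid] at h3
      omega

end RAM

/-! ### Simulation of the structured commands by their compiled code. -/

namespace RAM

theorem Represents.out {s : Store} {m : ℤ → ℤ} (h : Represents s m) (o : List ℤ) :
    Represents { s with out := o } m :=
  ⟨⟨h.v, h.a⟩, h.ptr_nonneg, h.inp⟩

theorem Runs.congr {P : Program} {c : Config} {t t' pc pc' : ℕ} {m : ℤ → ℤ} {o : List ℤ}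
    (h : Runs P c t ⟨pc, m, o⟩) (ht : t = t') (hpc : pc = pc') : Runs P c t' ⟨pc', m, o⟩ := by
  rwa [← ht, ← hpc]

theorem loc_ne_tmp {c : ℕ} (hc : c ≠ 2) (i : ℤ) (j : ℕ) : loc c i ≠ tmp j := by
  simp [tmp, loc_inj, hc]

theorem loc_ne_hid {c : ℕ} (hc : c ≠ 1) (i : ℤ) (j : ℕ) : loc c i ≠ hid j := by
  simp [hid, loc_inj, hc]

theorem hid_ne_tmp (i j : ℕ) : hid i ≠ tmp j := loc_ne_tmp (by omega) _ _

theorem loc_ne_of_nonneg {c : ℕ} {i z : ℤ} (hz : 0 ≤ z) : z ≠ loc c i := by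
  have := loc_neg c i
  omega

theorem Represents.setVar {s : Store} {m m' : ℤ → ℤ} (h : Represents s m) (x : ℕ) (z : ℤ)
    (hm : ∀ y, (∀ j, y ≠ tmp j) → (∀ j, y ≠ hid j) → y ≠ loc 0 x → m' y = m y)
    (hx : m' (loc 0 x) = z) : Represents (s.setVar x z) m' := by
  have h1 : m' ptr = m ptr := hm _ (fun j => loc_ne_tmp (by omega) _ _)
    (fun j => loc_ne_hid (by omega) _ _) (by simp [ptr, loc_inj])
  refine ⟨⟨fun y => ?_, fun a i => ?_⟩, h1 ▸ h.ptr_nonneg, fun i => ?_⟩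
  · by_cases hy : y = x
    · subst hy
      simp [Store.setVar, hx]
    · rw [hm _ (fun j => loc_ne_tmp (by omega) _ _) (fun j => loc_ne_hid (by omega) _ _)
        (by simp [loc_inj, hy]), h.v]
      simp [Store.setVar, hy]
  · rw [hm _ (fun j => loc_ne_tmp (by omega) _ _) (fun j => loc_ne_hid (by omega) _ _)
      (by simp [loc_inj]), h.a]
    rfl
  · have h2 := h.ptr_nonneg
    rw [h1, hm _ (fun j => loc_ne_of_nonneg (by omega)) (fun j => loc_ne_of_nonneg (by omega))
      (loc_ne_of_nonneg (by omega)), h.inp]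
    rfl

theorem Represents.put {s : Store} {m m' : ℤ → ℤ} (h : Represents s m) (a : ℕ) (i z : ℤ)
    (hm : ∀ y, (∀ j, y ≠ tmp j) → (∀ j, y ≠ hid j) → y ≠ loc (4 + a) i → m' y = m y)
    (hx : m' (loc (4 + a) i) = z) :
    Represents { s with a := Function.update s.a a (Function.update (s.a a) i z) } m' := by
  have h1 : m' ptr = m ptr := hm _ (fun j => loc_ne_tmp (by omega) _ _)
    (fun j => loc_ne_hid (by omega) _ _) (by simp [ptr, loc_inj]; omega)
  refine ⟨⟨fun y => ?_, fun a' i' => ?_⟩, h1 ▸ h.ptr_nonneg, fun i => ?_⟩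
  · rw [hm _ (fun j => loc_ne_tmp (by omega) _ _) (fun j => loc_ne_hid (by omega) _ _)
      (by simp [loc_inj]; omega), h.v]
  · by_cases hy : a' = a ∧ i' = i
    · obtain ⟨rfl, rfl⟩ := hy
      simp [hx]
    · rw [hm _ (fun j => loc_ne_tmp (by omega) _ _) (fun j => loc_ne_hid (by omega) _ _)
        (by simpa [loc_inj] using hy), h.a]
      by_cases ha : a' = a
      · subst ha
        have hi : i' ≠ i := by simpa using hy
        simp [hi]
      · simp [ha]
  · have h2 := h.ptr_nonneg
    rw [h1, hm _ (fun j => loc_ne_of_nonneg (by omega)) (fun j => loc_ne_of_nonneg (by omega))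
      (loc_ne_of_nonneg (by omega)), h.inp]

theorem Represents.eval {s : Store} {m : ℤ → ℤ} (h : Represents s m) (e : Expr) {P : Program}
    {b : ℕ} (k : ℕ) (hP : Contains P b (e.code k)) (o : List ℤ) :
    ∃ m', Runs P ⟨b, m, o⟩ e.cost ⟨b + e.cost, m', o⟩ ∧ m' (tmp k) = e.eval s ∧
      (∀ x, (∀ j ≥ k, x ≠ tmp j) → m' x = m x) ∧ Represents s m' := by
  have h1 := hP.runs (e.straight_code k) m o
  obtain ⟨h2, h3⟩ := e.effs_code k s m h.toHolds
  rw [e.length_code] at h1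
  exact ⟨_, h1, h2, h3, h.congr fun x hx _ => h3 x fun j _ => hx j⟩

theorem Cmd.cost_loop_eq (x : ℕ) (e : Expr) (c : Cmd) (s : Store) :
    (loop x e c).cost s = e.cost + 3 + (∑ i ∈ Finset.range (e.eval s).toNat,
      (4 + c.cost ((pass x c s i).setVar x i) + 3)) + 4 := rfl

/-- The compiled command runs as the command does. -/
def Cmd.Compiles (c : Cmd) : Prop :=
  ∀ (d : ℕ) (P : Program) (b : ℕ), Contains P b (c.code d b) →
    ∀ (s : Store) (m : ℤ → ℤ), Represents s m →
      ∃ m', Runs P ⟨b, m, s.out⟩ (c.cost s) ⟨b + c.size, m', (c.sem s).out⟩ ∧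
        Represents (c.sem s) m' ∧ ∀ j < 2 * d, m' (hid j) = m (hid j)

theorem Cmd.compiles_set (x : ℕ) (e : Expr) : (set x e).Compiles := by
  intro d P b hP s m h
  rw [code] at hP
  obtain ⟨m₁, hr, h1, h2, h3⟩ := h.eval e 0 hP.left s.out
  have hs := hP.right.runs (by simp [Instr.IsStraight]) m₁ s.out
  rw [e.length_code] at hs
  refine ⟨_, hr.trans hs, ?_, fun j _ => ?_⟩
  · have hne0 : tmp 0 ≠ tmp 1 := by simp [tmp, loc_inj]
    refine h3.setVar x _ (fun y hy _ hy' => ?_) ?_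
    · simp [effs_cons, effs_nil, Instr.eff_const, Instr.eff_add, hy, hy']
    · simp [effs_cons, effs_nil, Instr.eff_const, Instr.eff_add, h1, hne0]
  · rw [← h2 (hid j) (fun k _ => hid_ne_tmp j k)]
    have := (loc_ne_hid (c := 0) (by omega) x j).symm
    simp [effs_cons, effs_nil, Instr.eff_const, Instr.eff_add, hid_ne_tmp, this]

theorem Cmd.compiles_put (a : ℕ) (i e : Expr) : (put a i e).Compiles := by
  intro d P b hP s m h
  rw [code] at hP
  obtain ⟨m₁, hr, h1, h2, h3⟩ := h.eval i 0 hP.left.left s.out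
  have hP1 := hP.left.right
  have hP2 := hP.right
  rw [i.length_code] at hP1
  rw [List.length_append, i.length_code, e.length_code, ← add_assoc] at hP2
  obtain ⟨m₂, hr', h1', h2', h3'⟩ := h3.eval e 1 hP1 s.out
  obtain ⟨h4, h5⟩ := effs_locCode (4 + a) (tmp 0) 2
    (fun j hj => by simp [tmp, loc_inj]; omega) m₂
  have hs := hP2.runs (by
    intro I hI
    rcases List.mem_append.1 hI with h | h
    · exact straight_locCode _ _ _ _ h
    · simp only [List.mem_singleton] at h
      subst h
      trivial) m₂ s.out
  rw [effs_append, effs_cons, effs_nil, Instr.eff_store, h4,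
    h5 (tmp 1) (fun k hk => by simp [tmp, loc_inj]; omega), h1',
    h2' (tmp 0) (fun k hk => by simp [tmp, loc_inj]; omega), h1, List.length_append,
    show (locCode (4 + a) (tmp 0) 2).length = 9 from rfl] at hs
  refine ⟨_, ((hr.trans hr').trans hs).congr rfl (by simp only [size, List.length_singleton]; omega), ?_,
    fun j _ => ?_⟩
  · refine h3'.put a _ _ (fun y hy _ hy' => ?_) (by simp)
    rw [Function.update_of_ne hy', h5 _ fun k _ => hy k]
  · rw [Function.update_of_ne (loc_ne_hid (by omega) _ _).symm,
      h5 _ fun k _ => hid_ne_tmp _ _, h2' _ fun k _ => hid_ne_tmp _ _,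
      h2 _ fun k _ => hid_ne_tmp _ _]

theorem Cmd.compiles_read (x : ℕ) : (read x).Compiles := by
  intro d P b hP s m h
  have hs := hP.runs (by simp [code, Instr.IsStraight]) m s.out
  have hx : loc 0 x ≠ ptr := by simp [ptr, loc_inj]
  have ht : ptr ≠ tmp 0 := loc_ne_tmp (by omega) _ _
  have ht' : loc 0 x ≠ tmp 0 := loc_ne_tmp (by omega) _ _
  set m' := effs ((read x).code d b) m with hm'
  have hp : m' ptr = m ptr + 1 := by
    simp [hm', code, effs_cons, effs_nil, Instr.eff_load, Instr.eff_const, Instr.eff_add, hx.symm,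
      ht]
  have hv : m' (loc 0 x) = s.inp.headD 0 := by
    have := h.inp 0
    simp only [Nat.cast_zero, add_zero] at this
    simp [hm', code, effs_cons, effs_nil, Instr.eff_load, Instr.eff_const, Instr.eff_add, hx,
      ht', this]
    cases s.inp <;> rfl
  have ho : ∀ y, y ≠ tmp 0 → y ≠ loc 0 x → y ≠ ptr → m' y = m y := by
    intro y h1 h2 h3
    simp [hm', code, effs_cons, effs_nil, Instr.eff_load, Instr.eff_const, Instr.eff_add, h1, h2,
      h3]
  refine ⟨m', hs, ⟨⟨fun y => ?_, fun a i => ?_⟩, ?_, fun i => ?_⟩, fun j _ => ?_⟩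
  · by_cases hy : y = x
    · subst hy
      simp [sem, hv]
    · rw [ho _ (loc_ne_tmp (by omega) _ _) (by simp [loc_inj, hy]) (by simp [ptr, loc_inj]), h.v]
      simp [sem, hy]
  · rw [ho _ (loc_ne_tmp (by omega) _ _) (by simp [loc_inj])
      (by simp [ptr, loc_inj]; omega), h.a]
    rfl
  · have := h.ptr_nonneg
    omega
  · have := h.ptr_nonneg
    rw [hp, ho _ (loc_ne_of_nonneg (by omega)) (loc_ne_of_nonneg (by omega))
      (loc_ne_of_nonneg (by omega))]
    have h4 := h.inp (i + 1)
    push_cast at h4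
    rw [show m ptr + 1 + (i : ℤ) = m ptr + (i + 1) by ring, h4]
    simp only [sem]
    cases s.inp <;> simp
  · exact ho _ (hid_ne_tmp _ _) (loc_ne_hid (by omega) _ _).symm (loc_ne_hid (by omega) _ _).symm

theorem Cmd.compiles_write (e : Expr) : (write e).Compiles := by
  intro d P b hP s m h
  rw [code] at hP
  obtain ⟨m₁, hr, h1, h2, h3⟩ := h.eval e 0 hP.left s.out
  have hs := hP.right.runs_one m₁ s.out
  rw [e.length_code] at hs
  refine ⟨m₁, ?_, h3.out _, fun j _ => h2 _ fun k _ => hid_ne_tmp _ _⟩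
  simp only [Instr.exec, h1] at hs
  exact hr.trans hs

theorem Cmd.compiles_seq {c c' : Cmd} (hc : c.Compiles) (hc' : c'.Compiles) :
    (seq c c').Compiles := by
  intro d P b hP s m h
  rw [code] at hP
  obtain ⟨m₁, h1, h2, h3⟩ := hc d P b hP.left s m h
  have hP' := hP.right
  rw [c.length_code] at hP'
  obtain ⟨m₂, h4, h5, h6⟩ := hc' d P _ hP' _ m₁ h2
  refine ⟨m₂, ?_, h5, fun j hj => by rw [h6 j hj, h3 j hj]⟩
  have := h1.trans h4
  rwa [add_assoc] at this

theorem Represents.update_tmp {s : Store} {m : ℤ → ℤ} (h : Represents s m) (k : ℕ) (z : ℤ) :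
    Represents s (Function.update m (tmp k) z) :=
  h.congr fun _ hx _ => Function.update_of_ne (hx k) _ _

theorem Represents.update_hid {s : Store} {m : ℤ → ℤ} (h : Represents s m) (k : ℕ) (z : ℤ) :
    Represents s (Function.update m (hid k) z) :=
  h.congr fun _ _ hx => Function.update_of_ne (hx k) _ _

/-- The only jump is taken on positive values, so the code of `c'` comes first and ends with a jump
over `c` on the constant `1`. These two instructions are the `+ 2` in the cost of the second branch.
-/
theorem Cmd.compiles_ite (e : Expr) {c c' : Cmd} (hc : c.Compiles) (hc' : c'.Compiles) :
    (ite e c c').Compiles := by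
  intro d P b hP s m h
  rw [code] at hP
  obtain ⟨m₁, hr, h1, h2, h3⟩ := h.eval e 0 hP.left s.out
  have hP1 := hP.right
  rw [e.length_code] at hP1
  have hj := hP1.left.runs_one m₁ s.out
  have hP2 := hP1.right
  have hP3 := hP2.right
  have hP4 := hP3.right
  simp only [c'.length_code, List.length_cons, List.length_nil] at hP2 hP3 hP4
  by_cases hpos : 0 < e.eval s
  · simp only [Instr.exec, h1, hpos, if_true] at hj
    obtain ⟨m₂, h4, h5, h6⟩ := hc d P (b + e.cost + 1 + (c'.size + 2))
      (by simpa [add_assoc] using hP4) s m₁ h3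
    refine ⟨m₂, ?_, ?_, fun j hj => by rw [h6 j hj, h2 _ fun k _ => hid_ne_tmp _ _]⟩
    · have := (hr.trans hj).trans h4
      simp only [cost, sem, size, hpos, if_true]
      exact this.congr (by omega) (by omega)
    · simpa [sem, hpos] using h5
  · simp only [Instr.exec, h1, hpos, if_false] at hj
    obtain ⟨m₂, h4, h5, h6⟩ := hc' d P (b + e.cost + 1) hP2.left s m₁ h3
    have hk := hP3.left.runs_one m₂ (c'.sem s).out
    have hk' := hP3.left.tail.runs_one (Function.update m₂ (tmp 0) 1) (c'.sem s).out
    simp only [Instr.exec, Function.update_self, one_pos, if_true] at hk hk'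
    refine ⟨Function.update m₂ (tmp 0) 1, ?_, ?_, fun j hj => ?_⟩
    rotate_left
    · simp only [sem, hpos, if_false]
      exact h5.update_tmp 0 1
    · rw [Function.update_of_ne (hid_ne_tmp _ _), h6 j hj, h2 _ fun k _ => hid_ne_tmp _ _]
    · have := (((hr.trans hj).trans h4).trans hk).trans hk'
      simp only [cost, sem, size, hpos, if_false]
      exact this.congr (by omega) (by omega)

/-- A loop at nesting depth `d` keeps its bound in `hid (2 * d)` and its counter in `hid (2 * d +
1)`. The body is compiled for depth `d + 1` and preserves these two cells. The bound is evaluated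
once, and the loop variable is a copy of the counter, so that the body cannot disturb the number of
passes. -/
theorem Cmd.compiles_loop (x : ℕ) (e : Expr) {c : Cmd} (hc : c.Compiles) :
    (loop x e c).Compiles := by
  intro d P b hP s m h
  rw [code] at hP
  obtain ⟨m₁, hr, h1, h2, h3⟩ := h.eval e 0 hP.left s.out
  have hP1 := hP.right
  rw [e.length_code] at hP1
  have hP2 := hP1.right
  have hP3 := hP2.right
  have hP4 := hP3.right
  have hP5 := hP4.right
  simp only [c.length_code, List.length_cons, List.length_nil, zero_add, Nat.reduceAdd]
    at hP2 hP3 hP4 hP5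
  set N := (e.eval s).toNat with hN
  have hst := hP1.left.runs (by simp [Instr.IsStraight]) m₁ s.out
  simp only [List.length_cons, List.length_nil, zero_add, Nat.reduceAdd, effs_cons, effs_nil,
    Instr.eff_const, Instr.eff_add] at hst
  obtain ⟨m₂, hm₂⟩ : ∃ m₂, m₂ = Function.update (Function.update (Function.update m₁ (tmp 1) 0)
    (hid (2 * d)) (Function.update m₁ (tmp 1) 0 (tmp 0) + Function.update m₁ (tmp 1) 0 (tmp 1)))
    (hid (2 * d + 1)) 0 := ⟨_, rfl⟩
  rw [← hm₂] at hst
  have hne : hid (2 * d) ≠ hid (2 * d + 1) := by simp [hid, loc_inj]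
  have hne0 : tmp 0 ≠ tmp 1 := by simp [tmp, loc_inj]
  -- the state of affairs at the head of the loop
  have key : ∀ i ≤ N, ∃ m', Runs P ⟨b + e.cost + 3, m₂, s.out⟩
      (∑ i ∈ Finset.range i, (4 + c.cost ((pass x c s i).setVar x i) + 3))
      ⟨b + e.cost + 3, m', (pass x c s i).out⟩ ∧ Represents (pass x c s i) m' ∧
      (∀ j < 2 * d, m' (hid j) = m (hid j)) ∧ m' (hid (2 * d)) = e.eval s ∧
      m' (hid (2 * d + 1)) = i := by
    intro i hi
    induction i with
    | zero =>
      refine ⟨m₂, Runs.refl _ _, ?_, fun j hj => ?_, ?_, ?_⟩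
      · rw [hm₂]
        exact ((h3.update_tmp _ _).update_hid _ _).update_hid _ _
      · rw [hm₂, Function.update_of_ne (by simp [hid, loc_inj]; omega),
          Function.update_of_ne (by simp [hid, loc_inj]; omega),
          Function.update_of_ne (hid_ne_tmp _ _), h2 _ fun k _ => hid_ne_tmp _ _]
      · simp [hm₂, hne, hne0, h1]
      · simp [hm₂]
    | succ i ih =>
      obtain ⟨m', r1, r2, r3, r4, r5⟩ := ih (by omega)
      have hpos : 0 < e.eval s - i := by omega
      have q1 := hP2.left.runs_one m' (pass x c s i).out
      have q2 := hP2.left.tail.runs_one (Function.update m' (tmp 0) (e.eval s - i))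
        (pass x c s i).out
      simp only [Instr.exec, r4, r5, Function.update_self, hpos, if_true] at q1 q2
      have q3 := hP3.left.runs (by simp [Instr.IsStraight])
        (Function.update m' (tmp 0) (e.eval s - i)) (pass x c s i).out
      simp only [List.length_cons, List.length_nil, zero_add, Nat.reduceAdd, effs_cons, effs_nil,
        Instr.eff_const, Instr.eff_add] at q3
      obtain ⟨m₃, hm₃⟩ : ∃ m₃, m₃ = Function.update
        (Function.update (Function.update m' (tmp 0) (e.eval s - i)) (tmp 1) 0) (loc 0 x)
        (Function.update (Function.update m' (tmp 0) (e.eval s - i)) (tmp 1) 0 (hid (2 * d + 1)) +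
          Function.update (Function.update m' (tmp 0) (e.eval s - i)) (tmp 1) 0 (tmp 1)) :=
        ⟨_, rfl⟩
      rw [← hm₃] at q3
      have hid3 : ∀ j, m₃ (hid j) = m' (hid j) := by
        intro j
        rw [hm₃, Function.update_of_ne (loc_ne_hid (by omega) _ _).symm,
          Function.update_of_ne (hid_ne_tmp _ _), Function.update_of_ne (hid_ne_tmp _ _)]
      have r2' : Represents ((pass x c s i).setVar x i) m₃ := by
        refine r2.setVar x _ (fun y hy _ hy' => ?_) ?_
        · rw [hm₃, Function.update_of_ne hy', Function.update_of_ne (hy 1),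
            Function.update_of_ne (hy 0)]
        · simp [hm₃, hid_ne_tmp, r5]
      obtain ⟨m₄, q4, q5, q6⟩ := hc (d + 1) P (b + e.cost + 3 + 4 + 2) hP4.left _ m₃ r2'
      have q7 := hP5.runs_one m₄ (pass x c s (i + 1)).out
      have q8 := hP5.tail.runs_one (Function.update m₄ (tmp 1) 1) (pass x c s (i + 1)).out
      have hq : m₄ (hid (2 * d + 1)) = i := by rw [q6 _ (by omega), hid3, r5]
      simp only [Instr.exec, Function.update_self, Function.update_of_ne (hid_ne_tmp _ _), hq]
        at q7 q8
      have q9 := hP5.tail.tail.runs_one (Function.update (Function.update m₄ (tmp 1) 1)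
        (hid (2 * d + 1)) (i + 1)) (pass x c s (i + 1)).out
      simp only [Instr.exec, Function.update_self,
        Function.update_of_ne (hid_ne_tmp (2 * d + 1) 1).symm, one_pos, if_true] at q9
      refine ⟨Function.update (Function.update m₄ (tmp 1) 1) (hid (2 * d + 1)) (i + 1), ?_, ?_,
        fun j hj => ?_, ?_, ?_⟩
      rotate_left
      · exact (q5.update_tmp 1 1).update_hid _ _
      · rw [Function.update_of_ne (by simp [hid, loc_inj]; omega),
          Function.update_of_ne (hid_ne_tmp _ _), q6 _ (by omega), hid3, r3 _ hj]
      · rw [Function.update_of_ne hne, Function.update_of_ne (hid_ne_tmp _ _), q6 _ (by omega),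
          hid3, r4]
      · simp
      · rw [Finset.sum_range_succ]
        have := r1.trans ((((((q1.trans q2).trans q3).trans q4).trans q7).trans q8).trans q9)
        exact this.congr (by ring) (by ring)
  obtain ⟨m', r1, r2, r3, r4, r5⟩ := key N le_rfl
  have hneg : ¬ 0 < e.eval s - (N : ℤ) := by omega
  have q1 := hP2.left.runs_one m' (pass x c s N).out
  have q2 := hP2.left.tail.runs_one (Function.update m' (tmp 0) (e.eval s - N)) (pass x c s N).out
  simp only [Instr.exec, r4, r5, Function.update_self, hneg, if_false] at q1 q2
  have q3 := hP2.left.tail.tail.runs_one (Function.update m' (tmp 0) (e.eval s - N))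
    (pass x c s N).out
  have q4 := hP2.left.tail.tail.tail.runs_one (Function.update (Function.update m' (tmp 0)
    (e.eval s - N)) (tmp 0) 1) (pass x c s N).out
  simp only [Instr.exec, Function.update_self, one_pos, if_true] at q3 q4
  refine ⟨Function.update (Function.update m' (tmp 0) (e.eval s - N)) (tmp 0) 1, ?_,
    (r2.update_tmp 0 (e.eval s - N)).update_tmp 0 1, fun j hj => ?_⟩
  · have := (hr.trans hst).trans (r1.trans (((q1.trans q2).trans q3).trans q4))
    rw [sem_loop, cost_loop_eq]
    exact this.congr (by ring) (by simp only [size]; ring)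
  · rw [Function.update_of_ne (hid_ne_tmp _ _), Function.update_of_ne (hid_ne_tmp _ _), r3 j hj]

theorem Cmd.compiles (c : Cmd) : c.Compiles := by
  induction c with
  | skip => exact fun d P b _ s m h => ⟨m, Runs.refl _ _, h, fun _ _ => rfl⟩
  | set x e => exact compiles_set x e
  | put a i e => exact compiles_put a i e
  | read x => exact compiles_read x
  | write e => exact compiles_write e
  | seq c c' h h' => exact compiles_seq h h'
  | ite e c c' h h' => exact compiles_ite e h h'
  | loop x e c h => exact compiles_loop x e h

/-- The store at the start of a program. -/
def Store.init (input : List ℤ) : Store := ⟨fun _ => 0, fun _ _ => 0, input, []⟩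

theorem represents_start (input : List ℤ) : Represents (Store.init input) (start input).mem := by
  have h (c : ℕ) (i : ℤ) : (start input).mem (loc c i) = 0 := by
    have := loc_neg c i
    simp only [start]
    rw [if_neg (by omega)]
  refine ⟨⟨fun x => h _ _, fun a i => h _ _⟩, (h _ _).ge, fun i => ?_⟩
  rw [ptr, h]
  simp [start, Store.init]

/-- The code of `c` is a prefix of the code of the sequence. This gives the output at an
intermediate time, before `c'` has run. -/
theorem run_code_seq (c c' : Cmd) (input : List ℤ) :
    HasWritten ((Cmd.seq c c').code 0 0) input (c.cost (Store.init input))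
      (c.sem (Store.init input)).out := by
  have hP : Contains ((Cmd.seq c c').code 0 0) 0 ((Cmd.seq c c').code 0 0) := fun i hi => by
    simp [hi]
  obtain ⟨m, h, -⟩ := c.compiles 0 _ 0 hP.left _ _ (represents_start input)
  rw [HasWritten, run]
  exact congrArg Config.out h

theorem haltsWith_code (c : Cmd) (input : List ℤ) :
    HaltsWith (c.code 0 0) input (c.cost (Store.init input)) (c.sem (Store.init input)).out := by
  have hP : Contains (c.code 0 0) 0 (c.code 0 0) := fun i hi => by
    simp [hi]
  obtain ⟨m, h, -⟩ := c.compiles 0 _ 0 hP _ _ (represents_start input)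
  have h' : run (c.code 0 0) input (c.cost (Store.init input)) = _ := h
  rw [HaltsWith, h', c.length_code]
  exact ⟨by simp, rfl⟩

end RAM

namespace RAM

/-! ### Reasoning about structured programs -/

infixr:60 " ;; " => Cmd.seq

namespace Expr

variable (s : Store) (e f : Expr)

@[simp] theorem eval_var (x : ℕ) : (var x).eval s = s.v x := rfl
@[simp] theorem eval_get (a : ℕ) : (get a e).eval s = s.a a (e.eval s) := rfl
@[simp] theorem eval_add : (e + f).eval s = e.eval s + f.eval s := rfl
@[simp] theorem eval_sub : (e - f).eval s = e.eval s - f.eval s := rfl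
@[simp] theorem eval_mul : (e * f).eval s = e.eval s * f.eval s := rfl
@[simp] theorem eval_zero : (0 : Expr).eval s = 0 := rfl
@[simp] theorem eval_one : (1 : Expr).eval s = 1 := rfl
@[simp] theorem eval_two : (2 : Expr).eval s = 2 := rfl
@[simp] theorem eval_three : (3 : Expr).eval s = 3 := rfl
@[simp] theorem eval_eight : (8 : Expr).eval s = 8 := rfl

end Expr

namespace Store

variable (s : Store) (x : ℕ) (z : ℤ)

@[simp] theorem setVar_v (y : ℕ) : (s.setVar x z).v y = if y = x then z else s.v y := by
  simp [setVar, Function.update_apply]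

@[simp] theorem setVar_a : (s.setVar x z).a = s.a := rfl
@[simp] theorem setVar_inp : (s.setVar x z).inp = s.inp := rfl
@[simp] theorem setVar_out : (s.setVar x z).out = s.out := rfl

/-- Write `z` to the entry `i` of the array `a`. -/
def putArr (a : ℕ) (i z : ℤ) : Store :=
  { s with a := Function.update s.a a (Function.update (s.a a) i z) }

@[simp] theorem putArr_a (a b : ℕ) (i z : ℤ) :
    (s.putArr a i z).a b = if b = a then Function.update (s.a a) i z else s.a b := by
  by_cases h : b = a
  · subst h; simp [putArr]
  · simp [putArr, h]

@[simp] theorem putArr_v (a : ℕ) (i z : ℤ) : (s.putArr a i z).v = s.v := rfl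
@[simp] theorem putArr_inp (a : ℕ) (i z : ℤ) : (s.putArr a i z).inp = s.inp := rfl
@[simp] theorem putArr_out (a : ℕ) (i z : ℤ) : (s.putArr a i z).out = s.out := rfl

end Store

namespace Cmd

variable (s : Store)

@[simp] theorem sem_skip : skip.sem s = s := rfl
@[simp] theorem sem_set (x : ℕ) (e : Expr) : (set x e).sem s = s.setVar x (e.eval s) := rfl
@[simp] theorem sem_put (a : ℕ) (i e : Expr) :
    (put a i e).sem s = s.putArr a (i.eval s) (e.eval s) := rfl
@[simp] theorem sem_write (e : Expr) :
    (write e).sem s = { s with out := s.out ++ [e.eval s] } := rfl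
@[simp] theorem sem_seq (c c' : Cmd) : (c ;; c').sem s = c'.sem (c.sem s) := rfl
@[simp] theorem sem_ite (e : Expr) (c c' : Cmd) :
    (ite e c c').sem s = if 0 < e.eval s then c.sem s else c'.sem s := rfl

/-- The scalars that a command may change. -/
def vars : Cmd → List ℕ
  | skip => []
  | set x _ => [x]
  | put _ _ _ => []
  | read x => [x]
  | write _ => []
  | seq c c' => c.vars ++ c'.vars
  | ite _ c c' => c.vars ++ c'.vars
  | loop x _ c => x :: c.vars

/-- The arrays that a command may change. -/
def arrs : Cmd → List ℕ
  | skip => []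
  | set _ _ => []
  | put a _ _ => [a]
  | read _ => []
  | write _ => []
  | seq c c' => c.arrs ++ c'.arrs
  | ite _ c c' => c.arrs ++ c'.arrs
  | loop _ _ c => c.arrs

/-- The command writes no output. -/
def silent : Cmd → Bool
  | write _ => false
  | seq c c' => c.silent && c'.silent
  | ite _ c c' => c.silent && c'.silent
  | loop _ _ c => c.silent
  | _ => true

theorem sem_v {x : ℕ} (c : Cmd) (h : x ∉ c.vars) (s : Store) : (c.sem s).v x = s.v x := by
  induction c generalizing s with
  | skip => rfl
  | set y e => simp_all [vars]
  | put a i e => rfl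
  | read y => simp_all [vars, sem]
  | write e => rfl
  | seq c c' ih ih' => simp_all [vars]
  | ite e c c' ih ih' =>
    simp only [vars, List.mem_append, not_or] at h
    rw [sem_ite]
    split
    · exact ih h.1 s
    · exact ih' h.2 s
  | loop y e c ih =>
    simp only [vars, List.mem_cons, not_or] at h
    rw [sem_loop]
    induction (e.eval s).toNat with
    | zero => rfl
    | succ i ihi =>
      refine (ih h.2 ((pass y c s i).setVar y i)).trans ?_
      rw [Store.setVar_v, if_neg h.1, ihi]

theorem sem_a {a : ℕ} (c : Cmd) (h : a ∉ c.arrs) (s : Store) : (c.sem s).a a = s.a a := by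
  induction c generalizing s with
  | skip => rfl
  | set y e => rfl
  | put b i e => simp_all [arrs]
  | read y => rfl
  | write e => rfl
  | seq c c' ih ih' => simp_all [arrs]
  | ite e c c' ih ih' =>
    simp only [arrs, List.mem_append, not_or] at h
    rw [sem_ite]
    split
    · exact ih h.1 s
    · exact ih' h.2 s
  | loop y e c ih =>
    rw [sem_loop]
    induction (e.eval s).toNat with
    | zero => rfl
    | succ i ihi => exact (ih h ((pass y c s i).setVar y i)).trans ihi

theorem sem_out (c : Cmd) (h : c.silent = true) (s : Store) : (c.sem s).out = s.out := by
  induction c generalizing s with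
  | write e => simp [silent] at h
  | seq c c' ih ih' =>
    simp only [silent, Bool.and_eq_true] at h
    rw [sem_seq, ih' h.2, ih h.1]
  | ite e c c' ih ih' =>
    simp only [silent, Bool.and_eq_true] at h
    rw [sem_ite]
    split
    · exact ih h.1 s
    · exact ih' h.2 s
  | loop y e c ih =>
    rw [sem_loop]
    induction (e.eval s).toNat with
    | zero => rfl
    | succ i ihi => exact (ih h ((pass y c s i).setVar y i)).trans ihi
  | _ => rfl

/-- A bound for the running time of a command without loops. -/
def flatCost : Cmd → Option ℕ
  | skip => some 0
  | set _ e => some (e.cost + 2)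
  | put _ i e => some (i.cost + e.cost + 10)
  | read _ => some 3
  | write e => some (e.cost + 1)
  | seq c c' => c.flatCost.bind fun k => c'.flatCost.map fun k' => k + k'
  | ite e c c' => c.flatCost.bind fun k => c'.flatCost.map fun k' => e.cost + 3 + (k + k')
  | loop _ _ _ => none

/-- Adding the costs of both branches instead of taking their maximum is wasteful, but for a command
without loops the bound is a number that `decide` can compare with the wanted constant. -/
theorem cost_le_of_flatCost {c : Cmd} {k : ℕ} (h : c.flatCost = some k) (s : Store) :
    c.cost s ≤ k := by
  induction c generalizing s k with
  | loop y e c ih => simp [flatCost] at h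
  | seq c c' ih ih' =>
    simp only [flatCost, Option.bind_eq_some_iff, Option.map_eq_some_iff] at h
    obtain ⟨k₁, h₁, k₂, h₂, rfl⟩ := h
    exact Nat.add_le_add (ih h₁ _) (ih' h₂ _)
  | ite e c c' ih ih' =>
    simp only [flatCost, Option.bind_eq_some_iff, Option.map_eq_some_iff] at h
    obtain ⟨k₁, h₁, k₂, h₂, rfl⟩ := h
    have h3 := ih h₁ s
    have h4 := ih' h₂ s
    rw [cost]
    split <;> omega
  | _ =>
    simp only [flatCost, Option.some.injEq] at h
    subst h
    exact le_rfl

/-- Run from `s`, the command ends within time `B` and then `Q` holds. -/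
def Ens (c : Cmd) (s : Store) (B : ℕ) (Q : Store → Prop) : Prop := c.cost s ≤ B ∧ Q (c.sem s)

theorem Ens.seq {c c' : Cmd} {s : Store} {B B' : ℕ} {Q Q' : Store → Prop} (h : c.Ens s B Q)
    (h' : ∀ s', Q s' → c'.Ens s' B' Q') : (c ;; c').Ens s (B + B') Q' :=
  ⟨Nat.add_le_add h.1 (h' _ h.2).1, (h' _ h.2).2⟩

theorem Ens.mono {c : Cmd} {s : Store} {B B' : ℕ} {Q Q' : Store → Prop} (h : c.Ens s B Q)
    (hB : B ≤ B') (hQ : ∀ s', Q s' → Q' s') : c.Ens s B' Q' :=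
  ⟨h.1.trans hB, hQ _ h.2⟩

/-- A syntactic frame rule: whatever a command does not mention as a target keeps its value. -/
theorem Ens.frame {c : Cmd} {s : Store} {B : ℕ} {Q : Store → Prop} (h : c.Ens s B Q) :
    c.Ens s B fun s' => Q s' ∧ (∀ x, x ∉ c.vars → s'.v x = s.v x) ∧
      ∀ a, a ∉ c.arrs → s'.a a = s.a a :=
  ⟨h.1, h.2, fun _ hx => c.sem_v hx s, fun _ ha => c.sem_a ha s⟩

theorem Ens.of_flat {c : Cmd} {k : ℕ} (h : c.flatCost = some k) {s : Store} {Q : Store → Prop}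
    (hQ : Q (c.sem s)) : c.Ens s k Q :=
  ⟨cost_le_of_flatCost h s, hQ⟩

theorem Ens.ite {e : Expr} {c c' : Cmd} {s : Store} {B B' : ℕ} {Q : Store → Prop}
    (h : 0 < e.eval s → c.Ens s B Q) (h' : ¬ 0 < e.eval s → c'.Ens s B' Q) :
    (ite e c c').Ens s (e.cost + 3 + (B + B')) Q := by
  by_cases hp : 0 < e.eval s
  · refine ⟨?_, ?_⟩
    · rw [cost, if_pos hp]
      have := (h hp).1
      omega
    · rw [sem_ite, if_pos hp]
      exact (h hp).2
  · refine ⟨?_, ?_⟩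
    · rw [cost, if_neg hp]
      have := (h' hp).1
      omega
    · rw [sem_ite, if_neg hp]
      exact (h' hp).2

theorem Ens.loop {x : ℕ} {e : Expr} {c : Cmd} {s : Store} {N B : ℕ} (Inv : ℕ → Store → Prop)
    (hN : e.eval s = N) (h0 : Inv 0 s)
    (h : ∀ i < N, ∀ s', Inv i s' → c.Ens (s'.setVar x i) B (Inv (i + 1))) :
    (loop x e c).Ens s (e.cost + 7 + N * (B + 7)) (Inv N) := by
  have key : ∀ i ≤ N, Inv i (pass x c s i) := by
    intro i hi
    induction i with
    | zero => exact h0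
    | succ i ih => exact (h i (by omega) _ (ih (by omega))).2
  have hN' : (e.eval s).toNat = N := by rw [hN]; simp
  refine ⟨?_, ?_⟩
  · rw [cost_loop_eq, hN']
    have : ∑ i ∈ Finset.range N, (4 + c.cost ((pass x c s i).setVar x i) + 3) ≤
        ∑ _i ∈ Finset.range N, (B + 7) := by
      refine Finset.sum_le_sum fun i hi => ?_
      have := (h i (Finset.mem_range.1 hi) _ (key i (Finset.mem_range.1 hi).le)).1
      omega
    rw [Finset.sum_const, Finset.card_range, smul_eq_mul] at this
    omega
  · rw [sem_loop, hN']
    exact key N le_rfl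

end Cmd

end RAM

namespace FreeEq

open FreeGroup

/-- Letters of the alphabet `h_1, …, h_r, x` and their inverses. -/
abbrev Letter (r : ℕ) := Option (Fin r) × Bool

/-! ### Positions in the words of the letters -/

section Words

variable {n r : ℕ} (w : Option (Fin r) → List (Fin n × Bool))

/-- The word in `a_1, …, a_n` of a letter. -/
def letterWord (s : Letter r) : List (Fin n × Bool) := bif s.2 then w s.1 else invRev (w s.1)

/-- The homomorphism that replaces every letter by its word. -/
def wordHom : FreeGroup (Option (Fin r)) →* FreeGroup (Fin n) := FreeGroup.lift fun o => mk (w o)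

/-- The homomorphism that replaces every letter except for `x` by its word. -/
def ambientHom : FreeGroup (Option (Fin r)) →* FreeGroup (Option (Fin n)) :=
  FreeGroup.lift fun o =>
    o.elim (FreeGroup.of none) fun i => FreeGroup.map some (mk (w (some i)))

theorem wordHom_mk_singleton (s : Letter r) : wordHom w (mk [s]) = mk (letterWord w s) := by
  rcases s with ⟨o, _ | _⟩ <;> simp [wordHom, letterWord]

theorem ambientHom_mk_some (i : Fin r) (ε : Bool) :
    ambientHom w (mk [(some i, ε)]) = FreeGroup.map some (mk (letterWord w (some i, ε))) := by
  cases ε <;> simp [ambientHom, letterWord, ← FreeGroup.inv_mk, -FreeGroup.map.mk]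

theorem ambientHom_mk_none (ε : Bool) :
    ambientHom w (mk [(none, ε)]) = mk [(none, ε)] := by
  cases ε <;> simp [ambientHom, FreeGroup.of, FreeGroup.inv_mk, invRev]

/-- A position: a letter and the rest of its word. -/
abbrev Position (n r : ℕ) := Letter r × List (Fin n × Bool)

/-- The positions in the word of a letter. -/
def block (s : Letter r) : List (Position n r) := (letterWord w s).tails.map (s, ·)

/-- The list `T` consists of blocks; the block of a letter `s` with `J s` starts at `st s` and ends
at `en s`. -/
structure IsLayout (J : Letter r → Prop) (T : List (Position n r)) (st en : Letter r → ℕ) :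
    Prop where
  step : ∀ p s a l, T[p]? = some (s, a :: l) → T[p + 1]? = some (s, l)
  st_get : ∀ s, J s → T[st s]? = some (s, letterWord w s)
  en_eq : ∀ s, J s → en s = st s + (letterWord w s).length

variable {w}

theorem IsLayout.drop {J : Letter r → Prop} {T : List (Position n r)} {st en : Letter r → ℕ}
    (h : IsLayout w J T st en) {p : ℕ} {s : Letter r} {l : List (Fin n × Bool)}
    (hp : T[p]? = some (s, l)) (i : ℕ) (hi : i ≤ l.length) : T[p + i]? = some (s, l.drop i) := by
  induction i with
  | zero => simpa using hp
  | succ i ih =>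
    have h1 := ih (by omega)
    rw [List.drop_eq_getElem_cons (by omega)] at h1
    exact h.step _ _ _ _ h1

theorem IsLayout.en_get {J : Letter r → Prop} {T : List (Position n r)} {st en : Letter r → ℕ}
    (h : IsLayout w J T st en) {s : Letter r} (hs : J s) : T[en s]? = some (s, []) := by
  have := h.drop (h.st_get s hs) _ le_rfl
  rwa [← h.en_eq s hs, List.drop_length] at this

theorem length_block (s : Letter r) : (block w s).length = (letterWord w s).length + 1 := by
  simp [block]

theorem getElem?_block (s : Letter r) {i : ℕ} (hi : i ≤ (letterWord w s).length) :
    (block w s)[i]? = some (s, (letterWord w s).drop i) := by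
  rw [List.getElem?_eq_getElem (by rw [length_block]; omega)]
  simp [block, List.getElem_tails]

theorem IsLayout.append {J : Letter r → Prop} {T : List (Position n r)} {st en : Letter r → ℕ}
    (h : IsLayout w J T st en) (s : Letter r) :
    IsLayout w (fun t => J t ∨ t = s) (T ++ block w s) (Function.update st s T.length)
      (Function.update en s (T.length + (letterWord w s).length)) := by
  have key : (T ++ block w s)[T.length]? = some (s, letterWord w s) := by
    rw [List.getElem?_append_right le_rfl, Nat.sub_self, getElem?_block _ (Nat.zero_le _),
      List.drop_zero]
  have hlt {p : ℕ} {y : Position n r} (hp : T[p]? = some y) : (T ++ block w s)[p]? = some y := by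
    rw [List.getElem?_append_left, hp]
    exact (List.getElem?_eq_some_iff.1 hp).1
  refine ⟨fun p t a l hp => ?_, fun t ht => ?_, fun t ht => ?_⟩
  · rcases lt_or_ge p T.length with h1 | h1
    · rw [List.getElem?_append_left h1] at hp
      exact hlt (h.step _ _ _ _ hp)
    · rw [List.getElem?_append_right h1] at hp
      rw [List.getElem?_append_right (by omega)]
      obtain ⟨i, rfl⟩ := Nat.exists_eq_add_of_le h1
      rw [Nat.add_sub_cancel_left] at hp
      rw [add_assoc, Nat.add_sub_cancel_left]
      have h2 := (List.getElem?_eq_some_iff.1 hp).1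
      rw [length_block] at h2
      rw [getElem?_block _ (by omega)] at hp
      simp only [Option.some.injEq, Prod.mk.injEq] at hp
      obtain ⟨rfl, hp⟩ := hp
      have h3 : i < (letterWord w s).length := by
        by_contra h3
        rw [List.drop_eq_nil_of_le (by omega)] at hp
        cases hp
      rw [getElem?_block _ (by omega)]
      rw [List.drop_eq_getElem_cons h3] at hp
      rw [(List.cons.inj hp).2]
  · by_cases hts : t = s
    · subst hts
      simpa using key
    · rw [Function.update_of_ne hts]
      exact hlt (h.st_get t (ht.resolve_right hts))
  · by_cases hts : t = s
    · subst hts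
      simp
    · rw [Function.update_of_ne hts, Function.update_of_ne hts]
      exact h.en_eq t (ht.resolve_right hts)

end Words

/-! ### Facts: paths with trivial label between two positions -/

/-- `1` for `x` and `x⁻¹`, `0` for the other letters. -/
def weight {r : ℕ} (s : Letter r) : ℕ := if s.1 = none then 1 else 0

/-- The sum of the weights of the two letters over all pairs of consecutive letters. -/
def pathWeight {r : ℕ} : List (Letter r) → ℕ
  | a :: b :: l => weight a + weight b + pathWeight (b :: l)
  | _ => 0

/-- Weights belong to jumps and not to letters; hence two paths that share the letter `a` can be
glued there without counting it twice. -/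
theorem pathWeight_append {r : ℕ} (l l' : List (Letter r)) (a : Letter r) :
    pathWeight (l ++ a :: l') = pathWeight (l ++ [a]) + pathWeight (a :: l') := by
  induction l with
  | nil => simp [pathWeight]
  | cons b l ih =>
    cases l with
    | nil => simp [pathWeight]
    | cons c l =>
      simp only [List.cons_append, pathWeight] at ih ⊢
      omega

/-- Inner letters are ends of two jumps, the first and the last letter of one. For a closed path,
with `a = b`, the weight is twice the number of occurrences of `x^{±1}`; this is why the program
works with `2 * d`. -/
theorem pathWeight_add {r : ℕ} (l : List (Letter r)) (a b : Letter r)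
    (h : (a :: l).getLast? = some b) :
    pathWeight (a :: l) + weight b = weight a + 2 * countUnknown l := by
  induction l generalizing a with
  | nil =>
    simp only [List.getLast?_singleton, Option.some.injEq] at h
    subst h
    simp [pathWeight, countUnknown]
  | cons c l ih =>
    rw [List.getLast?_cons_cons] at h
    have := ih c h
    simp only [pathWeight, countUnknown, List.countP_cons] at this ⊢
    have h3 : weight c = if c.1.isNone = true then 1 else 0 := by simp [weight]
    omega

/-- There is a path with trivial label from the position `p` to the position `q` that enters the
letters of `u` and has weight `k`. -/
def IsFact {n r : ℕ} (w : Option (Fin r) → List (Fin n × Bool)) (T : List (Position n r))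
    (p q k : ℕ) (u : List (Letter r)) : Prop :=
  ∃ s l t l', T[p]? = some (s, l) ∧ T[q]? = some (t, l') ∧ IsReduced (s :: u) ∧
    (s :: u).getLast? = some t ∧ pathWeight (s :: u) = k ∧
    mk l * wordHom w (mk u) * (mk l')⁻¹ = 1

/-- The value of the rest of a word after a position, when the word of `x` is neglected. -/
def restValue {n r : ℕ} (P : Position n r) : FreeGroup (Option (Fin n)) :=
  if P.1.1 = none then 1 else FreeGroup.map some (mk P.2)

/-- The value in `F_n * ⟨x⟩` of a path. -/
def pathValue {n r : ℕ} (w : Option (Fin r) → List (Fin n × Bool)) (T : List (Position n r))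
    (p q : ℕ) (u : List (Letter r)) : FreeGroup (Option (Fin n)) :=
  (T[p]?.elim 1 restValue) * ambientHom w (mk u) * (T[q]?.elim 1 restValue)⁻¹

section Facts

variable {n r : ℕ} {w : Option (Fin r) → List (Fin n × Bool)} {J : Letter r → Prop}
  {T : List (Position n r)} {st en : Letter r → ℕ}

theorem IsFact.refl {p : ℕ} (hp : p < T.length) : IsFact w T p p 0 [] := by
  refine ⟨T[p].1, T[p].2, T[p].1, T[p].2, by simp [hp], by simp [hp], by simp, by simp, rfl, ?_⟩
  rw [← FreeGroup.one_eq_mk, _root_.map_one, mul_one, mul_inv_cancel]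

theorem pathValue_refl (p : ℕ) : pathValue w T p p [] = 1 := by
  rw [pathValue, ← FreeGroup.one_eq_mk]
  simp

/-- At the end of `s` nothing is left to read, and at the start of `t` its whole word is left, which
cancels the value of entering `t`. The hypothesis `hst` says that `t` is not the inverse of `s`. -/
theorem IsFact.silent (h : IsLayout w J T st en) {s t : Letter r} (hs : J s) (ht : J t)
    (hst : s.1 = t.1 → s.2 = t.2) : IsFact w T (en s) (st t) (weight s + weight t) [t] := by
  refine ⟨s, [], t, letterWord w t, h.en_get hs, h.st_get t ht, ?_, by simp, by simp [pathWeight],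
    ?_⟩
  · simpa [FreeGroup.isReduced_cons_cons] using hst
  · rw [wordHom_mk_singleton, ← FreeGroup.one_eq_mk, one_mul, mul_inv_cancel]

/-- Entering a coefficient contributes nothing yet, since its word is contributed while it is read;
entering `x^{±1}` contributes `x^{±1}` at once, because the rest of its word has value `1`. -/
theorem pathValue_silent (h : IsLayout w J T st en) {s t : Letter r} (hs : J s) (ht : J t) :
    pathValue w T (en s) (st t) [t] = if t.1 = none then mk [(none, t.2)] else 1 := by
  have h1 : (T[en s]?.elim 1 restValue) = 1 := by
    rw [h.en_get hs, Option.elim_some, restValue, ← FreeGroup.one_eq_mk]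
    simp
  rw [pathValue, h1, h.st_get t ht, Option.elim_some]
  rcases t with ⟨_ | i, ε⟩
  · rw [ambientHom_mk_none]
    simp [restValue]
  · rw [ambientHom_mk_some]
    simp [restValue, -FreeGroup.map.mk]

/-- The label is conjugated by one letter and so stays trivial. No letter of the alphabet is
entered, whence `u` and `k` do not change. -/
theorem IsFact.wrap (h : IsLayout w J T st en) {p q k : ℕ} {u : List (Letter r)} {s t : Letter r}
    {i : Fin n} {ε : Bool} {l l' : List (Fin n × Bool)} (hp : T[p]? = some (s, (i, ε) :: l))
    (hq : T[q]? = some (t, (i, !ε) :: l')) (hf : IsFact w T (p + 1) q k u) :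
    IsFact w T p (q + 1) k u := by
  obtain ⟨s₁, l₁, t₁, l₁', h1, h2, h3, h4, h5, h6⟩ := hf
  have hp' := h.step _ _ _ _ hp
  have hq' := h.step _ _ _ _ hq
  rw [h1] at hp'
  rw [h2] at hq
  simp only [Option.some.injEq, Prod.mk.injEq] at hp' hq
  obtain ⟨rfl, rfl⟩ := hp'
  obtain ⟨rfl, rfl⟩ := hq
  refine ⟨_, _, _, _, hp, hq', h3, h4, h5, ?_⟩
  have e1 : (mk ((i, ε) :: l₁) : FreeGroup (Fin n)) = mk [(i, ε)] * mk l₁ := by simp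
  have e2 : (mk ((i, !ε) :: l') : FreeGroup (Fin n)) = (mk [(i, ε)])⁻¹ * mk l' := by
    simp [FreeGroup.inv_mk, invRev]
  rw [e2] at h6
  rw [e1]
  calc mk [(i, ε)] * mk l₁ * wordHom w (mk u) * (mk l')⁻¹
      = mk [(i, ε)] * (mk l₁ * wordHom w (mk u) * ((mk [(i, ε)])⁻¹ * mk l')⁻¹) *
        (mk [(i, ε)])⁻¹ := by group
    _ = 1 := by rw [h6]; group

/-- The contribution of a letter in the word of `s` to the value of a path. -/
def visible {n r : ℕ} (s : Letter r) (a : Fin n × Bool) : Option (Option (Fin n) × Bool) :=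
  if s.1 = none then none else some (some a.1, a.2)

theorem restValue_cons (s : Letter r) (a : Fin n × Bool) (l : List (Fin n × Bool)) :
    restValue (s, a :: l) = mk (visible s a).toList * restValue (s, l) := by
  by_cases hs : s.1 = none
  · simp [restValue, visible, hs, ← FreeGroup.one_eq_mk]
  · simp [restValue, visible, hs]

theorem pathValue_wrap (h : IsLayout w J T st en) {p q : ℕ} (u : List (Letter r)) {s t : Letter r}
    {i : Fin n} {ε : Bool} {l l' : List (Fin n × Bool)} (hp : T[p]? = some (s, (i, ε) :: l))
    (hq : T[q]? = some (t, (i, !ε) :: l')) :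
    pathValue w T p (q + 1) u =
      mk (visible s (i, ε)).toList * pathValue w T (p + 1) q u * mk (visible t (i, !ε)).toList := by
  simp only [pathValue, hp, hq, h.step _ _ _ _ hp, h.step _ _ _ _ hq, Option.elim_some,
    restValue_cons]
  group

/-- Both paths visit the letter whose word contains the position `m`. They overlap in this letter,
and two reduced words that overlap in a letter join to a reduced word. -/
theorem IsFact.concat {p q m k k' : ℕ} {u u' : List (Letter r)} (hf : IsFact w T p m k u)
    (hf' : IsFact w T m q k' u') : IsFact w T p q (k + k') (u ++ u') := by
  obtain ⟨s₁, l₁, t₁, l₁', h1, h2, h3, h4, h5, h6⟩ := hf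
  obtain ⟨s₂, l₂, t₂, l₂', g1, g2, g3, g4, g5, g6⟩ := hf'
  rw [h2] at g1
  simp only [Option.some.injEq, Prod.mk.injEq] at g1
  obtain ⟨rfl, rfl⟩ := g1
  obtain ⟨v, hv⟩ : ∃ v, s₁ :: u = v ++ [t₁] := by
    obtain ⟨v, hv⟩ := List.getLast?_eq_some_iff.1 h4
    exact ⟨v, hv⟩
  have e : s₁ :: (u ++ u') = v ++ t₁ :: u' := by
    rw [← List.cons_append, hv]
    simp
  refine ⟨s₁, l₁, t₂, l₂', h1, g2, ?_, ?_, ?_, ?_⟩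
  · rw [e, ← List.singleton_append, ← List.append_assoc]
    refine IsReduced.append_overlap (hv ▸ h3) ?_ (by simp)
    simpa using g3
  · rw [e, List.getLast?_append, g4]
    simp
  · rw [e, pathWeight_append, ← hv, h5, g5]
  · rw [← FreeGroup.mul_mk, _root_.map_mul]
    calc mk l₁ * (wordHom w (mk u) * wordHom w (mk u')) * (mk l₂')⁻¹
        = (mk l₁ * wordHom w (mk u) * (mk l₁')⁻¹) *
          (mk l₁' * wordHom w (mk u') * (mk l₂')⁻¹) := by group
      _ = 1 := by rw [h6, g6, one_mul]

theorem pathValue_concat (p m q : ℕ) (u u' : List (Letter r)) :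
    pathValue w T p q (u ++ u') = pathValue w T p m u * pathValue w T m q u' := by
  simp only [pathValue, ← FreeGroup.mul_mk, _root_.map_mul]
  group

theorem ambientHom_eq_map (u : List (Letter r)) (hu : ∀ s ∈ u, s.1 ≠ none) :
    ambientHom w (mk u) = FreeGroup.map some (wordHom w (mk u)) := by
  induction u with
  | nil => simp [← FreeGroup.one_eq_mk]
  | cons s u ih =>
    have e : (mk (s :: u) : FreeGroup (Option (Fin r))) = mk [s] * mk u := by simp
    rw [e, _root_.map_mul, _root_.map_mul, _root_.map_mul, ih fun t ht => hu t (by simp [ht]), wordHom_mk_singleton]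
    rcases s with ⟨_ | i, ε⟩
    · exact absurd rfl (hu (none, ε) (by simp))
    · rw [ambientHom_mk_some]

/-- At least one jump is needed: a path that stays inside the word of `x` also has weight `0`. -/
theorem weight_eq_zero_of_pathWeight (a b : Letter r) (l : List (Letter r))
    (h : pathWeight (a :: b :: l) = 0) : ∀ s ∈ a :: b :: l, s.1 ≠ none := by
  induction l generalizing a b with
  | nil =>
    simp only [pathWeight, weight] at h
    intro s hs
    simp only [List.mem_cons, List.not_mem_nil, or_false] at hs
    rcases hs with rfl | rfl <;> intro hn <;> simp [hn] at h
  | cons c l ih =>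
    rw [pathWeight] at h
    intro s hs
    rcases List.mem_cons.1 hs with rfl | hs
    · intro hn
      simp [weight, hn] at h
    · exact ih b c (by omega) s hs

/-- Without a jump the path stays in one letter, and the two rests have the same value. With a jump,
weight `0` excludes `x` from all letters including the two outer ones, so the value is the image of
the trivial label in `F_n * ⟨x⟩`. To exclude the outer letters, jumps have to be weighted at both
ends. -/
theorem IsFact.pathValue_eq_one {p q : ℕ} {u : List (Letter r)} (hf : IsFact w T p q 0 u) :
    pathValue w T p q u = 1 := by
  obtain ⟨s, l, t, l', h1, h2, h3, h4, h5, h6⟩ := hf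
  rw [pathValue, h1, h2, Option.elim_some, Option.elim_some]
  cases u with
  | nil =>
    simp only [List.getLast?_singleton, Option.some.injEq] at h4
    subst h4
    rw [← FreeGroup.one_eq_mk, _root_.map_one, mul_one] at h6 ⊢
    rw [mul_inv_eq_one] at h6 ⊢
    simp only [restValue, h6]
  | cons b u =>
    have h7 := weight_eq_zero_of_pathWeight s b u h5
    have h8 : t.1 ≠ none := by
      refine h7 t ?_
      exact List.mem_of_getLast? h4
    rw [ambientHom_eq_map _ fun y hy => h7 y (by simp [List.mem_cons.1 hy])]
    simp only [restValue, if_neg h8, if_neg (h7 s (by simp))]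
    rw [← _root_.map_inv, ← _root_.map_mul, ← _root_.map_mul, h6, _root_.map_one]

/-- The start letter is also the last letter entered. So reducedness of the path with its start
letter in front says that `u` is cyclically reduced, and the rests at both ends cancel from the
label and are `1` in the value. -/
theorem IsFact.closed {d : ℕ} {u : List (Letter r)} {ε : Bool} (h : IsLayout w J T st en)
    (hJ : J (none, ε)) (hf : IsFact w T (st (none, ε)) (st (none, ε)) (2 * d) u) :
    IsCyclicallyReduced u ∧ countUnknown u = d ∧ wordHom w (mk u) = 1 ∧
      pathValue w T (st (none, ε)) (st (none, ε)) u = ambientHom w (mk u) := by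
  obtain ⟨s, l, t, l', h1, h2, h3, h4, h5, h6⟩ := hf
  have h7 := h.st_get _ hJ
  rw [h1] at h7 h2
  simp only [Option.some.injEq, Prod.mk.injEq] at h7 h2
  obtain ⟨rfl, rfl⟩ := h7
  obtain ⟨rfl, rfl⟩ := h2
  have h8 := pathWeight_add _ _ _ h4
  refine ⟨⟨h3.infix ⟨[(none, ε)], [], by simp⟩, ?_⟩, by omega, ?_, ?_⟩
  · cases u with
    | nil => simp
    | cons b u =>
      rw [List.getLast?_cons_cons] at h4
      rw [h4]
      simpa using (FreeGroup.isReduced_cons_cons.1 h3).1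
  · rw [mul_inv_eq_one] at h6
    simpa using h6
  · rw [pathValue, h1, Option.elim_some]
    simp [restValue]

end Facts

end FreeEq

namespace FreeEq

open FreeGroup

/-! ### Paths with trivial label can be derived -/

/-- The weights of paths with trivial label that can be derived by composing paths and by wrapping
a path into a letter and its inverse. -/
inductive Derivable {n r : ℕ} (T : List (Position n r)) (st en : Letter r → ℕ) :
    ℕ → ℕ → ℕ → Prop
  | refl (p : ℕ) (hp : p < T.length) : Derivable T st en p p 0
  | silent (s t : Letter r) (h : s.1 = t.1 → s.2 = t.2) :
    Derivable T st en (en s) (st t) (weight s + weight t)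
  | wrap (p q k : ℕ) (s t : Letter r) (i : Fin n) (ε : Bool) (l l' : List (Fin n × Bool))
    (hp : T[p]? = some (s, (i, ε) :: l)) (hq : T[q]? = some (t, (i, !ε) :: l'))
    (h : Derivable T st en (p + 1) q k) : Derivable T st en p (q + 1) k
  | concat (p m q k k' : ℕ) (h : Derivable T st en p m k) (h' : Derivable T st en m q k') :
    Derivable T st en p q (k + k')

/-- Paths with `m` edges from one position to another, with their weights and labels. -/
inductive Path {n r : ℕ} (T : List (Position n r)) (st en : Letter r → ℕ) :
    ℕ → ℕ → ℕ → ℕ → List (Fin n × Bool) → Prop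
  | nil (p : ℕ) (hp : p < T.length) : Path T st en 0 p p 0 []
  | letter (m p q k : ℕ) (s : Letter r) (a : Fin n × Bool) (l v : List (Fin n × Bool))
    (hp : T[p]? = some (s, a :: l)) (h : Path T st en m (p + 1) q k v) :
    Path T st en (m + 1) p q k (a :: v)
  | silent (m q k : ℕ) (s t : Letter r) (v : List (Fin n × Bool)) (h : s.1 = t.1 → s.2 = t.2)
    (h' : Path T st en m (st t) q k v) :
    Path T st en (m + 1) (en s) q (weight s + weight t + k) v

/-- Going backwards along a reduction to the one letter `a`, each step inserts a cancelling pair on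
one side of the letter that survives, and does not change the value of that side. -/
theorem exists_split_of_red_singleton {α : Type*} {L : List (α × Bool)} {a : α × Bool}
    (h : Red L [a]) : ∃ l₁ l₂, L = l₁ ++ a :: l₂ ∧ mk l₁ = 1 ∧ mk l₂ = 1 := by
  induction h using Relation.ReflTransGen.head_induction_on with
  | refl => exact ⟨[], [], rfl, rfl, rfl⟩
  | @head L L' hstep _ ih =>
    obtain ⟨l₁, l₂, e, h₁, h₂⟩ := ih
    obtain @⟨A, B, y, c⟩ := hstep
    have cancel (l l' : List (α × Bool)) :
        (mk (l ++ (y, c) :: (y, !c) :: l') : FreeGroup α) = mk (l ++ l') :=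
      Quot.sound Red.Step.not
    rcases List.append_eq_append_iff.1 e with ⟨C, hC, hC'⟩ | ⟨C, hC, hC'⟩
    · refine ⟨A ++ (y, c) :: (y, !c) :: C, l₂, by simp [hC'], ?_, h₂⟩
      rw [cancel, ← hC, h₁]
    · cases C with
      | nil =>
        simp only [List.append_nil, List.nil_append] at hC hC'
        refine ⟨A ++ [(y, c), (y, !c)], l₂, by simp [← hC'], ?_, h₂⟩
        rw [cancel, List.append_nil, hC, h₁]
      | cons b C =>
        rw [List.cons_append, List.cons.injEq] at hC'
        obtain ⟨rfl, hC'⟩ := hC'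
        refine ⟨l₁, C ++ (y, c) :: (y, !c) :: B, by simp [hC], h₁, ?_⟩
        rw [cancel, ← hC', h₂]

/-- The Dyck decomposition: the first letter cancels against an inverse letter, and the words
between and behind the two are trivial. -/
theorem exists_split_of_mk_cons_eq_one {α : Type*} {L : List (α × Bool)} {a : α} {ε : Bool}
    (h : mk ((a, ε) :: L) = 1) :
    ∃ l₁ l₂, L = l₁ ++ (a, !ε) :: l₂ ∧ mk l₁ = 1 ∧ mk l₂ = 1 := by
  refine exists_split_of_red_singleton (Red.cons_nil_iff_singleton.1 ?_)
  rw [FreeGroup.one_eq_mk, Red.exact] at h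
  obtain ⟨c, h1, h2⟩ := h
  rwa [Red.nil_iff.1 h2] at h1

section

variable {n r : ℕ} {w : Option (Fin r) → List (Fin n × Bool)} {J : Letter r → Prop}
  {T : List (Position n r)} {st en : Letter r → ℕ}

theorem Path.split {m p q k : ℕ} {v₁ v₂ : List (Fin n × Bool)} {b : Fin n × Bool}
    (h : Path T st en m p q k (v₁ ++ b :: v₂)) :
    ∃ m₁ m₂ c k₁ k₂ s l, Path T st en m₁ p c k₁ v₁ ∧ T[c]? = some (s, b :: l) ∧
      Path T st en m₂ (c + 1) q k₂ v₂ ∧ m = m₁ + m₂ + 1 ∧ k = k₁ + k₂ := by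
  generalize hv : v₁ ++ b :: v₂ = v at h
  induction h generalizing v₁ with
  | nil p hp => simp at hv
  | letter m p q k s a l v hp h ih =>
    cases v₁ with
    | nil =>
      simp only [List.nil_append, List.cons.injEq] at hv
      obtain ⟨rfl, rfl⟩ := hv
      have hlt := (List.getElem?_eq_some_iff.1 hp).1
      exact ⟨0, m, p, 0, k, s, l, .nil p hlt, hp, h, by omega, by omega⟩
    | cons a' v₁ =>
      simp only [List.cons_append, List.cons.injEq] at hv
      obtain ⟨rfl, hv⟩ := hv
      obtain ⟨m₁, m₂, c, k₁, k₂, s', l', h1, h2, h3, h4, h5⟩ := ih hv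
      exact ⟨m₁ + 1, m₂, c, k₁, k₂, s', l', .letter _ _ _ _ _ _ _ _ hp h1, h2, h3, by omega, h5⟩
  | silent m q k s t v h h' ih =>
    obtain ⟨m₁, m₂, c, k₁, k₂, s', l', h1, h2, h3, h4, h5⟩ := ih hv
    exact ⟨m₁ + 1, m₂, c, _, k₂, s', l', .silent _ _ _ _ _ _ h h1, h2, h3, by omega, by omega⟩

/-- If the first edge reads a letter, the Dyck decomposition cuts the path into a wrapped part and a
remainder, both with trivial labels. The induction is on the number of edges rather than on the
label, as silent jumps do not shorten the label. -/
theorem Path.derivable {m p q k : ℕ} {v : List (Fin n × Bool)} (h : Path T st en m p q k v)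
    (hv : mk v = 1) : Derivable T st en p q k := by
  induction m using Nat.strong_induction_on generalizing p q k v with
  | _ m ih =>
    cases h with
    | nil p hp => exact .refl _ hp
    | letter m p q k s a l v hp h =>
      obtain ⟨i, ε⟩ := a
      obtain ⟨v₁, v₂, rfl, h₁, h₂⟩ := exists_split_of_mk_cons_eq_one hv
      obtain ⟨m₁, m₂, c, k₁, k₂, s', l', g1, g2, g3, g4, rfl⟩ := h.split
      exact .concat _ _ _ _ _ (.wrap _ _ _ _ _ _ _ _ _ hp g2 (ih m₁ (by omega) g1 h₁))
        (ih m₂ (by omega) g3 h₂)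
    | silent m q k s t v h h' =>
      exact .concat _ _ _ _ _ (.silent s t h) (ih m (by omega) h' hv)

theorem Path.walk (hL : IsLayout w J T st en) (l : List (Fin n × Bool)) {m p q k : ℕ}
    {s : Letter r} {v : List (Fin n × Bool)} (hp : T[p]? = some (s, l))
    (h : Path T st en m (p + l.length) q k v) : ∃ m', Path T st en m' p q k (l ++ v) := by
  induction l generalizing p with
  | nil => exact ⟨m, h⟩
  | cons a l ih =>
    rw [List.length_cons, add_comm l.length, ← add_assoc] at h
    obtain ⟨m', h'⟩ := ih (hL.step _ _ _ _ hp) h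
    exact ⟨_, .letter _ _ _ _ _ _ _ _ hp h'⟩

theorem exists_path (hL : IsLayout w (fun _ => True) T st en) (u : List (Letter r))
    (s t : Letter r) (h : IsReduced (s :: (u ++ [t]))) :
    ∃ m, Path T st en m (en s) (st t) (pathWeight (s :: (u ++ [t])))
      (u.flatMap (letterWord w)) := by
  induction u generalizing s with
  | nil =>
    have hlt := (List.getElem?_eq_some_iff.1 (hL.st_get t trivial)).1
    exact ⟨1, .silent 0 _ 0 s t [] (FreeGroup.isReduced_cons_cons.1 h).1 (.nil _ hlt)⟩
  | cons b u ih =>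
    obtain ⟨h1, h2⟩ := FreeGroup.isReduced_cons_cons.1 h
    obtain ⟨m, hm⟩ := ih b h2
    rw [hL.en_eq b trivial] at hm
    obtain ⟨m', hm'⟩ := Path.walk hL _ (hL.st_get b trivial) hm
    exact ⟨_, .silent _ _ _ s b _ h1 hm'⟩

theorem wordHom_mk (u : List (Letter r)) :
    wordHom w (mk u) = mk (u.flatMap (letterWord w)) := by
  induction u with
  | nil => exact _root_.map_one _
  | cons s u ih =>
    rw [← List.singleton_append, ← FreeGroup.mul_mk, _root_.map_mul, ih, wordHom_mk_singleton]
    simp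

/-- Rotate the cyclic word so that it starts with `x`: this is a conjugation and keeps the value
trivial. The path reads `x`, then the other letters, and closes with a jump to the start of `x`;
that jump is allowed because `c ++ c` is reduced. -/
theorem derivable_of_mem (hL : IsLayout w (fun _ => True) T st en) {c : List (Letter r)}
    (hc : IsReduced (c ++ c)) (h1 : wordHom w (mk c) = 1) (hx : ((none, true) : Letter r) ∈ c) :
    Derivable T st en (st (none, true)) (st (none, true)) (2 * countUnknown c) := by
  obtain ⟨c₁, c₂, rfl⟩ := List.append_of_mem hx
  have h2 : IsReduced ((none, true) :: ((c₂ ++ c₁) ++ [(none, true)])) :=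
    hc.infix ⟨c₁, c₂, by simp⟩
  obtain ⟨m, hm⟩ := exists_path hL _ _ _ h2
  rw [hL.en_eq _ trivial] at hm
  obtain ⟨m', hm'⟩ := Path.walk hL _ (hL.st_get _ trivial) hm
  have h3 := pathWeight_add (c₂ ++ c₁ ++ [(none, true)]) (none, true) (none, true) (by
    rw [List.getLast?_cons]
    simp)
  have h4 : 2 * countUnknown (c₁ ++ (none, true) :: c₂) =
      pathWeight ((none, true) :: (c₂ ++ c₁ ++ [(none, true)])) := by
    simp only [countUnknown, List.countP_append, List.countP_cons] at h3 ⊢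
    simp at h3 ⊢
    omega
  rw [h4]
  refine hm'.derivable ?_
  have h5 := wordHom_mk (w := w) ((none, true) :: (c₂ ++ c₁))
  rw [List.flatMap_cons] at h5
  rw [← h5]
  have h6 : (mk ((none, true) :: (c₂ ++ c₁)) : FreeGroup (Option (Fin r))) =
      (mk c₁)⁻¹ * mk (c₁ ++ (none, true) :: c₂) * mk c₁ := by
    rw [← FreeGroup.mul_mk (L₁ := c₁), inv_mul_cancel_left, FreeGroup.mul_mk]
    simp
  rw [h6, _root_.map_mul, _root_.map_mul, h1, mul_one, _root_.map_inv, inv_mul_cancel]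

theorem countUnknown_invRev (c : List (Letter r)) : countUnknown (invRev c) = countUnknown c := by
  simp [countUnknown, invRev, List.countP_map, Function.comp_def]

theorem isReduced_invRev {α : Type*} {c : List (α × Bool)} (hc : IsReduced c) :
    IsReduced (invRev c) := by
  classical
  rw [isReduced_iff_reduce_eq] at hc ⊢
  rw [reduce_invRev, hc]

/-- If the occurrence found is `x⁻¹`, pass to the inverse word, which has the same degree. Degree
`0` is covered by the empty path. -/
theorem derivable_of_word (hL : IsLayout w (fun _ => True) T st en) {c : List (Letter r)}
    (hc : IsReduced (c ++ c)) (h1 : wordHom w (mk c) = 1) :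
    Derivable T st en (st (none, true)) (st (none, true)) (2 * countUnknown c) := by
  by_cases h0 : countUnknown c = 0
  · rw [h0]
    exact .refl _ (List.getElem?_eq_some_iff.1 (hL.st_get _ trivial)).1
  · rw [countUnknown, ← Ne, ← Nat.pos_iff_ne_zero, List.countP_pos_iff] at h0
    obtain ⟨⟨o, ε⟩, hm, ho⟩ := h0
    obtain rfl : o = none := by simpa using ho
    cases ε with
    | true => exact derivable_of_mem hL hc h1 hm
    | false =>
      rw [← countUnknown_invRev]
      refine derivable_of_mem hL ?_ ?_ ?_
      · rw [← FreeGroup.invRev_append]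
        exact isReduced_invRev hc
      · rw [← FreeGroup.inv_mk, _root_.map_inv, h1, inv_one]
      · simp [invRev, hm]

end

/-! ### Equations as words -/

section Equations

variable {n r : ℕ} {H : Subgroup (FreeGroup (Fin n))} (b : FreeGroupBasis (Fin r) H)
  (g : FreeGroup (Fin n))

/-- The reduced words of the basis and of `g`. -/
def inputWord (o : Option (Fin r)) : List (Fin n × Bool) :=
  o.elim g.toWord fun i => (b i : FreeGroup (Fin n)).toWord

theorem evalHom_ofWord (u : List (Letter r)) :
    evalHom H g (ofWord b u) = wordHom (inputWord b g) (mk u) := by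
  have : (evalHom H g).comp (FreeGroup.lift fun o : Option (Fin r) =>
      o.elim (unknown H) fun i => Monoid.Coprod.inl (b i)) = wordHom (inputWord b g) := by
    ext o
    cases o <;> simp [evalHom, wordHom, inputWord, unknown, FreeGroup.mk_toWord]
  exact DFunLike.congr_fun this (mk u)

theorem toAmbient_ofWord (u : List (Letter r)) :
    toAmbient H (ofWord b u) = ambientHom (inputWord b g) (mk u) := by
  have : (toAmbient H).comp (FreeGroup.lift fun o : Option (Fin r) =>
      o.elim (unknown H) fun i => Monoid.Coprod.inl (b i)) = ambientHom (inputWord b g) := by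
    ext o
    cases o <;> simp [toAmbient, ambientHom, inputWord, unknown, FreeGroup.mk_toWord,
      -FreeGroup.map.mk]
  exact DFunLike.congr_fun this (mk u)

theorem ofWord_mem {u : List (Letter r)} (hu : IsCyclicallyReduced u)
    (h1 : wordHom (inputWord b g) (mk u) = 1) :
    ofWord b u ∈ equationsOfDegree b g (countUnknown u) := by
  refine ⟨?_, u, hu.isReduced, rfl, ?_⟩
  · rw [ideal, MonoidHom.mem_ker, evalHom_ofWord, h1]
  · have : reduceCyclically u = u := by
      cases u using List.bidirectionalRec with
      | nil => simp
      | singleton a => simp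
      | cons_append a l c =>
        rw [reduceCyclically.cons_append, if_neg]
        · simp
        · have := (isCyclicallyReduced_cons_append_iff.1 hu).2
          rintro ⟨h2, h3⟩
          have := this h2
          rw [this] at h3
          simp at h3
    rw [this]

/-- The cyclic reduction is a conjugate, and the kernel is normal. Cyclic reducedness is recorded as
reducedness of `c ++ c`, which contains all rotations of `c`. -/
theorem exists_word_of_mem {d : ℕ} {y : EquationGroup H} (hy : y ∈ equationsOfDegree b g d) :
    ∃ c : List (Letter r), IsReduced (c ++ c) ∧ wordHom (inputWord b g) (mk c) = 1 ∧
      countUnknown c = d := by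
  obtain ⟨h1, u, hu, rfl, hd⟩ := hy
  refine ⟨reduceCyclically u, ?_, ?_, hd⟩
  · have := (reduceCyclically.isCyclicallyReduced hu).flatten_replicate 2
    simpa using this.isReduced
  · rw [ideal, MonoidHom.mem_ker, evalHom_ofWord,
      ← reduceCyclically.conj_conjugator_reduceCyclically u, ← FreeGroup.mul_mk,
      ← FreeGroup.mul_mk, ← FreeGroup.inv_mk, _root_.map_mul, _root_.map_mul,
      _root_.map_inv, conj_eq_one_iff] at h1
    exact h1

end Equations

end FreeEq

namespace FreeEq

open RAM FreeGroup
open RAM.Expr (var get)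
open RAM.Cmd (skip set put read write ite loop)

/-! ### The program

The scalars are `0`: `n`, `1`: `r`, `2`: `d`, `3`: `2 * d`, `4`: `2 * d + 1`, `5`: the number of
positions, `6`: the number of rules; the others are auxiliary.

The arrays are `0`: the letter after a position (`0` at the end of a word), `14`: the same, but `0`
in the words of `x` and `x⁻¹`, `1` and `2`: the first and the last position in the word of a letter,
`3`: the number of the rule for two positions and a weight, `4`, `5`, `6`: the two positions and the
weight of a rule, `7`, `8`: the right-hand side of a rule, `9`, `10`: the first and the last letter
of the contribution of a rule to the explicit equation, `11`, `12`: a stack, `13`: the explicit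
equation. -/

/-- Append the next letter of the input. -/
def copyLetter : Cmd :=
  read 10 ;; put 0 (var 5) (var 10) ;; put 14 (var 5) (var 10 * var 9) ;; set 5 (var 5 + 1)

/-- Append the inverse of the letter that mirrors the present position. -/
def mirrorLetter : Cmd :=
  -- If the block of the inverse starts at `m`, pass `j` fills the position `m + j` from `m - 2 -
  -- j`: the position `m - 1` is the end of the word just read and carries no letter.
  put 0 (var 5) (0 - get 0 (var 5 - 2 - 2 * var 31)) ;;
  put 14 (var 5) (0 - get 14 (var 5 - 2 - 2 * var 31)) ;; set 5 (var 5 + 1)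

/-- Read a word of the input, and append it and its inverse. -/
def readWord : Cmd :=
  read 8 ;; ite (var 1 - var 30) (set 9 1) (set 9 0) ;;
  put 1 (var 30 + 1) (var 5) ;; loop 31 (var 8) copyLetter ;;
  put 2 (var 30 + 1) (var 5) ;; set 5 (var 5 + 1) ;;
  put 1 (0 - (var 30 + 1)) (var 5) ;; loop 31 (var 8) mirrorLetter ;;
  put 2 (0 - (var 30 + 1)) (var 5) ;; set 5 (var 5 + 1)

def readInput : Cmd :=
  read 0 ;; read 1 ;; read 2 ;; set 3 (var 2 + var 2) ;; set 4 (var 3 + 1) ;;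
  loop 30 (var 1 + 1) readWord

/-- The index in the table of rules. -/
def slotExpr (p q k : Expr) : Expr := (p * var 5 + q) * var 4 + k

/-- Append a rule, if it is for a new fact of weight at most `2 * d`. -/
def appendRule : Cmd :=
  -- Scalar `4` holds `2 * d + 1`, so this tests whether the weight is at most `2 * d`.
  ite (var 4 - var 13)
    (set 18 (slotExpr (var 11) (var 12) (var 13)) ;;
      ite (get 3 (var 18)) skip
        (put 3 (var 18) (var 6) ;; put 4 (var 6) (var 11) ;; put 5 (var 6) (var 12) ;;
          put 6 (var 6) (var 13) ;; put 7 (var 6) (var 14) ;; put 8 (var 6) (var 15) ;;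
          put 9 (var 6) (var 16) ;; put 10 (var 6) (var 17) ;; set 6 (var 6 + 1)))
    skip

def addRule (p q k y₁ y₂ a b : Expr) : Cmd :=
  set 11 p ;; set 12 q ;; set 13 k ;; set 14 y₁ ;; set 15 y₂ ;; set 16 a ;; set 17 b ;; appendRule

/-- The symbol `r + 2` is rule `0`, the empty word; it pads right-hand sides to two symbols. -/
def addTrivial : Cmd := addRule (var 19) (var 19) 0 (var 1 + 2) (var 1 + 2) 0 0

/-- Add the fact that leads from the end of the letter `27` to the start of the letter `28`. -/
def addSilent : Cmd :=
  -- The square is positive exactly if both codes are nonzero and do not add up to zero, that is, if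
  -- they are letters and not inverse to each other.
  ite (var 27 * var 28 * (var 27 + var 28) * (var 27 * var 28 * (var 27 + var 28)))
    (ite (var 27 * var 27 - var 1 * var 1) (set 29 1) (set 29 0) ;;
      ite (var 28 * var 28 - var 1 * var 1)
        (set 32 1 ;; ite (var 28) (set 33 (var 0 + 1)) (set 33 (0 - (var 0 + 1))))
        (set 32 0 ;; set 33 0) ;;
      addRule (get 2 (var 27)) (get 1 (var 28)) (var 29 + var 32) (var 28) (var 1 + 2) (var 33) 0)
    skip

def initRules : Cmd :=
  set 6 1 ;; loop 19 (var 5) addTrivial ;;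
  loop 19 (2 * var 1 + 3) (set 27 (var 19 - (var 1 + 1)) ;;
    loop 20 (2 * var 1 + 3) (set 28 (var 20 - (var 1 + 1)) ;; addSilent))

/-- Wrap the fact number `23` into a letter and its inverse. -/
def addWrap : Cmd :=
  set 27 (get 0 (var 20 - 1)) ;; set 28 (get 0 (var 21)) ;;
  -- Positive exactly if the first code is nonzero and the second one is its negative.
  ite (var 27 * var 27 * (1 - (var 27 + var 28) * (var 27 + var 28)))
    (addRule (var 20 - 1) (var 21 + 1) (var 22) (var 1 + 2 + var 23) (var 1 + 2)
      (get 14 (var 20 - 1)) (get 14 (var 21)))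
    skip

/-- Join the fact number `23` to the facts for the position `24` and the weight `25`. -/
def addJoins : Cmd :=
  set 26 (get 3 (slotExpr (var 21) (var 24) (var 25))) ;;
  ite (var 26) (addRule (var 20) (var 24) (var 22 + var 25) (var 1 + 2 + var 23)
    (var 1 + 2 + var 26) 0 0) skip ;;
  set 26 (get 3 (slotExpr (var 24) (var 20) (var 25))) ;;
  ite (var 26) (addRule (var 24) (var 21) (var 25 + var 22) (var 1 + 2 + var 26)
    (var 1 + 2 + var 23) 0 0) skip

def processRule : Cmd :=
  set 20 (get 4 (var 23)) ;; set 21 (get 5 (var 23)) ;; set 22 (get 6 (var 23)) ;; addWrap ;;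
  loop 24 (var 5) (loop 25 (var 4) addJoins)

/-- A worklist processed by rule number. New rules are appended behind the rule being processed, and
the size of the table bounds their number, so a loop with a fixed number of passes suffices. -/
def closeRules : Cmd :=
  loop 19 (var 5 * var 5 * var 4)
    (set 23 (var 19 + 1) ;; ite (var 6 - var 23) processRule skip)

def writeRule : Cmd :=
  set 23 (var 19 + 1) ;; write 2 ;; write (get 7 (var 23)) ;; write (get 8 (var 23))

/-- The target is the fact from the start of `x` to itself of weight `2 * d`. The list is cut off at
its rule, which is thereby the initial symbol; the count is one larger because rule `0` is also
written, with an empty right-hand side. -/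
def writeRules : Cmd :=
  set 34 (get 1 (var 1 + 1)) ;; set 34 (get 3 (slotExpr (var 34) (var 34) (var 3))) ;;
  ite (var 34) (write 1 ;; write (var 34 + 1) ;; write 0 ;; loop 19 (var 34) writeRule) (write 0)

/-- Multiply the word in the array `13` by the letter `27`. -/
def pushLetter : Cmd :=
  ite (var 36 * (1 - (get 13 (var 36 - 1) + var 27) * (get 13 (var 36 - 1) + var 27)))
    (set 36 (var 36 - 1)) (put 13 (var 36) (var 27) ;; set 36 (var 36 + 1))

/-- Replace the symbol `28` by the right-hand side of its rule. -/
def expandSymbol : Cmd :=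
  set 23 (var 28 - (var 1 + 2)) ;;
  -- Rules of weight `0` have trivial value and are dropped; the bound on the number of steps
  -- depends on this.
  ite (get 6 (var 23))
    (put 11 (var 35) (get 10 (var 23)) ;; put 12 (var 35) 0 ;;
      put 11 (var 35 + 1) 0 ;; put 12 (var 35 + 1) (get 8 (var 23)) ;;
      put 11 (var 35 + 2) (get 9 (var 23)) ;; put 12 (var 35 + 2) (get 7 (var 23)) ;;
      set 35 (var 35 + 3))
    skip

def unfoldStep : Cmd :=
  ite (var 35)
    (set 35 (var 35 - 1) ;; set 27 (get 11 (var 35)) ;; set 28 (get 12 (var 35)) ;;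
      ite (var 27 * var 27) pushLetter skip ;;
      ite (var 28 - (var 1 + 2)) expandSymbol skip)
    skip

/-- The number of passes exceeds the initial potential of the stack. Passes after the stack has
become empty do nothing. -/
def writeEquation : Cmd :=
  ite (var 34)
    (set 35 1 ;; put 11 0 0 ;; put 12 0 (var 1 + 2 + var 34) ;; set 36 0 ;;
      loop 19 (8 * (var 4 * (var 5 * var 5 * var 4))) unfoldStep ;;
      write (var 36) ;; loop 19 (var 36) (write (get 13 (var 19))))
    skip

/-- Decide whether there is an equation, and write rules for one. -/
def decideCmd : Cmd := readInput ;; initRules ;; closeRules ;; writeRules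

def solver : Program := (decideCmd ;; writeEquation).code 0 0

end FreeEq

namespace FreeEq

open RAM FreeGroup
open RAM.Expr (var get)
open RAM.Cmd (skip set put read write ite loop)

/-! ### The representation of the positions -/

/-- The code of the letter after a position. -/
def nextCode {n r : ℕ} (P : Position n r) : ℤ := P.2.head?.elim 0 fun a => signed a.1 a.2

/-- The code of the letter after a position, or `0` in the words of `x` and `x⁻¹`. -/
def visibleCode {n r : ℕ} (P : Position n r) : ℤ := if P.1.1 = none then 0 else nextCode P

/-- The array with the values of `c` on the positions. -/
def tapeArray {n r : ℕ} (c : Position n r → ℤ) (T : List (Position n r)) (p : ℤ) : ℤ :=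
  if 0 ≤ p then T[p.toNat]?.elim 0 c else 0

theorem signed_ne_zero (i : ℕ) (ε : Bool) : signed i ε ≠ 0 := by
  cases ε <;> simp [signed] <;> omega

theorem signed_not (i : ℕ) (ε : Bool) : signed i (!ε) = -signed i ε := by
  cases ε <;> simp [signed]

theorem signed_inj {i j : ℕ} {ε δ : Bool} : signed i ε = signed j δ ↔ i = j ∧ ε = δ := by
  cases ε <;> cases δ <;> simp [signed] <;> omega

theorem encodeLetter_injective {k : ℕ} : Function.Injective (encodeLetter (k := k)) := by
  rintro ⟨o, ε⟩ ⟨o', δ⟩ h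
  simp only [encodeLetter, signed_inj] at h
  obtain ⟨h, rfl⟩ := h
  rcases o with _ | i <;> rcases o' with _ | j <;> simp at h ⊢ <;> omega

theorem encodeLetter_not {k : ℕ} (o : Option (Fin k)) (ε : Bool) :
    encodeLetter (o, !ε) = -encodeLetter (o, ε) := signed_not _ _

theorem encodeLetter_ne_zero {k : ℕ} (s : Option (Fin k) × Bool) : encodeLetter s ≠ 0 :=
  signed_ne_zero _ _

theorem abs_encodeLetter_le {k : ℕ} (s : Option (Fin k) × Bool) :
    -((k : ℤ) + 1) ≤ encodeLetter s ∧ encodeLetter s ≤ k + 1 := by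
  obtain ⟨o, ε⟩ := s
  rcases o with _ | i <;> cases ε <;> simp [encodeLetter, signed] <;> omega

theorem exists_encodeLetter_eq {k : ℕ} {z : ℤ} (h0 : z ≠ 0) (h1 : -((k : ℤ) + 1) ≤ z)
    (h2 : z ≤ k + 1) : ∃ s : Option (Fin k) × Bool, encodeLetter s = z := by
  have key : ∀ m : ℕ, 0 < m → m ≤ k + 1 → ∃ o : Option (Fin k), ((o.elim k Fin.val : ℕ) : ℤ) + 1 = m := by
    intro m hm hm'
    rcases eq_or_lt_of_le hm' with h | h
    · exact ⟨none, by simp [h]⟩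
    · refine ⟨some ⟨m - 1, by omega⟩, ?_⟩
      simp only [Option.elim_some]
      omega
  rcases lt_or_gt_of_ne h0 with h | h
  · obtain ⟨o, ho⟩ := key z.natAbs (by omega) (by omega)
    refine ⟨(o, false), ?_⟩
    simp only [encodeLetter, signed]
    simp
    omega
  · obtain ⟨o, ho⟩ := key z.natAbs (by omega) (by omega)
    refine ⟨(o, true), ?_⟩
    simp only [encodeLetter, signed]
    simp
    omega

theorem encodeLetter_add_eq_zero {k : ℕ} (s t : Option (Fin k) × Bool) :
    encodeLetter s + encodeLetter t ≠ 0 ↔ (s.1 = t.1 → s.2 = t.2) := by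
  obtain ⟨o, ε⟩ := s
  obtain ⟨o', δ⟩ := t
  have h : encodeLetter (o, ε) + encodeLetter (o', δ) = 0 ↔
      encodeLetter (o, ε) = encodeLetter (o', !δ) := by
    rw [encodeLetter_not, eq_neg_iff_add_eq_zero]
  rw [Ne, h, encodeLetter_injective.eq_iff]
  cases ε <;> cases δ <;> simp

/-- The unknown has the code `±(k + 1)`, and all other letters have codes of absolute value at most
`k`. -/
theorem encodeLetter_sq {k : ℕ} (s : Option (Fin k) × Bool) :
    0 < encodeLetter s * encodeLetter s - (k : ℤ) * k ↔ s.1 = none := by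
  obtain ⟨o, ε⟩ := s
  rcases o with _ | i
  · cases ε <;> simp [encodeLetter, signed] <;> nlinarith
  · have := i.2
    have h : ((i : ℕ) : ℤ) + 1 ≤ k := by omega
    cases ε <;> simp [encodeLetter, signed] <;> nlinarith

/-! ### The state of the program -/

variable {n r : ℕ}

/-- The index of a fact in the table of rules. -/
def slot (M E p q k : ℕ) : ℕ := (p * M + q) * E + k

theorem slot_lt {M E p q k : ℕ} (hp : p < M) (hq : q < M) (hk : k < E) :
    slot M E p q k < M * M * E := by
  have h1 : p * M + q < M * M := by nlinarith
  unfold slot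
  nlinarith

theorem mul_add_inj {E a b k l : ℕ} (hk : k < E) (hl : l < E) (h : a * E + k = b * E + l) :
    a = b ∧ k = l := by
  have h1 := congrArg (· % E) h
  have h2 := congrArg (· / E) h
  simp only [Nat.mul_add_mod_self_right, Nat.mod_eq_of_lt hk, Nat.mod_eq_of_lt hl] at h1
  have hE : 0 < E := by omega
  simp only [Nat.add_div_of_dvd_right (Dvd.intro_left a rfl),
    Nat.add_div_of_dvd_right (Dvd.intro_left b rfl), Nat.mul_div_cancel _ hE,
    Nat.div_eq_of_lt hk, Nat.div_eq_of_lt hl] at h2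
  exact ⟨by simpa using h2, h1⟩

theorem slot_inj {M E p q k p' q' k' : ℕ} (hq : q < M) (hk : k < E)
    (hq' : q' < M) (hk' : k' < E) (h : slot M E p q k = slot M E p' q' k') :
    p = p' ∧ q = q' ∧ k = k' := by
  obtain ⟨h1, h2⟩ := mul_add_inj hk hk' h
  obtain ⟨h3, h4⟩ := mul_add_inj hq hq' h1
  exact ⟨h3, h4, h2⟩

/-- The input of the program and the layout of the positions. -/
structure Frame (n r : ℕ) where
  w : Option (Fin r) → List (Fin n × Bool)
  d : ℕ
  T : List (Position n r)
  st : Letter r → ℕ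
  en : Letter r → ℕ
  layout : IsLayout w (fun _ => True) T st en

/-- A rule, together with the fact it is for, the word it describes, and the first and the last
letter that it contributes to the explicit equation. -/
structure Rule (n r : ℕ) where
  p : ℕ
  q : ℕ
  k : ℕ
  y₁ : Letter r ⊕ ℕ
  y₂ : Letter r ⊕ ℕ
  a : Option (Option (Fin n) × Bool)
  b : Option (Option (Fin n) × Bool)
  word : List (Letter r)

section Symbols

variable (F : Frame n r) (f : ℕ → Rule n r)

/-- The word that is derived from a symbol. -/
def symbolWord : Letter r ⊕ ℕ → List (Letter r) := Sum.elim (fun s => [s]) fun i => (f i).word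

/-- The weight that is attributed to a symbol. -/
def symbolWeight : Letter r ⊕ ℕ → ℕ := Sum.elim (fun _ => 0) fun i => (f i).k

/-- The value of a symbol in the explicit equation. -/
def symbolValue : Letter r ⊕ ℕ → FreeGroup (Option (Fin n)) :=
  Sum.elim (fun _ => 1) fun i => pathValue F.w F.T (f i).p (f i).q (f i).word

/-- The symbol is a letter or refers to a rule before `j`. -/
def SymbolLt (y : Letter r ⊕ ℕ) (j : ℕ) : Prop := ∀ i, y = Sum.inr i → i < j

/-- The rule `ρ`, used as the rule number `j`, is correct. -/
structure ValidRule (j : ℕ) (ρ : Rule n r) : Prop where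
  fact : IsFact F.w F.T ρ.p ρ.q ρ.k ρ.word
  word_eq : ρ.word = symbolWord f ρ.y₁ ++ symbolWord f ρ.y₂
  lt₁ : SymbolLt ρ.y₁ j
  lt₂ : SymbolLt ρ.y₂ j
  -- Only an inequality: a silent jump has a letter on its right-hand side, to which no weight is
  -- attributed. This is all that the potential argument needs.
  weight_le : symbolWeight f ρ.y₁ + symbolWeight f ρ.y₂ ≤ ρ.k
  value_eq : pathValue F.w F.T ρ.p ρ.q ρ.word =
    mk ρ.a.toList * symbolValue F f ρ.y₁ * symbolValue F f ρ.y₂ * mk ρ.b.toList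

variable {F f}

/-- A rule refers only to earlier rules, so appending rules does not affect it. -/
theorem ValidRule.congr {f' : ℕ → Rule n r} {j : ℕ} {ρ : Rule n r} (h : ValidRule F f j ρ)
    (hf : ∀ i < j, f' i = f i) : ValidRule F f' j ρ := by
  have key (y : Letter r ⊕ ℕ) (hy : SymbolLt y j) : symbolWord f' y = symbolWord f y ∧
      symbolWeight f' y = symbolWeight f y ∧ symbolValue F f' y = symbolValue F f y := by
    rcases y with s | i
    · exact ⟨rfl, rfl, rfl⟩
    · have := hf i (hy i rfl)
      simp [symbolWord, symbolWeight, symbolValue, this]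
  obtain ⟨a1, a2, a3⟩ := key _ h.lt₁
  obtain ⟨b1, b2, b3⟩ := key _ h.lt₂
  exact ⟨h.fact, by rw [a1, b1, ← h.word_eq], h.lt₁, h.lt₂, by rw [a2, b2]; exact h.weight_le,
    by rw [a3, b3]; exact h.value_eq⟩

end Symbols

/-- The code of a letter of the explicit equation, or `0`. -/
def optionCode (a : Option (Option (Fin n) × Bool)) : ℤ := a.elim 0 encodeLetter

/-- The store contains the input and the layout. -/
structure HasFrame (F : Frame n r) (s : Store) : Prop where
  n_eq : s.v 0 = n
  r_eq : s.v 1 = r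
  d_eq : s.v 3 = 2 * F.d
  e_eq : s.v 4 = 2 * F.d + 1
  m_eq : s.v 5 = F.T.length
  next : s.a 0 = tapeArray nextCode F.T
  vis : s.a 14 = tapeArray visibleCode F.T
  st : ∀ t, s.a 1 (encodeLetter t) = F.st t
  en : ∀ t, s.a 2 (encodeLetter t) = F.en t

/-- The index of a rule in the table of rules. -/
def Rule.slot (F : Frame n r) (ρ : Rule n r) : ℕ :=
  FreeEq.slot F.T.length (2 * F.d + 1) ρ.p ρ.q ρ.k

/-- The store contains the `q` rules `f 0, f 1, …, f (q - 1)`; the rule number `0` describes the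
empty word. -/
structure HasRules (F : Frame n r) (f : ℕ → Rule n r) (q : ℕ) (s : Store) : Prop
    extends HasFrame F s where
  q_eq : s.v 6 = q
  q_pos : 1 ≤ q
  arr_p : ∀ j < q, s.a 4 j = (f j).p
  arr_q : ∀ j < q, s.a 5 j = (f j).q
  arr_k : ∀ j < q, s.a 6 j = (f j).k
  arr_y₁ : ∀ j < q, 1 ≤ j → s.a 7 j = encodeSymbol (f j).y₁
  arr_y₂ : ∀ j < q, 1 ≤ j → s.a 8 j = encodeSymbol (f j).y₂
  arr_a : ∀ j < q, 1 ≤ j → s.a 9 j = optionCode (f j).a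
  arr_b : ∀ j < q, 1 ≤ j → s.a 10 j = optionCode (f j).b
  p_lt : ∀ j < q, (f j).p < F.T.length
  q_lt : ∀ j < q, (f j).q < F.T.length
  k_lt : ∀ j < q, (f j).k < 2 * F.d + 1
  -- Empty table entries read `0`; hence the numbers of facts start at `1`, and rule `0` is free for
  -- the empty word.
  slot_eq : ∀ j < q, 1 ≤ j → s.a 3 ((f j).slot F) = j
  eq_slot : ∀ z, 0 < s.a 3 z → ∃ j, 1 ≤ j ∧ j < q ∧ s.a 3 z = j ∧ z = (f j).slot F
  zero : (f 0).p = 0 ∧ (f 0).q = 0 ∧ (f 0).k = 0 ∧ (f 0).word = []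
  valid : ∀ j < q, 1 ≤ j → ValidRule F f j (f j)

variable {F : Frame n r} {f f' f'' : ℕ → Rule n r} {q q' q'' : ℕ} {s : Store}

theorem HasFrame.of_eq {s' : Store} (h : HasFrame F s)
    (hv : ∀ x ∈ [0, 1, 3, 4, 5], s'.v x = s.v x) (ha : ∀ x ∈ [0, 14, 1, 2], s'.a x = s.a x) :
    HasFrame F s' := by
  simp only [List.mem_cons, List.not_mem_nil, or_false, forall_eq_or_imp, forall_eq] at hv ha
  obtain ⟨v0, v1, v3, v4, v5⟩ := hv
  obtain ⟨a0, a14, a1, a2⟩ := ha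
  exact ⟨v0 ▸ h.n_eq, v1 ▸ h.r_eq, v3 ▸ h.d_eq, v4 ▸ h.e_eq, v5 ▸ h.m_eq, a0 ▸ h.next,
    a14 ▸ h.vis, a1 ▸ h.st, a2 ▸ h.en⟩

theorem HasRules.of_eq {s' : Store} (h : HasRules F f q s)
    (hv : ∀ x ∈ [0, 1, 3, 4, 5, 6], s'.v x = s.v x)
    (ha : ∀ x ∈ [0, 14, 1, 2, 3, 4, 5, 6, 7, 8, 9, 10], s'.a x = s.a x) :
    HasRules F f q s' := by
  have h0 : HasFrame F s' := h.toHasFrame.of_eq (fun x hx => hv x (by simp at hx ⊢; tauto))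
    (fun x hx => ha x (by simp at hx ⊢; tauto))
  simp only [List.mem_cons, List.not_mem_nil, or_false, forall_eq_or_imp, forall_eq] at hv ha
  obtain ⟨-, -, -, -, -, v6⟩ := hv
  obtain ⟨-, -, -, -, a3, a4, a5, a6, a7, a8, a9, a10⟩ := ha
  exact ⟨h0, v6 ▸ h.q_eq, h.q_pos, a4 ▸ h.arr_p, a5 ▸ h.arr_q, a6 ▸ h.arr_k,
    a7 ▸ h.arr_y₁, a8 ▸ h.arr_y₂, a9 ▸ h.arr_a, a10 ▸ h.arr_b, h.p_lt, h.q_lt, h.k_lt, a3 ▸ h.slot_eq, a3 ▸ h.eq_slot, h.zero, h.valid⟩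

theorem HasRules.setVar (h : HasRules F f q s) {x : ℕ} (hx : 6 < x) (z : ℤ) :
    HasRules F f q (s.setVar x z) :=
  h.of_eq (fun y hy => by
    rw [Store.setVar_v, if_neg]
    rintro rfl
    simp at hy
    omega) fun _ _ => rfl

/-- There is a rule for the fact. -/
def Known (f : ℕ → Rule n r) (q p p' k : ℕ) : Prop :=
  ∃ j, 1 ≤ j ∧ j < q ∧ (f j).p = p ∧ (f j).q = p' ∧ (f j).k = k

/-- Rules have been appended. -/
def Extends (f : ℕ → Rule n r) (q : ℕ) (f' : ℕ → Rule n r) (q' : ℕ) : Prop :=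
  q ≤ q' ∧ ∀ j < q, f' j = f j

theorem Extends.refl (f : ℕ → Rule n r) (q : ℕ) : Extends f q f q := ⟨le_rfl, fun _ _ => rfl⟩

theorem Extends.trans (h : Extends f q f' q') (h' : Extends f' q' f'' q'') :
    Extends f q f'' q'' :=
  ⟨h.1.trans h'.1, fun j hj => (h'.2 j (hj.trans_le h.1)).trans (h.2 j hj)⟩

theorem Known.mono {p p' k : ℕ} (h : Known f q p p' k) (h' : Extends f q f' q') :
    Known f' q' p p' k := by
  obtain ⟨j, h1, h2, h3, h4, h5⟩ := h
  refine ⟨j, h1, h2.trans_le h'.1, ?_⟩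
  rw [h'.2 j h2]
  exact ⟨h3, h4, h5⟩

/-- Each fact has at most one rule: the rule number can be read off from the table at the slot of
the fact, so slots are distinct. -/
theorem HasRules.q_le (h : HasRules F f q s) :
    q ≤ F.T.length * F.T.length * (2 * F.d + 1) + 1 := by
  have h1 : (Finset.Ico 1 q).card ≤
      (Finset.range (F.T.length * F.T.length * (2 * F.d + 1))).card := by
    refine Finset.card_le_card_of_injOn (fun j => (f j).slot F) (fun j hj => ?_)
      fun i hi j hj hij => ?_
    · simp only [Finset.coe_Ico, Set.mem_Ico] at hj
      simpa [Rule.slot] using slot_lt (h.p_lt j hj.2) (h.q_lt j hj.2) (h.k_lt j hj.2)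
    · simp only [Finset.coe_Ico, Set.mem_Ico] at hi hj
      have h1 := h.slot_eq i hi.2 hi.1
      have h2 := h.slot_eq j hj.2 hj.1
      simp only at hij
      rw [hij, h2] at h1
      exact_mod_cast h1.symm
  rw [Nat.card_Ico, Finset.card_range] at h1
  omega

theorem HasRules.known_of_pos (h : HasRules F f q s) {p p' k : ℕ} (hp : p' < F.T.length)
    (hk : k < 2 * F.d + 1) (hpos : 0 < s.a 3 (slot F.T.length (2 * F.d + 1) p p' k)) :
    ∃ j, 1 ≤ j ∧ j < q ∧ s.a 3 (slot F.T.length (2 * F.d + 1) p p' k) = j ∧ (f j).p = p ∧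
      (f j).q = p' ∧ (f j).k = k := by
  obtain ⟨j, h1, h2, h3, h4⟩ := h.eq_slot _ hpos
  refine ⟨j, h1, h2, h3, ?_⟩
  obtain ⟨a, b, c⟩ := slot_inj hp hk (h.q_lt j h2) (h.k_lt j h2) (by exact_mod_cast h4)
  exact ⟨a.symm, b.symm, c.symm⟩

theorem Known.pos {p p' k : ℕ} (hk : Known f q p p' k) (h : HasRules F f q s) :
    0 < s.a 3 (slot F.T.length (2 * F.d + 1) p p' k) := by
  obtain ⟨j, h1, h2, rfl, rfl, rfl⟩ := hk
  have := h.slot_eq j h2 h1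
  rw [Rule.slot] at this
  omega

/-- Three cases: too much weight, a fact already in the table, a new fact. A known fact keeps its
older rule, so references always point backwards. -/
theorem HasRules.sem_appendRule (h : HasRules F f q s) (ρ : Rule n r) (hp : s.v 11 = ρ.p)
    (hq : s.v 12 = ρ.q) (hk : s.v 13 = ρ.k) (hy₁ : s.v 14 = encodeSymbol ρ.y₁)
    (hy₂ : s.v 15 = encodeSymbol ρ.y₂) (ha : s.v 16 = optionCode ρ.a)
    (hb : s.v 17 = optionCode ρ.b) (hp_lt : ρ.p < F.T.length) (hq_lt : ρ.q < F.T.length)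
    (hρ : ValidRule F f q ρ) :
    ∃ f' q', HasRules F f' q' (appendRule.sem s) ∧ Extends f q f' q' ∧
      (ρ.k ≤ 2 * F.d → Known f' q' ρ.p ρ.q ρ.k) := by
  have hslot : (slotExpr (var 11) (var 12) (var 13)).eval s = (ρ.slot F : ℕ) := by
    simp [slotExpr, hp, hq, hk, h.m_eq, h.e_eq, Rule.slot, slot]
  by_cases hk' : ρ.k ≤ 2 * F.d
  swap
  · refine ⟨f, q, ?_, .refl _ _, fun h => absurd h hk'⟩
    have : ¬ (0 : ℤ) < 2 * F.d + 1 - ρ.k := by omega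
    rw [appendRule, Cmd.sem_ite, if_neg (by simpa [h.e_eq, hk, -Int.sub_pos, -sub_pos] using this)]
    exact h
  have hpos : (0 : ℤ) < 2 * F.d + 1 - ρ.k := by omega
  have e1 : appendRule.sem s =
      (if 0 < s.a 3 (ρ.slot F) then s.setVar 18 (ρ.slot F) else
        ((((((((((s.setVar 18 (ρ.slot F)).putArr 3 (ρ.slot F) q).putArr 4 q ρ.p).putArr 5 q
          ρ.q).putArr 6 q ρ.k).putArr 7 q (encodeSymbol ρ.y₁)).putArr 8 q
          (encodeSymbol ρ.y₂)).putArr 9 q (optionCode ρ.a)).putArr 10 q (optionCode ρ.b)).setVar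
          6 (q + 1))) := by
    rw [appendRule, Cmd.sem_ite, if_pos (by simpa [h.e_eq, hk, -Int.sub_pos, -sub_pos] using hpos)]
    simp [hslot, h.q_eq, hk, hp, hq, hy₁, hy₂, ha, hb]
  rw [e1]
  by_cases hnew : 0 < s.a 3 (ρ.slot F)
  · rw [if_pos hnew]
    refine ⟨f, q, h.setVar (by omega) _, .refl _ _, fun _ => ?_⟩
    obtain ⟨j, h1, h2, -, h3⟩ := h.known_of_pos hq_lt (by omega) hnew
    exact ⟨j, h1, h2, h3⟩
  rw [if_neg hnew]
  have hlt {j : ℕ} (hj : j < q) : Function.update f q ρ j = f j :=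
    Function.update_of_ne (by omega) _ _
  have hcase (P : ℕ → Rule n r → Prop) (h1 : ∀ j < q, P j (f j)) (h2 : P q ρ) :
      ∀ j < q + 1, P j (Function.update f q ρ j) := by
    intro j hj
    by_cases hjq : j = q
    · subst hjq
      simpa using h2
    · rw [hlt (by omega)]
      exact h1 j (by omega)
  refine ⟨Function.update f q ρ, q + 1, ⟨⟨?_, ?_, ?_, ?_, ?_, ?_, ?_, ?_, ?_⟩, ?_, ?_, ?_, ?_, ?_, ?_,
    ?_, ?_, ?_, ?_, ?_, ?_, ?_, ?_, ?_, ?_⟩, ⟨by omega, fun j hj => hlt hj⟩, fun _ =>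
    ⟨q, h.q_pos, by omega, by simp⟩⟩
  · simp [h.n_eq]
  · simp [h.r_eq]
  · simp [h.d_eq]
  · simp [h.e_eq]
  · simp [h.m_eq]
  · simp [h.next]
  · simp [h.vis]
  · simp [h.st]
  · simp [h.en]
  · simp
  · omega
  · refine hcase (fun j ρ => _ = (ρ.p : ℤ)) (fun j hj => ?_) (by simp)
    have : (j : ℤ) ≠ q := by omega
    simp [this, h.arr_p j hj]
  · refine hcase (fun j ρ => _ = (ρ.q : ℤ)) (fun j hj => ?_) (by simp)
    have : (j : ℤ) ≠ q := by omega
    simp [this, h.arr_q j hj]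
  · refine hcase (fun j ρ => _ = (ρ.k : ℤ)) (fun j hj => ?_) (by simp)
    have : (j : ℤ) ≠ q := by omega
    simp [this, h.arr_k j hj]
  · refine hcase (fun j ρ => 1 ≤ j → _ = encodeSymbol ρ.y₁) (fun j hj hj' => ?_) (by simp)
    have : (j : ℤ) ≠ q := by omega
    simp [this, h.arr_y₁ j hj hj']
  · refine hcase (fun j ρ => 1 ≤ j → _ = encodeSymbol ρ.y₂) (fun j hj hj' => ?_) (by simp)
    have : (j : ℤ) ≠ q := by omega
    simp [this, h.arr_y₂ j hj hj']
  · refine hcase (fun j ρ => 1 ≤ j → _ = optionCode ρ.a) (fun j hj hj' => ?_) (by simp)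
    have : (j : ℤ) ≠ q := by omega
    simp [this, h.arr_a j hj hj']
  · refine hcase (fun j ρ => 1 ≤ j → _ = optionCode ρ.b) (fun j hj hj' => ?_) (by simp)
    have : (j : ℤ) ≠ q := by omega
    simp [this, h.arr_b j hj hj']
  · exact hcase (fun _ ρ => ρ.p < F.T.length) h.p_lt hp_lt
  · exact hcase (fun _ ρ => ρ.q < F.T.length) h.q_lt hq_lt
  · exact hcase (fun _ ρ => ρ.k < 2 * F.d + 1) h.k_lt (by omega)
  · refine hcase (fun j ρ' => 1 ≤ j → Store.a _ 3 (ρ'.slot F : ℤ) = (j : ℤ))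
      (fun j hj hj' => ?_) (by simp)
    have h1 := h.slot_eq j hj hj'
    have : ((f j).slot F : ℤ) ≠ ρ.slot F := by
      intro h2
      rw [h2] at h1
      omega
    simp [this, h1]
  · intro z hz
    by_cases hz' : z = ρ.slot F
    · subst hz'
      exact ⟨q, h.q_pos, by omega, by simp, by simp⟩
    · have h1 : 0 < s.a 3 z := by simpa [hz'] using hz
      obtain ⟨j, h2, h3, h4, h5⟩ := h.eq_slot z h1
      refine ⟨j, h2, by omega, by simpa [hz'] using h4, ?_⟩
      rw [hlt h3, h5]
  · rw [hlt h.q_pos]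
    exact h.zero
  · refine hcase (fun j ρ' => 1 ≤ j → ValidRule F _ j ρ') (fun j hj hj' => ?_) fun _ => ?_
    · exact (h.valid j hj hj').congr fun i hi => hlt (by omega)
    · exact hρ.congr fun i hi => hlt hi

end FreeEq

namespace FreeEq

open RAM FreeGroup
open RAM.Expr (var get)
open RAM.Cmd (skip set put read write ite loop)

variable {n r : ℕ} {F : Frame n r} {f f' f'' : ℕ → Rule n r} {q q' q'' : ℕ} {s : Store}

/-! ### Adding rules -/

/-- The arguments are assigned one after another to the scalars `11` to `17`. A later argument is
evaluated after earlier assignments, so `he` asks for its value in every store that differs only in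
these scalars. -/
theorem HasRules.sem_addRule (h : HasRules F f q s) {p p' k y₁ y₂ a b : Expr} (ρ : Rule n r)
    (he : ∀ s' : Store, s'.a = s.a → (∀ x, x < 11 ∨ 17 < x → s'.v x = s.v x) →
      p.eval s' = ρ.p ∧ p'.eval s' = ρ.q ∧ k.eval s' = ρ.k ∧ y₁.eval s' = encodeSymbol ρ.y₁ ∧
      y₂.eval s' = encodeSymbol ρ.y₂ ∧ a.eval s' = optionCode ρ.a ∧ b.eval s' = optionCode ρ.b)
    (hp_lt : ρ.p < F.T.length) (hq_lt : ρ.q < F.T.length) (hρ : ValidRule F f q ρ) :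
    ∃ f' q', HasRules F f' q' ((addRule p p' k y₁ y₂ a b).sem s) ∧ Extends f q f' q' ∧
      (ρ.k ≤ 2 * F.d → Known f' q' ρ.p ρ.q ρ.k) := by
  have aux (s' : Store) (x : ℕ) (hx : 11 ≤ x ∧ x ≤ 17) (z : ℤ)
      (h' : s'.a = s.a ∧ (∀ x, x < 11 ∨ 17 < x → s'.v x = s.v x) ∧ HasRules F f q s') :
      (s'.setVar x z).a = s.a ∧ (∀ y, y < 11 ∨ 17 < y → (s'.setVar x z).v y = s.v y) ∧
        HasRules F f q (s'.setVar x z) := by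
    refine ⟨h'.1, fun y hy => ?_, h'.2.2.setVar (by omega) _⟩
    rw [Store.setVar_v, if_neg (by omega), h'.2.1 y hy]
  have h1 := aux s 11 (by omega) ρ.p ⟨rfl, fun _ _ => rfl, h⟩
  have h2 := aux _ 12 (by omega) ρ.q h1
  have h3 := aux _ 13 (by omega) ρ.k h2
  have h4 := aux _ 14 (by omega) (encodeSymbol ρ.y₁) h3
  have h5 := aux _ 15 (by omega) (encodeSymbol ρ.y₂) h4
  have h6 := aux _ 16 (by omega) (optionCode ρ.a) h5
  have h7 := aux _ 17 (by omega) (optionCode ρ.b) h6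
  have e : (addRule p p' k y₁ y₂ a b).sem s = appendRule.sem (((((((s.setVar 11 ρ.p).setVar 12
      ρ.q).setVar 13 ρ.k).setVar 14 (encodeSymbol ρ.y₁)).setVar 15 (encodeSymbol ρ.y₂)).setVar 16
      (optionCode ρ.a)).setVar 17 (optionCode ρ.b)) := by
    simp only [addRule, Cmd.sem_seq, Cmd.sem_set, (he _ rfl fun _ _ => rfl).1,
      (he _ h1.1 h1.2.1).2.1, (he _ h2.1 h2.2.1).2.2.1, (he _ h3.1 h3.2.1).2.2.2.1,
      (he _ h4.1 h4.2.1).2.2.2.2.1, (he _ h5.1 h5.2.1).2.2.2.2.2.1,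
      (he _ h6.1 h6.2.1).2.2.2.2.2.2]
  rw [e]
  exact h7.2.2.sem_appendRule ρ (by simp) (by simp) (by simp) (by simp) (by simp) (by simp)
    (by simp) hp_lt hq_lt hρ

theorem HasRules.symbol_zero (h : HasRules F f q s) :
    symbolWord f (Sum.inr 0) = [] ∧ symbolWeight f (Sum.inr 0) = 0 ∧
      symbolValue F f (Sum.inr 0) = 1 ∧ SymbolLt (Sum.inr 0 : Letter r ⊕ ℕ) q := by
  obtain ⟨h1, h2, h3, h4⟩ := h.zero
  refine ⟨h4, h3, ?_, ?_⟩
  · simp only [symbolValue, Sum.elim_inr, h1, h2, h4]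
    exact pathValue_refl 0
  · rintro i ⟨⟩
    exact h.q_pos

theorem symbolLt_inr {i j : ℕ} (h : i < j) : SymbolLt (Sum.inr i : Letter r ⊕ ℕ) j := by
  rintro _ ⟨⟩
  exact h

theorem HasRules.sem_addTrivial (h : HasRules F f q s) {i : ℕ} (hi : i < F.T.length)
    (hs : s.v 19 = i) : ∃ f' q', HasRules F f' q' (addTrivial.sem s) ∧ Extends f q f' q' ∧
      Known f' q' i i 0 := by
  obtain ⟨z1, z2, z3, z4⟩ := h.symbol_zero
  obtain ⟨f', q', h1, h2, h3⟩ := h.sem_addRule ⟨i, i, 0, Sum.inr 0, Sum.inr 0, none, none, []⟩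
    (p := var 19) (p' := var 19) (k := 0) (y₁ := var 1 + 2) (y₂ := var 1 + 2) (a := 0) (b := 0)
    (fun s' ha hv => by simp [hv, hs, h.r_eq, encodeSymbol, optionCode]) hi hi
    ⟨IsFact.refl hi, by simp [z1], z4, z4, by simp [z2], by
      rw [pathValue_refl, z3, Option.toList_none, ← FreeGroup.one_eq_mk]
      simp⟩
  exact ⟨f', q', h1, h2, h3 (Nat.zero_le _)⟩

theorem Frame.st_lt (F : Frame n r) (t : Letter r) : F.st t < F.T.length :=
  (List.getElem?_eq_some_iff.1 (F.layout.st_get t trivial)).1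

theorem Frame.en_lt (F : Frame n r) (t : Letter r) : F.en t < F.T.length :=
  (List.getElem?_eq_some_iff.1 (F.layout.en_get (s := t) trivial)).1

theorem HasRules.sem_addSilent (h : HasRules F f q s)
    (h27 : -((r : ℤ) + 1) ≤ s.v 27 ∧ s.v 27 ≤ r + 1)
    (h28 : -((r : ℤ) + 1) ≤ s.v 28 ∧ s.v 28 ≤ r + 1) :
    ∃ f' q', HasRules F f' q' (addSilent.sem s) ∧ Extends f q f' q' ∧
      ∀ t u : Letter r, encodeLetter t = s.v 27 → encodeLetter u = s.v 28 →
        (t.1 = u.1 → t.2 = u.2) → weight t + weight u ≤ 2 * F.d →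
        Known f' q' (F.en t) (F.st u) (weight t + weight u) := by
  by_cases hc : s.v 27 ≠ 0 ∧ s.v 28 ≠ 0 ∧ s.v 27 + s.v 28 ≠ 0
  swap
  · have hz : s.v 27 * s.v 28 * (s.v 27 + s.v 28) = 0 := by
      by_contra hz
      refine hc ⟨?_, ?_, ?_⟩ <;> intro h0 <;> simp [h0] at hz
    refine ⟨f, q, ?_, .refl _ _, fun t u ht hu htu _ => ?_⟩
    · rw [addSilent, Cmd.sem_ite, if_neg (by simp [hz])]
      exact h
    · refine absurd ⟨?_, ?_, ?_⟩ hc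
      · exact ht ▸ encodeLetter_ne_zero t
      · exact hu ▸ encodeLetter_ne_zero u
      · rw [← ht, ← hu]
        exact (encodeLetter_add_eq_zero t u).2 htu
  obtain ⟨c1, c2, c3⟩ := hc
  obtain ⟨t, ht⟩ := exists_encodeLetter_eq c1 h27.1 h27.2
  obtain ⟨u, hu⟩ := exists_encodeLetter_eq c2 h28.1 h28.2
  have htu : t.1 = u.1 → t.2 = u.2 := by
    rw [← encodeLetter_add_eq_zero, ht, hu]
    exact c3
  have hpos : 0 < s.v 27 * s.v 28 * (s.v 27 + s.v 28) * (s.v 27 * s.v 28 * (s.v 27 + s.v 28)) :=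
    mul_self_pos.2 (mul_ne_zero (mul_ne_zero c1 c2) c3)
  obtain ⟨z1, z2, z3, z4⟩ := h.symbol_zero
  -- The letter contributed to the explicit equation: `x^{±1}` if the jump enters it, otherwise
  -- nothing.
  let a : Option (Option (Fin n) × Bool) := if u.1 = none then some (none, u.2) else none
  let s₁ := (s.setVar 29 (weight t)).setVar 32 (weight u)
  have hs₁ : HasRules F f q (s₁.setVar 33 (optionCode a)) :=
    ((h.setVar (by omega) _).setVar (by omega) _).setVar (by omega) _
  have e : addSilent.sem s = (addRule (get 2 (var 27)) (get 1 (var 28)) (var 29 + var 32) (var 28)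
      (var 1 + 2) (var 33) 0).sem (s₁.setVar 33 (optionCode a)) := by
    have g1 := encodeLetter_sq t
    have g2 := encodeLetter_sq u
    rw [ht] at g1
    rw [hu] at g2
    rw [addSilent, Cmd.sem_ite, if_pos (by simpa using hpos), Cmd.sem_seq, Cmd.sem_seq]
    congr 1
    have e1 : (ite (var 27 * var 27 - var 1 * var 1) (set 29 1) (set 29 0)).sem s =
        s.setVar 29 (weight t) := by
      rw [Cmd.sem_ite]
      by_cases h1 : t.1 = none
      · rw [if_pos (by simpa [h.r_eq, -Int.sub_pos, -sub_pos] using g1.2 h1)]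
        simp [weight, h1]
      · rw [if_neg (by simpa [h.r_eq, -Int.sub_pos, -sub_pos] using mt g1.1 h1)]
        simp [weight, h1]
    rw [e1, Cmd.sem_ite]
    by_cases h1 : u.1 = none
    · rw [if_pos (by simpa [h.r_eq, -Int.sub_pos, -sub_pos] using g2.2 h1)]
      have h2 : weight u = 1 := by simp [weight, h1]
      have h3 : a = some (none, u.2) := if_pos h1
      have h4 : s.v 28 = signed r u.2 := by
        rw [← hu, encodeLetter, h1]
        rfl
      simp only [Cmd.sem_seq, Cmd.sem_set, Cmd.sem_ite, s₁, h2, h3, optionCode, Option.elim_some,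
        encodeLetter, Option.elim_none, Expr.eval_var, Expr.eval_one, Store.setVar_v,
        Expr.eval_add, Expr.eval_sub, Expr.eval_zero]
      cases hε : u.2
      · rw [hε] at h4
        rw [if_neg (by simp [h4, signed])]
        simp [h.n_eq, signed]
      · rw [hε] at h4
        rw [if_pos (by simp [h4, signed])]
        simp [h.n_eq, signed]
    · rw [if_neg (by simpa [h.r_eq, -Int.sub_pos, -sub_pos] using mt g2.1 h1)]
      have h2 : weight u = 0 := by simp [weight, h1]
      have h3 : a = none := if_neg h1
      simp [s₁, h2, h3, optionCode]
  rw [e]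
  obtain ⟨f', q', h1, h2, h3⟩ := hs₁.sem_addRule
    ⟨F.en t, F.st u, weight t + weight u, Sum.inl u, Sum.inr 0, a, none, [u]⟩
    (p := get 2 (var 27)) (p' := get 1 (var 28)) (k := var 29 + var 32) (y₁ := var 28)
    (y₂ := var 1 + 2) (a := var 33) (b := 0)
    (fun s' ha hv => by
      simp [hv, ha, s₁, ← ht, ← hu, h.r_eq, h.st, h.en, encodeSymbol, optionCode])
    (F.en_lt t) (F.st_lt u)
    ⟨IsFact.silent F.layout trivial trivial htu, by simp only [z1, List.append_nil]; rfl,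
      fun i hi => by simp at hi, z4, by simp only [z2, add_zero]; exact Nat.zero_le _, by
        rw [pathValue_silent F.layout trivial trivial, z3]
        simp only [symbolValue, Sum.elim_inl, Option.toList_none, a, ← FreeGroup.one_eq_mk]
        split <;> simp [← FreeGroup.one_eq_mk]⟩
  refine ⟨f', q', h1, h2, fun t' u' ht' hu' _ hk => ?_⟩
  rw [← ht] at ht'
  rw [← hu] at hu'
  rw [encodeLetter_injective ht', encodeLetter_injective hu'] at hk ⊢
  exact h3 hk

theorem tapeArray_natCast (c : Position n r → ℤ) (T : List (Position n r)) (p : ℕ) :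
    tapeArray c T p = T[p]?.elim 0 c := by
  simp [tapeArray]

theorem exists_of_tapeArray_ne_zero {T : List (Position n r)} {z : ℤ}
    (h : tapeArray nextCode T z ≠ 0) : ∃ (p : ℕ) (t : Letter r) (i : Fin n) (ε : Bool)
      (l : List (Fin n × Bool)), z = p ∧ T[p]? = some (t, (i, ε) :: l) ∧
        tapeArray nextCode T z = signed i ε := by
  unfold tapeArray at h ⊢
  by_cases hz : 0 ≤ z
  swap
  · rw [if_neg hz] at h
    exact absurd rfl h
  rw [if_pos hz] at h ⊢
  obtain ⟨p, rfl⟩ := Int.eq_ofNat_of_zero_le hz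
  simp only [Int.toNat_natCast] at h ⊢
  rcases hT : T[p]? with _ | ⟨t, _ | ⟨⟨i, ε⟩, l⟩⟩
  · simp [hT] at h
  · simp [hT, nextCode] at h
  · exact ⟨p, t, i, ε, l, rfl, hT, by simp [nextCode]⟩

theorem optionCode_visible (t : Letter r) (i : Fin n) (ε : Bool) (l : List (Fin n × Bool)) :
    visibleCode (t, (i, ε) :: l) = optionCode (visible t (i, ε)) := by
  unfold visibleCode visible optionCode
  split <;> simp [nextCode, encodeLetter, *]

theorem HasRules.sem_addWrap (h : HasRules F f q s) {j : ℕ} (hj : 1 ≤ j) (hjq : j < q)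
    (h20 : s.v 20 = (f j).p) (h21 : s.v 21 = (f j).q) (h22 : s.v 22 = (f j).k) (h23 : s.v 23 = j) :
    ∃ f' q', HasRules F f' q' (addWrap.sem s) ∧ Extends f q f' q' ∧
      ∀ p (t u : Letter r) (i : Fin n) (ε : Bool) (l l' : List (Fin n × Bool)), (f j).p = p + 1 →
        F.T[p]? = some (t, (i, ε) :: l) → F.T[(f j).q]? = some (u, (i, !ε) :: l') →
        Known f' q' p ((f j).q + 1) (f j).k := by
  -- If the path starts at position `0`, this reads entry `-1`, which is `0`, and the test fails as
  -- it should.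
  let z₁ := tapeArray nextCode F.T ((f j).p - 1)
  let z₂ := tapeArray nextCode F.T (f j).q
  let s₁ := (s.setVar 27 z₁).setVar 28 z₂
  have hs₁ : HasRules F f q s₁ := (h.setVar (by omega) _).setVar (by omega) _
  have e : addWrap.sem s = (ite (var 27 * var 27 * (1 - (var 27 + var 28) * (var 27 + var 28)))
      (addRule (var 20 - 1) (var 21 + 1) (var 22) (var 1 + 2 + var 23) (var 1 + 2)
        (get 14 (var 20 - 1)) (get 14 (var 21))) skip).sem s₁ := by
    simp [addWrap, h.next, h20, h21, s₁, z₁, z₂]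
  rw [e]
  by_cases hc : z₁ ≠ 0 ∧ z₁ + z₂ = 0
  swap
  · rw [Cmd.sem_ite, if_neg]
    · refine ⟨f, q, hs₁, .refl _ _, fun p t u i ε l l' hp ht hu => absurd ⟨?_, ?_⟩ hc⟩
      · simp only [z₁, hp]
        rw [Nat.cast_succ, add_sub_cancel_right, tapeArray_natCast, ht]
        simpa [nextCode] using signed_ne_zero _ _
      · simp only [z₁, z₂, hp]
        rw [Nat.cast_succ, add_sub_cancel_right, tapeArray_natCast, tapeArray_natCast, ht, hu]
        simp [nextCode, signed_not]
    · simp only [Expr.eval_mul, Expr.eval_sub, Expr.eval_add, Expr.eval_one, Expr.eval_var, s₁,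
        Store.setVar_v, if_true, not_lt]
      norm_num
      by_cases h1 : z₁ = 0
      · simp [h1]
      · have h2 : z₁ + z₂ ≠ 0 := fun h2 => hc ⟨h1, h2⟩
        have h3 := mul_self_pos.2 h2
        have h4 := mul_self_pos.2 h1
        nlinarith
  obtain ⟨h1, h2⟩ := hc
  obtain ⟨p, t, i, ε, l, g1, g2, g3⟩ := exists_of_tapeArray_ne_zero h1
  have h2' : tapeArray nextCode F.T (f j).q ≠ 0 := by
    change z₂ ≠ 0
    omega
  obtain ⟨p', u, i', ε', l', g4, g5, g6⟩ := exists_of_tapeArray_ne_zero h2'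
  obtain rfl : (f j).q = p' := by exact_mod_cast g4
  have hpp : (f j).p = p + 1 := by omega
  have g7 : signed i' ε' = signed i (!ε) := by
    rw [signed_not, ← g3, ← g6]
    change z₂ = -z₁
    omega
  obtain ⟨g8, rfl⟩ := signed_inj.1 g7
  obtain rfl : i' = i := Fin.ext g8
  obtain ⟨z1, z2, z3, z4⟩ := h.symbol_zero
  rw [Cmd.sem_ite, if_pos]
  swap
  · simp only [Expr.eval_mul, Expr.eval_sub, Expr.eval_add, Expr.eval_one, Expr.eval_var, s₁,
      Store.setVar_v, if_true]
    norm_num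
    rw [h2]
    simpa using h1
  have hv := h.valid j hjq hj
  obtain ⟨f', q', k1, k2, k3⟩ := hs₁.sem_addRule
    ⟨p, (f j).q + 1, (f j).k, Sum.inr j, Sum.inr 0, visible t (i', ε), visible u (i', !ε),
      (f j).word⟩
    (p := var 20 - 1) (p' := var 21 + 1) (k := var 22) (y₁ := var 1 + 2 + var 23)
    (y₂ := var 1 + 2) (a := get 14 (var 20 - 1)) (b := get 14 (var 21))
    (fun s' ha hv => by
      simp [hv, ha, s₁, h20, hpp, h21, h22, h23, h.r_eq, h.vis, encodeSymbol, tapeArray_natCast, g2, g5,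
        optionCode_visible])
    (List.getElem?_eq_some_iff.1 g2).1
    (List.getElem?_eq_some_iff.1 (F.layout.step _ _ _ _ g5)).1
    ⟨IsFact.wrap F.layout g2 g5 (by rw [← hpp]; exact hv.fact), by simp only [z1, List.append_nil]; rfl,
      symbolLt_inr hjq, z4, by simp only [z2, add_zero]; exact le_rfl, by
        simp only
        rw [pathValue_wrap F.layout _ g2 g5, z3, mul_one]
        simp only [symbolValue, Sum.elim_inr, hpp]⟩
  refine ⟨f', q', k1, k2, fun p₀ t' u' i ε l l' hp _ _ => ?_⟩
  obtain rfl : p₀ = p := by omega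
  exact k3 (by have := h.k_lt j hjq; simp only; omega)

theorem HasRules.slotExpr_eval {f : ℕ → Rule n r} {q : ℕ} {s s' : Store} (h : HasRules F f q s)
    {x y z p p' k : ℕ} (h4 : s'.v 4 = s.v 4) (h5 : s'.v 5 = s.v 5) (hx : s'.v x = p)
    (hy : s'.v y = p') (hz : s'.v z = k) :
    (slotExpr (var x) (var y) (var z)).eval s' = slot F.T.length (2 * F.d + 1) p p' k := by
  simp [slotExpr, slot, h4, h5, hx, hy, hz, h.m_eq, h.e_eq]

/-- The rule that joins two facts. -/
def joinRule (f : ℕ → Rule n r) (i j : ℕ) : Rule n r :=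
  ⟨(f i).p, (f j).q, (f i).k + (f j).k, Sum.inr i, Sum.inr j, none, none, (f i).word ++ (f j).word⟩

theorem HasRules.concat (h : HasRules F f q s) {i j : ℕ} (hi : 1 ≤ i) (hiq : i < q) (hj : 1 ≤ j)
    (hjq : j < q) (hij : (f i).q = (f j).p) :
    ValidRule F f q (joinRule f i j) := by
  have h1 := (h.valid i hiq hi).fact
  have h2 := (h.valid j hjq hj).fact
  rw [← hij] at h2
  refine ⟨h1.concat h2, rfl, symbolLt_inr hiq, symbolLt_inr hjq, le_rfl, ?_⟩
  simp only [joinRule]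
  rw [pathValue_concat _ (f i).q]
  simp [symbolValue, hij, ← FreeGroup.one_eq_mk]

/-- The first join may already append a rule, so the second one is carried out with the extended
family `f₁`; facts known before remain known there. -/
theorem HasRules.sem_addJoins (h : HasRules F f q s) {j p k : ℕ} (hj : 1 ≤ j) (hjq : j < q)
    (h20 : s.v 20 = (f j).p) (h21 : s.v 21 = (f j).q) (h22 : s.v 22 = (f j).k) (h23 : s.v 23 = j)
    (h24 : s.v 24 = p) (hp : p < F.T.length) (h25 : s.v 25 = k) (hk : k < 2 * F.d + 1) :
    ∃ f' q', HasRules F f' q' (addJoins.sem s) ∧ Extends f q f' q' ∧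
      (Known f q (f j).q p k → (f j).k + k ≤ 2 * F.d → Known f' q' (f j).p p ((f j).k + k)) ∧
      (Known f q p (f j).p k → k + (f j).k ≤ 2 * F.d → Known f' q' p (f j).q (k + (f j).k)) := by
  let s₁ := s.setVar 26 (s.a 3 (slot F.T.length (2 * F.d + 1) (f j).q p k))
  have hs₁ : HasRules F f q s₁ := h.setVar (by omega) _
  let s₂ := (ite (var 26) (addRule (var 20) (var 24) (var 22 + var 25) (var 1 + 2 + var 23)
    (var 1 + 2 + var 26) 0 0) skip).sem s₁
  have step1 : ∃ f' q', HasRules F f' q' s₂ ∧ Extends f q f' q' ∧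
      (Known f q (f j).q p k → (f j).k + k ≤ 2 * F.d → Known f' q' (f j).p p ((f j).k + k)) := by
    by_cases hc : 0 < s.a 3 (slot F.T.length (2 * F.d + 1) (f j).q p k)
    · obtain ⟨i, i1, i2, i3, i4, rfl, rfl⟩ := h.known_of_pos hp hk hc
      simp only [s₂]
      rw [Cmd.sem_ite, if_pos (by simpa [s₁] using hc)]
      obtain ⟨f', q', k1, k2, k3⟩ := hs₁.sem_addRule (joinRule f j i) (p := var 20) (p' := var 24)
        (k := var 22 + var 25) (y₁ := var 1 + 2 + var 23) (y₂ := var 1 + 2 + var 26) (a := 0)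
        (b := 0) (fun s' ha hv => by
          simp [hv, s₁, h20, h22, h23, h24, h25, h.r_eq, i3, encodeSymbol, optionCode,
            joinRule])
        (h.p_lt j hjq) hp (h.concat hj hjq i1 i2 i4.symm)
      exact ⟨f', q', k1, k2, fun _ => k3⟩
    · simp only [s₂]
      rw [Cmd.sem_ite, if_neg (by simpa [s₁] using hc)]
      exact ⟨f, q, hs₁, .refl _ _, fun hK => absurd (hK.pos h) hc⟩
  obtain ⟨f₁, q₁, h1, h2, h3⟩ := step1
  have hv (x : ℕ) (hx : x ∉ addJoins.vars) : s₂.v x = s.v x := by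
    refine (Cmd.sem_v _ (fun h => hx ?_) _).trans ?_
    · simp only [addJoins, Cmd.vars] at h ⊢
      simp only [List.mem_append] at h ⊢
      tauto
    · simp only [addJoins, Cmd.vars, List.cons_append, List.mem_cons, not_or] at hx
      simp [s₁, hx.1]
  have hjf : f₁ j = f j := h2.2 j hjq
  let s₃ := s₂.setVar 26 (s₂.a 3 (slot F.T.length (2 * F.d + 1) p (f j).p k))
  have hs₃ : HasRules F f₁ q₁ s₃ := h1.setVar (by omega) _
  have e : addJoins.sem s = (ite (var 26) (addRule (var 24) (var 21) (var 25 + var 22)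
      (var 1 + 2 + var 26) (var 1 + 2 + var 23) 0 0) skip).sem s₃ := by
    simp only [addJoins, Cmd.sem_seq]
    congr 1
    have e1 : (set 26 (get 3 (slotExpr (var 21) (var 24) (var 25)))).sem s = s₁ := by
      rw [Cmd.sem_set, Expr.eval_get, h.slotExpr_eval rfl rfl h21 h24 h25]
    rw [e1]
    change (set 26 (get 3 (slotExpr (var 24) (var 20) (var 25)))).sem s₂ = s₃
    rw [Cmd.sem_set, Expr.eval_get, h.slotExpr_eval (hv 4 (by decide)) (hv 5 (by decide))
      ((hv 24 (by decide)).trans h24) ((hv 20 (by decide)).trans h20)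
      ((hv 25 (by decide)).trans h25)]
  rw [e]
  by_cases hc : 0 < s₂.a 3 (slot F.T.length (2 * F.d + 1) p (f j).p k)
  · obtain ⟨i, i1, i2, i3, rfl, i4, rfl⟩ := h1.known_of_pos (h.p_lt j hjq) hk hc
    rw [Cmd.sem_ite, if_pos (by simpa [s₃] using hc)]
    obtain ⟨f', q', k1, k2, k3⟩ := hs₃.sem_addRule (joinRule f₁ i j) (p := var 24) (p' := var 21)
      (k := var 25 + var 22) (y₁ := var 1 + 2 + var 26) (y₂ := var 1 + 2 + var 23) (a := 0)
      (b := 0) (fun s' ha hv' => by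
        simp [hv', s₃, hv 21 (by decide), hv 22 (by decide), hv 23 (by decide), hv 24 (by decide),
          hv 25 (by decide), hv 1 (by decide), h21, h22, h23, h24, h25, h.r_eq, i3, encodeSymbol,
          optionCode, joinRule, hjf])
      hp (by simp only [joinRule, hjf]; exact h.q_lt j hjq)
      (h1.concat i1 i2 hj (hjq.trans_le h2.1) (by rw [i4, hjf]))
    simp only [joinRule, hjf] at k3
    exact ⟨f', q', k1, h2.trans k2, fun a b => (h3 a b).mono k2, fun _ => k3⟩
  · rw [Cmd.sem_ite, if_neg (by simpa [s₃] using hc)]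
    exact ⟨f₁, q₁, hs₃, h2, h3, fun hK => absurd ((hK.mono h2).pos h1) hc⟩

end FreeEq

namespace FreeEq

open RAM FreeGroup
open RAM.Expr (var get)
open RAM.Cmd (skip set put read write ite loop)

variable {n r : ℕ} {F : Frame n r} {f f' f'' : ℕ → Rule n r} {q q' q'' : ℕ} {s : Store}

/-! ### The initial rules -/

/-- There are rules for the facts that lead from the end of `t` to the start of `u`, for all letters
`t` and `u` with `A t u`. -/
def SilentKnown (F : Frame n r) (f : ℕ → Rule n r) (q : ℕ) (A : Letter r → Letter r → Prop) :
    Prop :=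
  ∀ t u, A t u → (t.1 = u.1 → t.2 = u.2) → weight t + weight u ≤ 2 * F.d →
    Known f q (F.en t) (F.st u) (weight t + weight u)

theorem SilentKnown.mono {A : Letter r → Letter r → Prop} (h : SilentKnown F f q A)
    (h' : Extends f q f' q') : SilentKnown F f' q' A :=
  fun t u htu h1 h2 => (h t u htu h1 h2).mono h'

theorem HasFrame.hasRules_one (h : HasFrame F s)
    (ha : ∀ a ∈ [3, 4, 5, 6], s.a a = 0) (hM : 0 < F.T.length) :
    HasRules F (fun _ => ⟨0, 0, 0, Sum.inr 0, Sum.inr 0, none, none, []⟩) 1 (s.setVar 6 1) := by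
  simp only [List.mem_cons, List.not_mem_nil, or_false, forall_eq_or_imp, forall_eq] at ha
  obtain ⟨h3, h4, h5, h6⟩ := ha
  refine ⟨h.of_eq (fun x hx => ?_) fun _ _ => rfl, by simp, le_rfl, ?_, ?_, ?_, ?_, ?_, ?_, ?_,
    fun _ _ => hM, fun _ _ => hM, fun _ _ => by simp, ?_, ?_, ⟨rfl, rfl, rfl, rfl⟩, ?_⟩
  · rw [Store.setVar_v, if_neg]
    rintro rfl
    simp at hx
  · simp [h4]
  · simp [h5]
  · simp [h6]
  all_goals first
    | exact fun j hj hj' => absurd hj (by omega)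
    | (intro z hz; simp [h3] at hz)

/-- The two nested loops run over all codes from `-(r + 1)` to `r + 1`; the invariants describe the
finished pairs of letters by the order of their codes. The code `0` belongs to no letter and is
rejected by `addSilent`. -/
theorem ens_initRules (h : HasFrame F s) (ha : ∀ a ∈ [3, 4, 5, 6], s.a a = 0)
    (hM : 0 < F.T.length) :
    initRules.Ens s (100 + F.T.length * 200 + (2 * r + 3) * ((2 * r + 3) * 400 + 100))
      fun s' => ∃ f q, HasRules F f q s' ∧ (∀ p < F.T.length, Known f q p p 0) ∧
        SilentKnown F f q fun _ _ => True := by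
  have hsep (t : Letter r) (c : ℕ) : encodeLetter t < ((c + 1 : ℕ) : ℤ) - (r + 1) →
      encodeLetter t < (c : ℤ) - (r + 1) ∨ encodeLetter t = (c : ℤ) - (r + 1) := by
    intro h
    push_cast at h
    omega
  have E1 : (set 6 1).Ens s 10 fun s' => ∃ f q, HasRules F f q s' :=
    (Cmd.Ens.of_flat rfl ⟨_, _, h.hasRules_one ha hM⟩).mono (by decide) fun _ => id
  have E2 (s : Store) (hs : ∃ f q, HasRules F f q s) : (loop 19 (var 5) addTrivial).Ens s
      (20 + F.T.length * 200) fun s' => ∃ f q, HasRules F f q s' ∧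
        ∀ p < F.T.length, Known f q p p 0 := by
    obtain ⟨f, q, hs⟩ := hs
    refine (Cmd.Ens.loop (B := 190) (N := F.T.length)
      (fun i s' => ∃ f q, HasRules F f q s' ∧ ∀ p < i, Known f q p p 0) (by simpa using hs.m_eq)
      ⟨f, q, hs, fun _ h => absurd h (by omega)⟩ ?_).mono (by simp [Expr.cost]; omega) fun _ => id
    rintro i hi s' ⟨f, q, hs, hK⟩
    obtain ⟨f', q', h1, h2, h3⟩ := (hs.setVar (x := 19) (by omega) i).sem_addTrivial hi (by simp)
    refine (Cmd.Ens.of_flat rfl ⟨f', q', h1, fun p hp => ?_⟩).mono (by decide) fun _ => id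
    rcases Nat.lt_succ_iff_lt_or_eq.1 hp with hp | rfl
    · exact (hK p hp).mono h2
    · exact h3
  let Inv (s : Store) (A : Letter r → Letter r → Prop) : Prop := ∃ f q, HasRules F f q s ∧
    (∀ p < F.T.length, Known f q p p 0) ∧ SilentKnown F f q A
  have hN {f q s} (hs : HasRules F f q s) :
      (2 * var 1 + 3 : Expr).eval s = ((2 * r + 3 : ℕ) : ℤ) := by simp [hs.r_eq]
  have E3 (s : Store) (c : ℕ) (hc : c < 2 * r + 3) (h19 : s.v 19 = c)
      (hs : Inv s fun t _ => encodeLetter t < (c : ℤ) - (r + 1)) :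
      (set 27 (var 19 - (var 1 + 1)) ;;
        loop 20 (2 * var 1 + 3) (set 28 (var 20 - (var 1 + 1)) ;; addSilent)).Ens s
        (50 + (2 * r + 3) * 400) fun s' =>
          Inv s' fun t _ => encodeLetter t < ((c + 1 : ℕ) : ℤ) - (r + 1) := by
    obtain ⟨f, q, hs, hK, hS⟩ := hs
    have A1 : (set 27 (var 19 - (var 1 + 1))).Ens s 10 fun s' => s'.v 27 = (c : ℤ) - (r + 1) ∧
        Inv s' fun t _ => encodeLetter t < (c : ℤ) - (r + 1) :=
      (Cmd.Ens.of_flat rfl ⟨by simp [h19, hs.r_eq], f, q, hs.setVar (by omega) _, hK, hS⟩).mono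
        (by decide) fun _ => id
    refine (A1.seq (B' := 40 + (2 * r + 3) * 400) ?_).mono (by omega) fun _ => id
    rintro s ⟨h27, f, q, hs, hK, hS⟩
    refine (Cmd.Ens.loop (B := 350) (N := 2 * r + 3) (fun e s' => s'.v 27 = (c : ℤ) - (r + 1) ∧
      Inv s' fun t u => encodeLetter t < (c : ℤ) - (r + 1) ∨
        encodeLetter t = (c : ℤ) - (r + 1) ∧ encodeLetter u < (e : ℤ) - (r + 1)) (hN hs)
      ⟨h27, f, q, hs, hK, fun t u htu => hS t u (htu.resolve_right fun h => ?_)⟩ ?_).mono ?_ ?_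
    · have := (abs_encodeLetter_le u).1
      push_cast at h
      omega
    · rintro e he s' ⟨h27, f, q, hs, hK, hS⟩
      refine (Cmd.Ens.of_flat rfl ?_).mono (by decide) fun _ => id
      have hs' := (hs.setVar (x := 20) (by omega) e).setVar (x := 28) (by omega) (e - (r + 1))
      have e1 : (set 28 (var 20 - (var 1 + 1))).sem (s'.setVar 20 e) =
          (s'.setVar 20 e).setVar 28 (e - (r + 1)) := by simp [hs.r_eq]
      rw [Cmd.sem_seq, e1]
      obtain ⟨f', q', h1, h2, h3⟩ := hs'.sem_addSilent (by simp [h27]; omega) (by simp; omega)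
      refine ⟨(Cmd.sem_v _ (by decide) _).trans (by simp [h27]), f', q', h1,
        fun p hp => (hK p hp).mono h2, fun t u htu a1 a2 => ?_⟩
      by_cases h4 : encodeLetter t < (c : ℤ) - (r + 1) ∨
        encodeLetter t = (c : ℤ) - (r + 1) ∧ encodeLetter u < (e : ℤ) - (r + 1)
      · exact (hS t u h4 a1 a2).mono h2
      · have h5 : encodeLetter t = (c : ℤ) - (r + 1) ∧ encodeLetter u = (e : ℤ) - (r + 1) := by
          push_cast at htu
          omega
        exact h3 t u (by simp [h27, h5.1]) (by simp [h5.2]) a1 a2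
    · simp [Expr.cost]
      omega
    · rintro s' ⟨-, f, q, hs, hK, hS⟩
      refine ⟨f, q, hs, hK, fun t u htu => hS t u ?_⟩
      have := (abs_encodeLetter_le u).2
      rcases hsep t c htu with h | h
      · exact Or.inl h
      · refine Or.inr ⟨h, ?_⟩
        push_cast
        omega
  refine (E1.seq (B' := 90 + F.T.length * 200 + (2 * r + 3) * ((2 * r + 3) * 400 + 100))
    fun s hs => (E2 s hs).seq (B' := 70 + (2 * r + 3) * ((2 * r + 3) * 400 + 100))
      (fun s hs => ?_) |>.mono (by omega) fun _ => id).mono (by omega) fun _ => id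
  obtain ⟨f, q, hs, hK⟩ := hs
  refine (Cmd.Ens.loop (B := 50 + (2 * r + 3) * 400) (N := 2 * r + 3) (fun c s' => Inv s' fun t _ =>
    encodeLetter t < (c : ℤ) - (r + 1)) (hN hs) ⟨f, q, hs, hK, fun t u htu => ?_⟩
    fun c hc s' hs' => E3 _ c hc (by simp) ?_).mono ?_ ?_
  · have := (abs_encodeLetter_le t).1
    push_cast at htu
    omega
  · obtain ⟨f, q, hs, h'⟩ := hs'
    exact ⟨f, q, hs.setVar (by omega) _, h'⟩
  · simp only [Expr.cost]
    have : (2 * r + 3) * (50 + (2 * r + 3) * 400 + 7) ≤ (2 * r + 3) * ((2 * r + 3) * 400 + 100) :=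
      Nat.mul_le_mul_left _ (by omega)
    have h2 : (2 * var 1 + 3 : Expr).cost ≤ 20 := by decide
    omega
  · rintro s' ⟨f, q, hs, hK, hS⟩
    refine ⟨f, q, hs, hK, fun t u _ => hS t u ?_⟩
    have := (abs_encodeLetter_le t).2
    push_cast
    omega

end FreeEq

namespace FreeEq

open RAM FreeGroup
open RAM.Expr (var get)
open RAM.Cmd (skip set put read write ite loop)

variable {n r : ℕ} {F : Frame n r} {f f' f'' : ℕ → Rule n r} {q q' q'' : ℕ} {s : Store}

/-! ### The closure of the set of rules -/

/-- The fact number `j` has been wrapped. -/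
def Wrapped (F : Frame n r) (f : ℕ → Rule n r) (q j : ℕ) : Prop :=
  ∀ p (t u : Letter r) (i : Fin n) (ε : Bool) (l l' : List (Fin n × Bool)), (f j).p = p + 1 →
    F.T[p]? = some (t, (i, ε) :: l) → F.T[(f j).q]? = some (u, (i, !ε) :: l') →
    Known f q p ((f j).q + 1) (f j).k

/-- The facts number `i` and `j` have been joined. -/
def Joined (F : Frame n r) (f : ℕ → Rule n r) (q i j : ℕ) : Prop :=
  (f i).q = (f j).p → (f i).k + (f j).k ≤ 2 * F.d → Known f q (f i).p (f j).q ((f i).k + (f j).k)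

theorem Wrapped.mono {j : ℕ} (h : Wrapped F f q j) (h' : Extends f q f' q') (hj : j < q) :
    Wrapped F f' q' j := by
  intro p t u i ε l l'
  rw [h'.2 j hj]
  exact fun h1 h2 h3 => (h p t u i ε l l' h1 h2 h3).mono h'

theorem Joined.mono {i j : ℕ} (h : Joined F f q i j) (h' : Extends f q f' q') (hi : i < q)
    (hj : j < q) : Joined F f' q' i j := by
  rw [Joined, h'.2 i hi, h'.2 j hj]
  exact fun h1 h2 => (h h1 h2).mono h'

/-- The rules before the rule number `m` have been processed. -/
def Processed (F : Frame n r) (f : ℕ → Rule n r) (q m : ℕ) : Prop :=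
  ∀ j, 1 ≤ j → j < m → j < q →
    Wrapped F f q j ∧ ∀ i, 1 ≤ i → i < m → i < q → Joined F f q i j

/-- Partners are found by looking up every position and every weight in the table. Joining is only
promised for the partners present at the beginning; later ones will meet rule `j` when they are
processed themselves. -/
theorem ens_processRule (h : HasRules F f q s) {j : ℕ} (hj : 1 ≤ j) (hjq : j < q)
    (h23 : s.v 23 = j) :
    processRule.Ens s (400 + F.T.length * ((2 * F.d + 1) * 500 + 100))
      fun s' => ∃ f' q', HasRules F f' q' s' ∧ Extends f q f' q' ∧ Wrapped F f' q' j ∧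
        ∀ i, 1 ≤ i → i < q → Joined F f' q' i j ∧ Joined F f' q' j i := by
  let V (s : Store) : Prop := s.v 20 = (f j).p ∧ s.v 21 = (f j).q ∧ s.v 22 = (f j).k ∧ s.v 23 = j
  have hV {c : Cmd} {s : Store} (hs : V s) (hc : 20 ∉ c.vars ∧ 21 ∉ c.vars ∧ 22 ∉ c.vars ∧
      23 ∉ c.vars) : V (c.sem s) := by
    unfold V
    rw [c.sem_v hc.1, c.sem_v hc.2.1, c.sem_v hc.2.2.1, c.sem_v hc.2.2.2]
    exact hs
  let Inv (A : ℕ → ℕ → Prop) (s : Store) : Prop := V s ∧ ∃ f' q', HasRules F f' q' s ∧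
    Extends f q f' q' ∧ Wrapped F f' q' j ∧ ∀ p < F.T.length, ∀ k < 2 * F.d + 1, A p k →
      (Known f q (f j).q p k → (f j).k + k ≤ 2 * F.d → Known f' q' (f j).p p ((f j).k + k)) ∧
      (Known f q p (f j).p k → k + (f j).k ≤ 2 * F.d → Known f' q' p (f j).q (k + (f j).k))
  have E1 : (set 20 (get 4 (var 23)) ;; set 21 (get 5 (var 23)) ;; set 22 (get 6 (var 23)) ;;
      addWrap).Ens s 350 (Inv fun _ _ => False) := by
    refine (Cmd.Ens.of_flat rfl ?_).mono (by decide) fun _ => id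
    have hs : HasRules F f q (((s.setVar 20 (f j).p).setVar 21 (f j).q).setVar 22 (f j).k) :=
      ((h.setVar (by omega) _).setVar (by omega) _).setVar (by omega) _
    have e : (set 20 (get 4 (var 23)) ;; set 21 (get 5 (var 23)) ;; set 22 (get 6 (var 23)) ;;
        addWrap).sem s =
        addWrap.sem (((s.setVar 20 (f j).p).setVar 21 (f j).q).setVar 22 (f j).k) := by
      simp [h23, h.arr_p j hjq, h.arr_q j hjq, h.arr_k j hjq]
    rw [e]
    obtain ⟨f', q', h1, h2, h3⟩ := hs.sem_addWrap hj hjq (by simp) (by simp) (by simp)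
      (by simp [h23])
    refine ⟨hV ⟨by simp, by simp, by simp, by simp [h23]⟩ (by decide), f', q', h1, h2, ?_,
      fun _ _ _ _ h => h.elim⟩
    rw [Wrapped, h2.2 j hjq]
    exact h3
  have E2 (s : Store) (p : ℕ) (hp : p < F.T.length) (h24 : s.v 24 = p)
      (hs : Inv (fun p' _ => p' < p) s) : (loop 25 (var 4) addJoins).Ens s
      (50 + (2 * F.d + 1) * 500) (Inv fun p' _ => p' < p + 1) := by
    obtain ⟨hv, f', q', h1, h2, h3⟩ := hs
    refine (Cmd.Ens.loop (B := 470) (N := 2 * F.d + 1) (fun k s => s.v 24 = p ∧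
      Inv (fun p' k' => p' < p ∨ p' = p ∧ k' < k) s) (by simp [h1.e_eq]) ⟨h24, hv, f', q', h1, h2,
      h3.1, fun p' hp' k' hk' hA => h3.2 p' hp' k' hk' (by omega)⟩ ?_).mono ?_ ?_
    · rintro k hk s ⟨h24, hv, f', q', h1, h2, h3, h4⟩
      refine (Cmd.Ens.of_flat rfl ?_).mono (by decide) fun _ => id
      have hjf : f' j = f j := h2.2 j hjq
      obtain ⟨f'', q'', k1, k2, k3, k4⟩ := (h1.setVar (x := 25) (by omega) k).sem_addJoins hj
        (hjq.trans_le h2.1) (p := p) (k := k) (by simp [hv.1, hjf]) (by simp [hv.2.1, hjf])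
        (by simp [hv.2.2.1, hjf]) (by simp [hv.2.2.2]) (by simp [h24]) hp (by simp) hk
      rw [hjf] at k3 k4
      refine ⟨(Cmd.sem_v _ (by decide) _).trans (by simp [h24]),
        hV ⟨by simp [hv.1], by simp [hv.2.1], by simp [hv.2.2.1], by simp [hv.2.2.2]⟩ (by decide),
        f'', q'', k1, h2.trans k2, h3.mono k2 (hjq.trans_le h2.1), fun p' hp' k' hk' hA => ?_⟩
      by_cases hA' : p' < p ∨ p' = p ∧ k' < k
      · obtain ⟨g1, g2⟩ := h4 p' hp' k' hk' hA'
        exact ⟨fun a b => (g1 a b).mono k2, fun a b => (g2 a b).mono k2⟩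
      · obtain ⟨rfl, rfl⟩ : p' = p ∧ k' = k := by omega
        exact ⟨fun a => k3 (a.mono h2), fun a => k4 (a.mono h2)⟩
    · simp [Expr.cost]
      omega
    · rintro s ⟨-, hv, f', q', h1, h2, h3, h4⟩
      exact ⟨hv, f', q', h1, h2, h3, fun p' hp' k' hk' hA => h4 p' hp' k' hk' (by omega)⟩
  -- Regrouping a sequence changes neither its effect nor its cost.
  have e : processRule.Ens s (400 + F.T.length * ((2 * F.d + 1) * 500 + 100)) =
    ((set 20 (get 4 (var 23)) ;; set 21 (get 5 (var 23)) ;; set 22 (get 6 (var 23)) ;;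
      addWrap) ;; loop 24 (var 5) (loop 25 (var 4) addJoins)).Ens s
      (400 + F.T.length * ((2 * F.d + 1) * 500 + 100)) := by
    funext Q
    simp [Cmd.Ens, processRule, Cmd.cost, Nat.add_assoc]
  rw [e]
  refine (E1.seq (B' := 50 + F.T.length * ((2 * F.d + 1) * 500 + 100)) (Q' := Inv fun p' _ =>
    p' < F.T.length) fun s hs => ?_).mono (by omega) ?_
  · obtain ⟨hv, f', q', h1, h2, h3⟩ := hs
    refine (Cmd.Ens.loop (B := 50 + (2 * F.d + 1) * 500) (N := F.T.length) (fun p => Inv fun p' _ =>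
      p' < p) (by simp [h1.m_eq]) ⟨hv, f', q', h1, h2, h3.1, fun p' hp' k' hk' hA => by omega⟩
      fun p hp s hs => E2 _ p hp (by simp) ?_).mono ?_ fun _ => id
    · obtain ⟨hv, f', q', h1, h'⟩ := hs
      exact ⟨by simpa [V] using hv, f', q', h1.setVar (by omega) _, h'⟩
    · have : F.T.length * (50 + (2 * F.d + 1) * 500 + 7) ≤
        F.T.length * ((2 * F.d + 1) * 500 + 100) := Nat.mul_le_mul_left _ (by omega)
      simp only [Expr.cost]
      omega
  · rintro s ⟨-, f', q', h1, h2, h3, h4⟩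
    refine ⟨f', q', h1, h2, h3, fun i hi hiq => ?_⟩
    rw [Joined, Joined, h2.2 i hiq, h2.2 j hjq]
    refine ⟨fun h5 h6 => ?_, fun h5 h6 => ?_⟩
    · exact (h4 _ (h.p_lt i hiq) _ (h.k_lt i hiq) (h.p_lt i hiq)).2
        ⟨i, hi, hiq, rfl, h5, rfl⟩ h6
    · exact (h4 _ (h.q_lt i hiq) _ (h.k_lt i hiq) (h.q_lt i hiq)).1
        ⟨i, hi, hiq, h5.symm, rfl, rfl⟩ h6

/-- The number of entries of the table of rules. -/
def Frame.size (F : Frame n r) : ℕ := F.T.length * F.T.length * (2 * F.d + 1)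

/-- Two rules have been joined at the latest when the one with the larger number has been processed,
as the other is in the table by then. By `HasRules.q_le` no rule is left after `F.size` passes, so
the result is closed. -/
theorem ens_closeRules (h : HasRules F f q s) :
    closeRules.Ens s (30 + F.size * (500 + F.T.length * ((2 * F.d + 1) * 500 + 100)))
      fun s' => ∃ f' q', HasRules F f' q' s' ∧ Extends f q f' q' ∧ Processed F f' q' q' := by
  refine (Cmd.Ens.loop (N := F.size)
    (B := 450 + F.T.length * ((2 * F.d + 1) * 500 + 100)) (fun i s => ∃ f' q', HasRules F f' q' s ∧
    Extends f q f' q' ∧ Processed F f' q' (i + 1)) (by simp [h.m_eq, h.e_eq, Frame.size])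
    ⟨f, q, h, .refl _ _, fun j h1 h2 => by omega⟩ ?_).mono ?_ ?_
  · rintro i hi s ⟨f', q', h1, h2, h3⟩
    have hs := (h1.setVar (x := 19) (by omega) i).setVar (x := 23) (by omega) (i + 1)
    have E1 : (set 23 (var 19 + 1)).Ens (s.setVar 19 i) 10 fun s' =>
        s' = (s.setVar 19 i).setVar 23 (i + 1) :=
      (Cmd.Ens.of_flat rfl (by simp)).mono (by decide) fun _ => id
    refine (E1.seq (B' := 410 + F.T.length * ((2 * F.d + 1) * 500 + 100)) ?_).mono (by omega)
      fun _ => id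
    rintro _ rfl
    have hev : (var 6 - var 23 : Expr).eval ((s.setVar 19 i).setVar 23 (i + 1)) = q' - (i + 1) := by
      simp [h1.q_eq]
    refine (Cmd.Ens.ite (B := 400 + F.T.length * ((2 * F.d + 1) * 500 + 100)) (B' := 0)
      (fun hpos => ?_) fun hpos => ?_).mono ?_ fun _ => id
    · have hiq : i + 1 < q' := by
        rw [hev] at hpos
        omega
      refine (ens_processRule hs (by omega) hiq (by simp)).mono le_rfl ?_
      rintro s ⟨f'', q'', k1, k2, k3, k4⟩
      refine ⟨f'', q'', k1, h2.trans k2, fun j g1 g2 _ => ?_⟩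
      rcases Nat.lt_succ_iff_lt_or_eq.1 g2 with g2 | rfl
      · obtain ⟨g3, g4⟩ := h3 j g1 g2 (by omega)
        refine ⟨g3.mono k2 (by omega), fun i' g5 g6 _ => ?_⟩
        rcases Nat.lt_succ_iff_lt_or_eq.1 g6 with g6 | rfl
        · exact (g4 i' g5 g6 (by omega)).mono k2 (by omega) (by omega)
        · exact (k4 j g1 (by omega)).2
      · refine ⟨k3, fun i' g5 g6 _ => (k4 i' g5 (by omega)).1⟩
    · have hiq : q' ≤ i + 1 := by
        rw [hev] at hpos
        omega
      refine (Cmd.Ens.of_flat rfl ⟨f', q', hs, h2, fun j g1 g2 g3 => ?_⟩).mono le_rfl fun _ => id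
      obtain ⟨g4, g5⟩ := h3 j g1 (by omega) g3
      exact ⟨g4, fun i' g6 _ g7 => g5 i' g6 (by omega) g7⟩
    · have h2 : (var 6 - var 23 : Expr).cost ≤ 7 := by decide
      omega
  · have : F.size * (450 + F.T.length * ((2 * F.d + 1) * 500 + 100) + 7) ≤
      F.size * (500 + F.T.length * ((2 * F.d + 1) * 500 + 100)) :=
      Nat.mul_le_mul_left _ (by omega)
    have h2 : (var 5 * var 5 * var 4 : Expr).cost ≤ 20 := by decide
    omega
  · rintro s ⟨f', q', h1, h2, h3⟩
    have := h1.q_le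
    refine ⟨f', q', h1, h2, fun j g1 g2 _ => ?_⟩
    obtain ⟨g4, g5⟩ := h3 j g1 (by unfold Frame.size; omega) g2
    exact ⟨g4, fun i g6 _ g7 => g5 i g6 (by unfold Frame.size; omega) g7⟩

/-- Weights are natural numbers and add up, so a derivation of a fact of weight at most `2 * d`
passes only through facts of weight at most `2 * d`; discarding heavier ones loses nothing. -/
theorem Processed.known (h : Processed F f q q) (h0 : ∀ p < F.T.length, Known f q p p 0)
    (h1 : SilentKnown F f q fun _ _ => True) {p p' k : ℕ} (hd : Derivable F.T F.st F.en p p' k)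
    (hk : k ≤ 2 * F.d) : Known f q p p' k := by
  induction hd with
  | refl p hp => exact h0 p hp
  | silent t u htu => exact h1 t u trivial htu hk
  | wrap p q k t u i ε l l' hp hq _ ih =>
    obtain ⟨j, j1, j2, j3, rfl, rfl⟩ := ih hk
    exact (h j j1 j2 j2).1 p t u i ε l l' j3 hp hq
  | concat p m p' k k' _ _ ih ih' =>
    obtain ⟨i, i1, i2, rfl, rfl, rfl⟩ := ih (by omega)
    obtain ⟨j, j1, j2, j3, rfl, rfl⟩ := ih' (by omega)
    exact (h j j1 j2 j2).2 i i1 i2 i2 j3.symm hk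

end FreeEq

namespace FreeEq

open RAM FreeGroup
open RAM.Expr (var get)
open RAM.Cmd (skip set put read write ite loop)

variable {n r : ℕ} {w : Option (Fin r) → List (Fin n × Bool)} {T : List (Position n r)} {s : Store}

/-! ### Reading the input -/

theorem tapeArray_concat (c : Position n r → ℤ) (T : List (Position n r)) (P : Position n r) :
    tapeArray c (T ++ [P]) = Function.update (tapeArray c T) T.length (c P) := by
  funext p
  rw [Function.update_apply]
  unfold tapeArray
  by_cases hp : 0 ≤ p
  · obtain ⟨p, rfl⟩ := Int.eq_ofNat_of_zero_le hp
    simp only [hp, if_true, Int.toNat_natCast, Nat.cast_inj, List.getElem?_append]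
    rcases lt_trichotomy p T.length with h | h | h
    · simp [h, h.ne]
    · simp [h]
    · have h1 : ¬ p < T.length := by omega
      have h2 : p ≠ T.length := by omega
      have h3 : p - T.length ≠ 0 := by omega
      simp [h1, h2, h3]
  · have : p ≠ T.length := by omega
    simp [hp, this]

theorem tapeArray_take_succ (c : Position n r → ℤ) (t : Letter r) {j : ℕ}
    (hj : j ≤ (letterWord w t).length) :
    tapeArray c (T ++ (block w t).take (j + 1)) =
      Function.update (tapeArray c (T ++ (block w t).take j)) (T.length + j : ℕ)
        (c (t, (letterWord w t).drop j)) := by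
  have h : (block w t).take (j + 1) = (block w t).take j ++ [(t, (letterWord w t).drop j)] := by
    rw [List.take_add_one, getElem?_block t hj]
    rfl
  rw [h, ← List.append_assoc, tapeArray_concat]
  simp [length_block, hj.trans (Nat.le_succ _)]

/-- The end position of a block has the code `0`, which the array holds already; the program only
has to step over it. -/
theorem tapeArray_block {c : Position n r → ℤ} {t : Letter r} (h : c (t, []) = 0) :
    tapeArray c (T ++ block w t) =
      tapeArray c (T ++ (block w t).take (letterWord w t).length) := by
  have h1 : block w t = (block w t).take ((letterWord w t).length + 1) := by
    rw [← length_block, List.take_length]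
  conv_lhs => rw [h1]
  rw [tapeArray_take_succ c t le_rfl, List.drop_length, h]
  refine Function.update_eq_self_iff.2 ?_
  rw [tapeArray_natCast, List.getElem?_eq_none]
  · rfl
  · simp [length_block]

/-- The store contains the tape `T`, and `m` is the number of the next position. -/
structure HasTape (T : List (Position n r)) (m : ℕ) (s : Store) : Prop where
  pos : s.v 5 = m
  next : s.a 0 = tapeArray nextCode T
  vis : s.a 14 = tapeArray visibleCode T

theorem HasTape.step {t : Letter r} {j : ℕ} (hj : j ≤ (letterWord w t).length) {s' : Store}
    (h : HasTape (T ++ (block w t).take j) (T.length + j) s) (h5 : s'.v 5 = s.v 5 + 1)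
    (h0 : s'.a 0 = Function.update (s.a 0) (s.v 5) (nextCode (t, (letterWord w t).drop j)))
    (h14 : s'.a 14 = Function.update (s.a 14) (s.v 5)
      (visibleCode (t, (letterWord w t).drop j))) :
    HasTape (T ++ (block w t).take (j + 1)) (T.length + (j + 1)) s' := by
  refine ⟨by rw [h5, h.pos]; push_cast; ring, ?_, ?_⟩
  · rw [h0, h.next, h.pos, tapeArray_take_succ _ _ hj]
  · rw [h14, h.vis, h.pos, tapeArray_take_succ _ _ hj]

theorem visibleCode_nil (t : Letter r) : visibleCode ((t, []) : Position n r) = 0 := by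
  simp [visibleCode, nextCode]

theorem HasTape.finish {t : Letter r} {m : ℕ}
    (h : HasTape (T ++ (block w t).take (letterWord w t).length) m s) :
    HasTape (T ++ block w t) m s :=
  ⟨h.pos, by rw [h.next, tapeArray_block rfl], by rw [h.vis, tapeArray_block (visibleCode_nil t)]⟩

theorem ens_copy {o : Option (Fin r)} {rest : List ℤ} (h : HasTape T T.length s)
    (h8 : s.v 8 = (w o).length) (h9 : s.v 9 = if o = none then 0 else 1)
    (hi : s.inp = (w o).map (fun a => signed a.1 a.2) ++ rest) :
    (loop 31 (var 8) copyLetter).Ens s (20 + (w o).length * 100) fun s' =>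
      HasTape (T ++ block w (o, true)) (T.length + (w o).length) s' ∧ s'.inp = rest := by
  refine (Cmd.Ens.loop (B := 80) (N := (w o).length) (fun j s' =>
    HasTape (T ++ (block w (o, true)).take j) (T.length + j) s' ∧
      s'.v 9 = (if o = none then 0 else 1) ∧
      s'.inp = ((w o).drop j).map (fun a => signed a.1 a.2) ++ rest) (by simpa using h8)
    ⟨by simpa using h, h9, by simpa using hi⟩ ?_).mono ?_ ?_
  · rintro j hj s ⟨h1, h2, h3⟩
    refine (Cmd.Ens.of_flat rfl ?_).mono (by decide) fun _ => id
    rw [List.drop_eq_getElem_cons hj] at h3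
    have e : (letterWord w (o, true)).drop j = (w o)[j] :: (w o).drop (j + 1) := by
      rw [← List.drop_eq_getElem_cons hj]
      rfl
    generalize (w o)[j] = a at h3 e
    refine ⟨h1.step hj.le ?_ ?_ ?_, ?_, ?_⟩
    · simp [copyLetter, Cmd.sem, Store.setVar_v]
    · rw [e]
      simp [copyLetter, Cmd.sem, h3, nextCode]
    · rw [e]
      simp [copyLetter, Cmd.sem, h3, h2, nextCode, visibleCode]
    · simp [copyLetter, Cmd.sem, h2]
    · simp [copyLetter, Cmd.sem, h3]
  · simp [Expr.cost]
    omega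
  · rintro s' ⟨h1, -, h3⟩
    exact ⟨h1.finish, by simpa using h3⟩

theorem ens_mirror {o : Option (Fin r)}
    (h : HasTape (T ++ block w (o, true)) (T ++ block w (o, true)).length s)
    (h8 : s.v 8 = (w o).length) :
    (loop 31 (var 8) mirrorLetter).Ens s (20 + (w o).length * 100) fun s' =>
      HasTape (T ++ block w (o, true) ++ block w (o, false))
        ((T ++ block w (o, true)).length + (w o).length) s' ∧ s'.inp = s.inp := by
  have hlen : (letterWord w (o, false)).length = (w o).length := by
    simp [letterWord, invRev_length]
  refine (Cmd.Ens.loop (B := 80) (N := (w o).length) (fun j s' =>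
    HasTape (T ++ block w (o, true) ++ (block w (o, false)).take j)
      ((T ++ block w (o, true)).length + j) s' ∧ s'.inp = s.inp) (by simpa using h8)
    ⟨by simpa using h, rfl⟩ ?_).mono ?_ ?_
  · rintro j hj s ⟨h1, hinp⟩
    refine (Cmd.Ens.of_flat rfl ?_).mono (by decide) fun _ => id
    have e : (letterWord w (o, false)).drop j = (((w o)[(w o).length - 1 - j]).1,
        !((w o)[(w o).length - 1 - j]).2) :: (letterWord w (o, false)).drop (j + 1) := by
      rw [List.drop_eq_getElem_cons (by omega)]
      simp [letterWord, invRev]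
    -- The index in `mirrorLetter` points to the letter number `length - 1 - j` of the word just
    -- read.
    have e2 : ((T ++ block w (o, true)).length + j : ℕ) - 2 - 2 * (j : ℤ) =
        ((T.length + ((w o).length - 1 - j) : ℕ) : ℤ) := by
      simp [length_block, letterWord]
      omega
    have e3 (c : Position n r → ℤ) : tapeArray c (T ++ block w (o, true) ++
        (block w (o, false)).take j) (T.length + ((w o).length - 1 - j) : ℕ) =
        c ((o, true), (w o)[(w o).length - 1 - j] :: (w o).drop ((w o).length - 1 - j + 1)) := by
      rw [tapeArray_natCast, List.append_assoc, List.getElem?_append_right (by omega),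
        Nat.add_sub_cancel_left, List.getElem?_append_left, getElem?_block]
      · simp only [letterWord, cond_true, Option.elim_some]
        rw [← List.drop_eq_getElem_cons]
      · simp [letterWord]
        omega
      · simp [length_block, letterWord]
        omega
    generalize (w o)[(w o).length - 1 - j] = a at e e3
    refine ⟨h1.step (by omega) ?_ ?_ ?_, by simpa [mirrorLetter] using hinp⟩
    · simp [mirrorLetter]
    · rw [e]
      simp only [mirrorLetter, Cmd.sem_seq, Cmd.sem_put, Cmd.sem_set, Store.setVar_a,
        Store.putArr_a, Expr.eval_sub, Expr.eval_get, Expr.eval_mul, Expr.eval_two, Expr.eval_var,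
        Expr.eval_zero, Store.setVar_v, h1.next]
      norm_num [-List.append_assoc]
      rw [h1.pos, e2, e3]
      simp [nextCode, signed_not]
    · rw [e]
      simp only [mirrorLetter, Cmd.sem_seq, Cmd.sem_put, Cmd.sem_set, Store.setVar_a,
        Store.putArr_a, Expr.eval_sub, Expr.eval_get, Expr.eval_mul, Expr.eval_two, Expr.eval_var,
        Expr.eval_zero, Store.setVar_v, Store.putArr_v, h1.vis]
      norm_num [-List.append_assoc]
      rw [h1.pos, e2, e3]
      simp only [visibleCode, nextCode]
      split <;> simp [signed_not]
  · simp [Expr.cost]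
    omega
  · rintro s' ⟨h1, hinp⟩
    rw [← hlen] at h1 ⊢
    exact ⟨h1.finish, hinp⟩

/-- The letter with a given number. -/
def letterOf (r j : ℕ) : Option (Fin r) := if h : j < r then some ⟨j, h⟩ else none

theorem letterOf_eq_none {j : ℕ} : letterOf r j = none ↔ r ≤ j := by
  simp [letterOf]

theorem elim_letterOf {j : ℕ} (hj : j ≤ r) : (letterOf r j).elim r Fin.val = j := by
  unfold letterOf
  split
  · rfl
  · simp
    omega

theorem letterOf_elim (o : Option (Fin r)) : letterOf r (o.elim r Fin.val) = o := by
  cases o <;> simp [letterOf]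

/-- The code of a word in the input. -/
def wordCode (l : List (Fin n × Bool)) : List ℤ := withLength (l.map fun a => signed a.1 a.2)

theorem ens_readWord {i : ℕ} (hi : i ≤ r) {rest : List ℤ} (h : HasTape T T.length s)
    (h1 : s.v 1 = r) (h30 : s.v 30 = i) (hinp : s.inp = wordCode (w (letterOf r i)) ++ rest) :
    readWord.Ens s (400 + (w (letterOf r i)).length * 200) fun s' =>
      HasTape (T ++ block w (letterOf r i, true) ++ block w (letterOf r i, false))
        (T ++ block w (letterOf r i, true) ++ block w (letterOf r i, false)).length s' ∧
      s'.inp = rest ∧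
      s'.a 1 = Function.update (Function.update (s.a 1) (i + 1) T.length) (-(i + 1))
        (T ++ block w (letterOf r i, true)).length ∧
      s'.a 2 = Function.update (Function.update (s.a 2) (i + 1)
        (T.length + (w (letterOf r i)).length : ℕ)) (-(i + 1))
        ((T ++ block w (letterOf r i, true)).length + (w (letterOf r i)).length : ℕ) := by
  obtain ⟨o, ho⟩ : ∃ o, o = letterOf r i := ⟨_, rfl⟩
  have ho' : o = none ↔ r ≤ i := by rw [ho, letterOf_eq_none]
  rw [← ho] at hinp ⊢
  simp only [wordCode, withLength, List.length_map, List.cons_append] at hinp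
  have e : readWord.Ens s (400 + (w o).length * 200) = ((read 8 ;;
      ite (var 1 - var 30) (set 9 1) (set 9 0) ;; put 1 (var 30 + 1) (var 5)) ;;
      loop 31 (var 8) copyLetter ;;
      (put 2 (var 30 + 1) (var 5) ;; set 5 (var 5 + 1) ;; put 1 (0 - (var 30 + 1)) (var 5)) ;;
      loop 31 (var 8) mirrorLetter ;;
      put 2 (0 - (var 30 + 1)) (var 5) ;; set 5 (var 5 + 1)).Ens s
      (400 + (w o).length * 200) := by
    funext Q
    simp [Cmd.Ens, readWord, Cmd.cost, Nat.add_assoc]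
  rw [e]
  have E1 : (read 8 ;; ite (var 1 - var 30) (set 9 1) (set 9 0) ;;
      put 1 (var 30 + 1) (var 5)).Ens s 60 fun s' => HasTape T T.length s' ∧
        s'.v 8 = (w o).length ∧ s'.v 9 = (if o = none then 0 else 1) ∧
        s'.inp = (w o).map (fun a => signed a.1 a.2) ++ rest ∧ s'.v 30 = i ∧
        s'.a 1 = Function.update (s.a 1) (i + 1) T.length ∧ s'.a 2 = s.a 2 := by
    refine (Cmd.Ens.of_flat rfl ?_).mono (by decide) fun _ => id
    have e1 : (read 8 ;; ite (var 1 - var 30) (set 9 1) (set 9 0) ;;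
      put 1 (var 30 + 1) (var 5)).sem s = ({ (s.setVar 8 (w o).length) with
        inp := (w o).map (fun a : Fin n × Bool => signed a.1 a.2) ++ rest }.setVar 9
        (if o = none then 0 else 1)).putArr 1 (i + 1) T.length := by
      have : ((read 8).sem s) = { (s.setVar 8 (w o).length) with
        inp := (w o).map (fun a : Fin n × Bool => signed a.1 a.2) ++ rest } := by
        simp [Cmd.sem, hinp, Store.setVar]
      rw [Cmd.sem_seq, this]
      by_cases hir : r ≤ i
      · have hn := ho'.2 hir
        have : ¬ (0 : ℤ) < r - i := by omega
        simp [h1, h30, hn, h.pos, not_lt.2 hir]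
      · have hn := mt ho'.1 hir
        simp [h1, h30, hn, h.pos, not_le.1 hir]
    rw [e1]
    exact ⟨⟨by simp [h.pos], by simp [h.next], by simp [h.vis]⟩, by simp, by simp, by simp,
      by simp [h30], by simp, by simp⟩
  refine (E1.seq (B' := 300 + (w o).length * 200) ?_).mono (by omega) fun _ => id
  rintro s₁ ⟨g1, g2, g3, g4, g5, g6, g7⟩
  refine ((ens_copy g1 g2 g3 g4).frame.seq (B' := 250 + (w o).length * 100) ?_).mono (by omega)
    fun _ => id
  rintro s₂ ⟨⟨k1, k2⟩, k3, k4⟩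
  have k8 := (k3 8 (by decide)).trans g2
  have k30 := (k3 30 (by decide)).trans g5
  have a1 := (k4 1 (by decide)).trans g6
  have a2 := (k4 2 (by decide)).trans g7
  have hlen : (T ++ block w (o, true)).length = T.length + (w o).length + 1 := by
    simp [length_block, letterWord]
    ring
  have E2 : (put 2 (var 30 + 1) (var 5) ;; set 5 (var 5 + 1) ;;
      put 1 (0 - (var 30 + 1)) (var 5)).Ens s₂ 70 fun s' =>
        HasTape (T ++ block w (o, true)) (T ++ block w (o, true)).length s' ∧
        s'.v 8 = (w o).length ∧ s'.v 30 = i ∧ s'.inp = rest ∧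
        s'.a 1 = Function.update (Function.update (s.a 1) (i + 1) T.length) (-(i + 1))
          (T ++ block w (o, true)).length ∧
        s'.a 2 = Function.update (s.a 2) (i + 1) (T.length + (w o).length : ℕ) := by
    refine (Cmd.Ens.of_flat rfl ?_).mono (by decide) fun _ => id
    rw [hlen]
    refine ⟨⟨?_, ?_, ?_⟩, ?_, ?_, ?_, ?_, ?_⟩
    · simp [k1.pos]
    · simp [k1.next]
    · simp [k1.vis]
    · simp [k8]
    · simp [k30]
    · simp [k2]
    · simp [k30, a1, k1.pos]
    · simp [k30, a2, k1.pos]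
  refine (E2.seq (B' := 180 + (w o).length * 100) ?_).mono (by omega) fun _ => id
  rintro s₃ ⟨l1, l2, l3, l4, l5, l6⟩
  refine ((ens_mirror l1 l2).frame.seq (B' := 150)
    (Q' := fun s' => HasTape (T ++ block w (o, true) ++ block w (o, false))
        (T ++ block w (o, true) ++ block w (o, false)).length s' ∧ s'.inp = s₃.inp ∧
        s'.a 1 = s₃.a 1 ∧ s'.a 2 = Function.update (s₃.a 2) (-(i + 1))
        ((T ++ block w (o, true)).length + (w o).length : ℕ)) ?_).mono (by omega) ?_
  · rintro s₄ ⟨⟨m1, m4⟩, m2, m3⟩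
    have k30 := (m2 30 (by decide)).trans l3
    have a1 := m3 1 (by decide)
    have a2 := m3 2 (by decide)
    refine (Cmd.Ens.of_flat rfl ⟨⟨?_, ?_, ?_⟩, ?_, ?_, ?_⟩).mono (by decide) fun _ => id
    · rw [List.length_append (bs := block w (o, false)), length_block]
      simp [m1.pos, letterWord, invRev_length]
      ring
    · simp [m1.next]
    · simp [m1.vis]
    · simp [m4]
    · simp [a1]
    · simp [k30, a2, m1.pos]
  · rintro s' ⟨b1, b2, b3, b4⟩
    exact ⟨b1, by rw [b2, l4], by rw [b3, l5], by rw [b4, l6]⟩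

/-- The store when `i` words of the input have been read. -/
structure HasInput (n : ℕ) (w : Option (Fin r) → List (Fin n × Bool)) (d i : ℕ) (s : Store) :
    Prop where
  n_eq : s.v 0 = n
  r_eq : s.v 1 = r
  d_eq : s.v 3 = 2 * d
  e_eq : s.v 4 = 2 * d + 1
  arr : ∀ a ∈ [3, 4, 5, 6], s.a a = 0
  inp : s.inp = ((List.range (r + 1)).drop i).flatMap fun j => wordCode (w (letterOf r j))
  tape : ∃ (T : List (Position n r)) (st en : Letter r → ℕ),
    IsLayout w (fun t => t.1.elim r Fin.val < i) T st en ∧ HasTape T T.length s ∧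
    (∀ t : Letter r, t.1.elim r Fin.val < i →
      s.a 1 (encodeLetter t) = st t ∧ s.a 2 (encodeLetter t) = en t) ∧
    T.length = ∑ j ∈ Finset.range i, 2 * ((w (letterOf r j)).length + 1)

theorem HasInput.ens_readWord {d i L : ℕ} (h : HasInput n w d i s) (hi : i ≤ r)
    (hL : ∀ o, (w o).length ≤ L) :
    readWord.Ens (s.setVar 30 i) (400 + L * 200) (HasInput n w d (i + 1)) := by
  obtain ⟨T, st, en, h1, h2, h3, h4⟩ := h.tape
  have hi' : i < (List.range (r + 1)).length := by simp; omega
  have hinp := h.inp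
  rw [List.drop_eq_getElem_cons hi', List.getElem_range, List.flatMap_cons] at hinp
  have hlen := hL (letterOf r i)
  refine (FreeEq.ens_readWord (s := s.setVar 30 i) hi ⟨by simp [h2.pos], h2.next, h2.vis⟩
    (by simp [h.r_eq]) (by simp) hinp).frame.mono (by omega) ?_
  rintro s' ⟨⟨k1, k2, k3, k4⟩, k5, k6⟩
  have c1 : ((i : ℤ) + 1) = encodeLetter (letterOf r i, true) := by
    simp [encodeLetter, elim_letterOf hi, signed]
  have c2 : -((i : ℤ) + 1) = encodeLetter (letterOf r i, false) := by
    simp [encodeLetter, elim_letterOf hi, signed]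
  have hJ (t : Letter r) : t.1.elim r Fin.val < i + 1 ↔
      (t.1.elim r Fin.val < i ∨ t = (letterOf r i, true)) ∨ t = (letterOf r i, false) := by
    obtain ⟨o, ε⟩ := t
    have h5 : o.elim r Fin.val = i ↔ o = letterOf r i := by
      constructor
      · rintro rfl
        rw [letterOf_elim]
      · rintro rfl
        exact elim_letterOf hi
    rw [Nat.lt_succ_iff_lt_or_eq, h5]
    cases ε <;> simp
  have hl (ε : Bool) : (letterWord w (letterOf r i, ε)).length = (w (letterOf r i)).length := by
    cases ε <;> simp [letterWord, invRev_length]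
  refine ⟨?_, ?_, ?_, ?_, fun a ha => ?_, k2, _, _, _, by
    simp only [hJ]
    exact (h1.append (letterOf r i, true)).append (letterOf r i, false), k1, fun t ht => ?_, ?_⟩
  · rw [k5 0 (by decide)]
    simp [h.n_eq]
  · rw [k5 1 (by decide)]
    simp [h.r_eq]
  · rw [k5 3 (by decide)]
    simp [h.d_eq]
  · rw [k5 4 (by decide)]
    simp [h.e_eq]
  · rw [k6 a, Store.setVar_a, h.arr a ha]
    simp only [List.mem_cons, List.not_mem_nil, or_false] at ha
    rcases ha with rfl | rfl | rfl | rfl <;> decide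
  · rw [k3, k4, c2, c1]
    simp only [Function.update_apply, encodeLetter_injective.eq_iff, hl]
    by_cases e1 : t = (letterOf r i, false)
    · simp [e1]
    by_cases e2 : t = (letterOf r i, true)
    · simp [e2]
    · simpa [e1, e2] using h3 t (by simpa [e1, e2] using (hJ t).1 ht)
  · rw [Finset.sum_range_succ, ← h4]
    simp [length_block, hl]
    ring

theorem ens_readInput {d L : ℕ} (hL : ∀ o, (w o).length ≤ L)
    (hs : s = Store.init ([(n : ℤ), (r : ℤ), (d : ℤ)] ++
      (List.range (r + 1)).flatMap fun j => wordCode (w (letterOf r j)))) :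
    readInput.Ens s (100 + (r + 1) * (410 + L * 200)) (HasInput n w d (r + 1)) := by
  have e : readInput.Ens s (100 + (r + 1) * (410 + L * 200)) =
      ((read 0 ;; read 1 ;; read 2 ;; set 3 (var 2 + var 2) ;; set 4 (var 3 + 1)) ;;
        loop 30 (var 1 + 1) readWord).Ens s (100 + (r + 1) * (410 + L * 200)) := by
    funext Q
    simp [Cmd.Ens, readInput, Cmd.cost, Nat.add_assoc]
  rw [e]
  have E1 : (read 0 ;; read 1 ;; read 2 ;; set 3 (var 2 + var 2) ;; set 4 (var 3 + 1)).Ens s 60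
      (HasInput n w d 0) := by
    refine (Cmd.Ens.of_flat rfl ?_).mono (by decide) fun _ => id
    subst hs
    refine ⟨?_, ?_, ?_, ?_, ?_, ?_, [], fun _ => 0, fun _ => 0, ⟨?_, ?_, ?_⟩, ⟨?_, ?_, ?_⟩,
      fun t ht => by omega, rfl⟩
    · simp [Cmd.sem, Store.setVar, Store.init]
    · simp [Cmd.sem, Store.setVar, Store.init]
    · simp [Cmd.sem, Store.setVar, Store.init]
      ring
    · simp [Cmd.sem, Store.setVar, Store.init]
      ring
    · intro a _
      rfl
    · simp [Cmd.sem, Store.setVar, Store.init]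
    · simp
    · exact fun t ht => by omega
    · exact fun t ht => by omega
    · rfl
    · funext p
      simp [Cmd.sem, Store.setVar, Store.init, tapeArray]
    · funext p
      simp [Cmd.sem, Store.setVar, Store.init, tapeArray]
  refine (E1.seq (B' := 40 + (r + 1) * (410 + L * 200)) fun s h => ?_).mono (by omega) fun _ => id
  refine (Cmd.Ens.loop (N := r + 1) (B := 400 + L * 200) (fun i => HasInput n w d i)
    (by simp [h.r_eq]) h fun i hi s h => h.ens_readWord (by omega) hL).mono ?_ fun _ => id
  have : (r + 1) * (400 + L * 200 + 7) ≤ (r + 1) * (410 + L * 200) :=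
    Nat.mul_le_mul_left _ (by omega)
  have h2 : (var 1 + 1 : Expr).cost ≤ 20 := by decide
  omega

theorem HasInput.exists_frame {d L : ℕ} (h : HasInput n w d (r + 1) s)
    (hL : ∀ o, (w o).length ≤ L) : ∃ F : Frame n r, F.w = w ∧ F.d = d ∧ HasFrame F s ∧
      0 < F.T.length ∧ F.T.length ≤ 2 * ((r + 1) * (L + 1)) := by
  obtain ⟨T, st, en, h1, h2, h3, h4⟩ := h.tape
  have hJ (t : Letter r) : t.1.elim r Fin.val < r + 1 := by
    rcases t with ⟨_ | i, ε⟩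
    · simp
    · simp
  have h5 : IsLayout w (fun _ => True) T st en := by
    simpa only [hJ] using h1
  refine ⟨⟨w, d, T, st, en, h5⟩, rfl, rfl, ⟨h.n_eq, h.r_eq, h.d_eq, h.e_eq, h2.pos, h2.next, h2.vis,
    fun t => (h3 t (hJ t)).1, fun t => (h3 t (hJ t)).2⟩, ?_, ?_⟩
  · simp only [h4, Finset.sum_range_succ]
    omega
  · simp only [h4]
    refine (Finset.sum_le_card_nsmul _ _ (2 * (L + 1)) fun j _ => ?_).trans ?_
    · have := hL (letterOf r j)
      omega
    · simp
      nlinarith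

theorem encodeInput_eq {H : Subgroup (FreeGroup (Fin n))} (b : FreeGroupBasis (Fin r) H)
    (g : FreeGroup (Fin n)) (d : ℕ) : encodeInput b g d = [(n : ℤ), (r : ℤ), (d : ℤ)] ++
      (List.range (r + 1)).flatMap fun j => wordCode (inputWord b g (letterOf r j)) := by
  rw [encodeInput, List.append_assoc, List.range_succ, List.flatMap_append]
  congr 2
  · rw [List.flatMap_def, ← List.map_coe_finRange_eq_range, List.map_map, List.ofFn_eq_map]
    congr 2
    funext i
    simp [letterOf, inputWord, wordCode, encodeElement]
  · simp [letterOf, inputWord, wordCode, encodeElement]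

end FreeEq

namespace FreeEq

open RAM FreeGroup
open RAM.Expr (var get)
open RAM.Cmd (skip set put read write ite loop)

variable {n r : ℕ} {F : Frame n r} {f : ℕ → Rule n r} {q : ℕ} {s : Store}

/-! ### Writing the rules -/

/-- The list of the rules with numbers up to `j`. -/
def ruleList (f : ℕ → Rule n r) (j : ℕ) : Rules r :=
  [] :: (List.range j).map fun i => [(f (i + 1)).y₁, (f (i + 1)).y₂]

theorem ruleList_succ (f : ℕ → Rule n r) (j : ℕ) :
    ruleList f (j + 1) = ruleList f j ++ [[(f (j + 1)).y₁, (f (j + 1)).y₂]] := by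
  simp [ruleList, List.range_succ]

/-- When rule `j + 1` is evaluated, the words of all rules up to `j` are available, and its symbols
refer only to these. -/
theorem words_ruleList (h : HasRules F f q s) {j : ℕ} (hj : j < q) :
    (ruleList f j).words = (List.range (j + 1)).map fun i => (f i).word := by
  induction j with
  | zero => simp [ruleList, Rules.words, h.zero]
  | succ j ih =>
    have hv := h.valid (j + 1) hj (by omega)
    have key (y : Letter r ⊕ ℕ) (hy : SymbolLt y (j + 1)) :
        y.elim (fun p => [p]) (fun i => ((List.range (j + 1)).map fun i => (f i).word).getD i []) =
          symbolWord f y := by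
      rcases y with t | i
      · rfl
      · have := hy i rfl
        simp [symbolWord, List.getD_eq_getElem?_getD, this]
    rw [ruleList_succ, Rules.words, List.foldl_append]
    change List.foldl _ (Rules.words (ruleList f j)) _ = _
    rw [ih (by omega), List.range_succ (n := j + 1), List.map_append]
    simp only [List.foldl_cons, List.foldl_nil, List.flatMap_cons, List.flatMap_nil,
      List.append_nil, key _ hv.lt₁, key _ hv.lt₂, List.map_cons, List.map_nil, hv.word_eq]

theorem word_ruleList (h : HasRules F f q s) {j : ℕ} (hj : j < q) :
    (ruleList f j).word = (f j).word := by
  rw [Rules.word, words_ruleList h hj]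
  simp [List.range_succ, List.getLastD_eq_getLast?]

theorem wellFormed_ruleList (h : HasRules F f q s) {j : ℕ} (hj : j < q) :
    (ruleList f j).WellFormed := by
  refine ⟨by simp [ruleList], fun i hi l hl => ?_⟩
  rcases i with _ | i
  · simp [ruleList] at hl
  · have hi' : i < j := by simpa [ruleList] using hi
    have hv := h.valid (i + 1) (by omega) (by omega)
    have : (ruleList f j)[i + 1] = [(f (i + 1)).y₁, (f (i + 1)).y₂] := by simp [ruleList]
    rw [this] at hl
    simp only [List.mem_cons, List.not_mem_nil, or_false] at hl
    rcases hl with hl | hl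
    · exact hv.lt₁ l hl.symm
    · exact hv.lt₂ l hl.symm

theorem encodeRules_ruleList (f : ℕ → Rule n r) (j : ℕ) : encodeRules (ruleList f j) =
    [((j + 1 : ℕ) : ℤ), 0] ++ (List.range j).flatMap fun i =>
      [2, encodeSymbol (f (i + 1)).y₁, encodeSymbol (f (i + 1)).y₂] := by
  simp [encodeRules, ruleList, withLength, List.flatMap_map]

/-- The rule number `j` describes an equation of degree `d`. -/
def IsTarget (F : Frame n r) (f : ℕ → Rule n r) (q j : ℕ) : Prop :=
  1 ≤ j ∧ j < q ∧ (f j).p = F.st (none, true) ∧ (f j).q = F.st (none, true) ∧ (f j).k = 2 * F.d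

theorem ens_writeRules (h : HasRules F f q s) (hout : s.out = []) :
    writeRules.Ens s (200 + q * 100) fun s' => HasRules F f q s' ∧
      ((∃ j, IsTarget F f q j ∧ s'.v 34 = j ∧ s'.out = 1 :: encodeRules (ruleList f j)) ∨
      ¬ Known f q (F.st (none, true)) (F.st (none, true)) (2 * F.d) ∧ s'.v 34 ≤ 0 ∧
        s'.out = [0]) := by
  have hx : s.a 1 (r + 1) = F.st (none, true) := by
    rw [← h.st]
    simp [encodeLetter, signed]
  let z := s.a 3 (slot F.T.length (2 * F.d + 1) (F.st (none, true)) (F.st (none, true)) (2 * F.d))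
  have E1 : (set 34 (get 1 (var 1 + 1)) ;;
      set 34 (get 3 (slotExpr (var 34) (var 34) (var 3)))).Ens s 100 fun s' =>
        HasRules F f q s' ∧ s'.v 34 = z ∧ s'.a = s.a ∧ s'.out = [] := by
    refine (Cmd.Ens.of_flat rfl ?_).mono (by decide) fun _ => id
    have e : (set 34 (get 1 (var 1 + 1)) ;;
        set 34 (get 3 (slotExpr (var 34) (var 34) (var 3)))).sem s =
        (s.setVar 34 (F.st (none, true))).setVar 34 z := by
      simp [h.r_eq, hx, slotExpr, h.m_eq, h.e_eq, h.d_eq, z, slot]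
    rw [e]
    exact ⟨(h.setVar (by omega) _).setVar (by omega) _, by simp, rfl, hout⟩
  have e : writeRules.Ens s (200 + q * 100) = ((set 34 (get 1 (var 1 + 1)) ;;
      set 34 (get 3 (slotExpr (var 34) (var 34) (var 3)))) ;;
      ite (var 34) (write 1 ;; write (var 34 + 1) ;; write 0 ;; loop 19 (var 34) writeRule)
        (write 0)).Ens s (200 + q * 100) := by
    funext Q
    simp [Cmd.Ens, writeRules, Cmd.cost, Nat.add_assoc]
  rw [e]
  refine (E1.seq (B' := 100 + q * 100) ?_).mono (by omega) fun _ => id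
  rintro s₁ ⟨g1, g2, g3, g4⟩
  refine (Cmd.Ens.ite (B := 70 + q * 100) (B' := 10) (fun hpos => ?_) fun hpos => ?_).mono
    (by simp [Expr.cost]; omega) fun _ => id
  · simp only [Expr.eval_var, g2] at hpos
    obtain ⟨j, h1, h2, h3, h4⟩ := h.known_of_pos (F.st_lt _) (by omega) hpos
    have h34 : s₁.v 34 = j := g2.trans h3
    have E2 : (write 1 ;; write (var 34 + 1) ;; write 0).Ens s₁ 20 fun s' =>
        HasRules F f q s' ∧ s'.v 34 = j ∧ s'.out = [1, ((j + 1 : ℕ) : ℤ), 0] :=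
      (Cmd.Ens.of_flat rfl ⟨g1.of_eq (fun _ _ => rfl) fun _ _ => rfl, by simp [h34],
        by simp [g4, h34]⟩).mono (by decide) fun _ => id
    have e : (write 1 ;; write (var 34 + 1) ;; write 0 ;; loop 19 (var 34) writeRule).Ens s₁
        (70 + q * 100) = ((write 1 ;; write (var 34 + 1) ;; write 0) ;;
          loop 19 (var 34) writeRule).Ens s₁ (70 + q * 100) := by
      funext Q
      simp [Cmd.Ens, Cmd.cost, Nat.add_assoc]
    rw [e]
    refine (E2.seq (B' := 50 + q * 100) ?_).mono (by omega) fun _ => id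
    rintro s₂ ⟨k1, k2, k3⟩
    refine (Cmd.Ens.loop (B := 90) (N := j) (fun i s' => HasRules F f q s' ∧ s'.v 34 = j ∧
      s'.out = 1 :: ([((j + 1 : ℕ) : ℤ), 0] ++ (List.range i).flatMap fun i =>
        [2, encodeSymbol (f (i + 1)).y₁, encodeSymbol (f (i + 1)).y₂])) (by simp [k2])
      ⟨k1, k2, by simp [k3]⟩ ?_).mono ?_ ?_
    · rintro i hi s' ⟨l1, l2, l3⟩
      refine (Cmd.Ens.of_flat rfl ⟨?_, ?_, ?_⟩).mono (by decide) fun _ => id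
      · exact ((l1.setVar (x := 19) (by omega) i).setVar (x := 23) (by omega) (i + 1)).of_eq
          (fun _ _ => by simp [writeRule]) fun _ _ => by simp [writeRule]
      · simp [writeRule, l2]
      · have a1 := l1.arr_y₁ (i + 1) (by omega) (by omega)
        have a2 := l1.arr_y₂ (i + 1) (by omega) (by omega)
        push_cast at a1 a2
        simp [writeRule, l3, List.range_succ, a1, a2]
    · simp [Expr.cost]
      omega
    · rintro s' ⟨l1, l2, l3⟩
      exact ⟨l1, Or.inl ⟨j, ⟨h1, h2, h4⟩, l2, by rw [l3, encodeRules_ruleList]⟩⟩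
  · simp only [Expr.eval_var, g2] at hpos
    refine (Cmd.Ens.of_flat rfl ⟨g1.of_eq (fun _ _ => rfl) fun _ _ => rfl, Or.inr
      ⟨fun hK => hpos (hK.pos h), ?_, ?_⟩⟩).mono (by decide) fun _ => id
    · simpa [g2] using hpos
    · simp [g4]

end FreeEq

namespace FreeEq

open RAM FreeGroup
open RAM.Expr (var get)
open RAM.Cmd (skip set put read write ite loop)

variable {n r : ℕ} {F : Frame n r} {f : ℕ → Rule n r} {q : ℕ} {s : Store}

/-! ### Writing the equation -/

/-- The stack in the arrays `a` and `b` consists of pairs of a letter and a rule number, where `0`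
stands for nothing. -/
def IsStack (r : ℕ) (a b : ℤ → ℤ) : List (Option (Option (Fin n) × Bool) × ℕ) → Prop
  | [] => True
  | x :: S => a S.length = optionCode x.1 ∧
      (b S.length = (r : ℤ) + 2 + x.2 ∨ x.2 = 0 ∧ b S.length ≤ (r : ℤ) + 2) ∧ IsStack r a b S

theorem IsStack.congr {a b a' b' : ℤ → ℤ} {S : List (Option (Option (Fin n) × Bool) × ℕ)}
    (h : IsStack r a b S) (hab : ∀ i : ℕ, i < S.length → a' i = a i ∧ b' i = b i) :
    IsStack r a' b' S := by
  induction S with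
  | nil => trivial
  | cons x S ih =>
    obtain ⟨h1, h2, h3⟩ := h
    obtain ⟨e1, e2⟩ := hab S.length (by simp)
    exact ⟨by rw [e1, h1], by rwa [e2], ih h3 fun i hi => hab i (by simp; omega)⟩

/-- The value of the rule number `c` in the explicit equation. -/
def ruleValue (F : Frame n r) (f : ℕ → Rule n r) (c : ℕ) : FreeGroup (Option (Fin n)) :=
  pathValue F.w F.T (f c).p (f c).q (f c).word

/-- The value of a stack in the explicit equation. -/
def stackValue (F : Frame n r) (f : ℕ → Rule n r)
    (S : List (Option (Option (Fin n) × Bool) × ℕ)) : FreeGroup (Option (Fin n)) :=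
  (S.map fun x => mk x.1.toList * ruleValue F f x.2).prod

/-- A bound for the number of steps that are needed to unfold the rule number `c`. -/
def rulePotential (F : Frame n r) (f : ℕ → Rule n r) (c : ℕ) : ℕ :=
  if (f c).k = 0 then 1 else 4 * ((2 * (f c).k - 2) * F.size + c)

def stackPotential (F : Frame n r) (f : ℕ → Rule n r)
    (S : List (Option (Option (Fin n) × Bool) × ℕ)) : ℕ :=
  (S.map fun x => rulePotential F f x.2).sum

/-- The rule number that belongs to a symbol. -/
def symbolIndex : Letter r ⊕ ℕ → ℕ := Sum.elim (fun _ => 0) id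

theorem HasRules.symbolValue_eq (h : HasRules F f q s) (y : Letter r ⊕ ℕ) :
    symbolValue F f y = ruleValue F f (symbolIndex y) := by
  rcases y with t | i
  · exact h.symbol_zero.2.2.1.symm
  · rfl

theorem HasRules.symbolWeight_eq (h : HasRules F f q s) (y : Letter r ⊕ ℕ) :
    symbolWeight f y = (f (symbolIndex y)).k := by
  rcases y with t | i
  · exact h.symbol_zero.2.1.symm
  · rfl

theorem encodeSymbol_eq (y : Letter r ⊕ ℕ) : encodeSymbol y = (r : ℤ) + 2 + (symbolIndex y : ℕ) ∨
    symbolIndex y = 0 ∧ encodeSymbol y ≤ (r : ℤ) + 2 := by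
  rcases y with t | i
  · refine Or.inr ⟨rfl, ?_⟩
    have := (abs_encodeLetter_le t).2
    simp only [encodeSymbol]
    omega
  · exact Or.inl rfl

theorem rulePotential_pos {c : ℕ} : (c = 0 → (f c).k = 0) →
    1 ≤ rulePotential F f c := by
  intro hc
  unfold rulePotential
  split
  · exact le_rfl
  · have : c ≠ 0 := fun h => absurd (hc h) ‹_›
    omega

/-- Rule numbers decrease and weights do not increase in total. If at most one symbol keeps positive
weight, the decrease of the rule number, multiplied by `4`, pays for the remaining stack entries,
each of potential `1`. If both do, their weights lower the first term by `2 * F.size` before the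
factor `4`, which covers the second rule number, as it is at most `F.size`. -/
theorem HasRules.potential_lt (h : HasRules F f q s) {c : ℕ} (hc : 1 ≤ c) (hcq : c < q)
    (hk : (f c).k ≠ 0) : rulePotential F f (symbolIndex (f c).y₁) +
      (rulePotential F f (symbolIndex (f c).y₂) + rulePotential F f 0) <
      rulePotential F f c := by
  have hv := h.valid c hcq hc
  have hw := hv.weight_le
  have hq := h.q_le
  rw [h.symbolWeight_eq, h.symbolWeight_eq] at hw
  have hlt (y : Letter r ⊕ ℕ) (hy : SymbolLt y c) : symbolIndex y < c := by
    rcases y with t | i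
    · exact hc
    · exact hy i rfl
  have h1 := hlt _ hv.lt₁
  have h2 := hlt _ hv.lt₂
  have h0 : rulePotential F f 0 = 1 := if_pos h.zero.2.2.1
  have hcF : c ≤ F.size := by
    unfold Frame.size
    omega
  rw [h0]
  generalize symbolIndex (f c).y₁ = c₁ at *
  generalize symbolIndex (f c).y₂ = c₂ at *
  unfold rulePotential
  rw [if_neg hk]
  generalize (f c).k = k at *
  generalize (f c₁).k = k₁ at *
  generalize (f c₂).k = k₂ at *
  generalize F.size = N at *
  obtain ⟨k, rfl⟩ := Nat.exists_eq_succ_of_ne_zero hk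
  have e (k : ℕ) : (2 * (k + 1) - 2) * N = 2 * (k * N) := by
    rw [show 2 * (k + 1) - 2 = 2 * k by omega, mul_assoc]
  rw [Nat.succ_eq_add_one, e]
  rcases k₁ with _ | k₁ <;> rcases k₂ with _ | k₂
  · simp
    omega
  · have h3 : k₂ * N ≤ k * N := Nat.mul_le_mul_right _ (by omega)
    simp only [e, if_true, Nat.add_eq_zero_iff, one_ne_zero, and_false, if_false]
    omega
  · have h3 : k₁ * N ≤ k * N := Nat.mul_le_mul_right _ (by omega)
    simp only [e, if_true, Nat.add_eq_zero_iff, one_ne_zero, and_false, if_false]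
    omega
  · have h3 : (k₁ + k₂ + 1) * N ≤ k * N := Nat.mul_le_mul_right _ (by omega)
    simp only [e, Nat.add_eq_zero_iff, one_ne_zero, and_false, if_false]
    rw [Nat.add_mul, Nat.add_mul] at h3
    omega

/-- The array `13` contains the reduced word `W`. -/
structure HasWord (W : List (Option (Fin n) × Bool)) (s : Store) : Prop where
  length_eq : s.v 36 = W.length
  get : ∀ (i : ℕ) (hi : i < W.length), s.a 13 i = encodeLetter W[i]
  reduced : IsReduced W

/-- A letter that is inverse to the last one deletes it, so the word stays reduced throughout and
needs no reduction afterwards. -/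
theorem HasWord.sem_pushLetter {W : List (Option (Fin n) × Bool)} (h : HasWord W s)
    (a : Option (Fin n) × Bool) (ha : s.v 27 = encodeLetter a) :
    ∃ W', HasWord W' (pushLetter.sem s) ∧ FreeGroup.mk W' = FreeGroup.mk W * FreeGroup.mk [a] ∧
      W'.length ≤ W.length + 1 := by
  have hpush : (IsReduced (W ++ [a])) →
      HasWord (W ++ [a]) ((put 13 (var 36) (var 27) ;; set 36 (var 36 + 1)).sem s) := by
    intro hr
    refine ⟨by simp [h.length_eq], fun i hi => ?_, hr⟩
    simp only [Cmd.sem_seq, Cmd.sem_put, Cmd.sem_set, Store.setVar_a, Store.putArr_a, if_true,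
      Expr.eval_var, h.length_eq, ha, Function.update_apply, Nat.cast_inj]
    by_cases hi' : i = W.length
    · simp [hi']
    · have : i < W.length := by simp at hi; omega
      rw [if_neg hi', h.get i this, List.getElem_append_left]
  rcases List.eq_nil_or_concat W with rfl | ⟨W, b, rfl⟩
  · refine ⟨[a], ?_, by simp [← FreeGroup.one_eq_mk], by simp⟩
    rw [pushLetter, Cmd.sem_ite, if_neg (by simp [h.length_eq])]
    exact hpush (by simp)
  · rw [List.concat_eq_append] at *
    have hb : s.a 13 (s.v 36 - 1) = encodeLetter b := by
      have := h.get W.length (by simp)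
      simpa [h.length_eq] using this
    have hpos : (0 : ℤ) < s.v 36 := by
      simp [h.length_eq]
    by_cases hab : encodeLetter b + encodeLetter a = 0
    · refine ⟨W, ?_, ?_, by simp; omega⟩
      · rw [pushLetter, Cmd.sem_ite, if_pos (by simpa [hb, ha, hab] using hpos)]
        refine ⟨by simp [h.length_eq], fun i hi => ?_, ?_⟩
        · have := h.get i (by simp; omega)
          rw [List.getElem_append_left hi] at this
          exact this
        · exact h.reduced.infix (List.infix_append' [] W [b])
      · have hne : ¬ (b.1 = a.1 → b.2 = a.2) := fun h => (encodeLetter_add_eq_zero b a).2 h hab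
        obtain ⟨o, ε⟩ := a
        obtain ⟨o', δ⟩ := b
        simp only [Classical.not_imp] at hne
        obtain ⟨rfl, hne⟩ := hne
        obtain rfl : ε = !δ := by cases ε <;> cases δ <;> simp_all
        rw [← FreeGroup.mul_mk, mul_assoc]
        have : FreeGroup.mk [(o', δ)] * FreeGroup.mk [(o', !δ)] = 1 := by
          rw [FreeGroup.mul_mk]
          exact Quot.sound (Red.Step.not (L₁ := []) (L₂ := []))
        rw [this, mul_one]
    · refine ⟨W ++ [b] ++ [a], ?_, by rw [FreeGroup.mul_mk], by simp⟩
      rw [pushLetter, Cmd.sem_ite, if_neg]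
      · refine hpush (h.reduced.append_overlap ?_ (by simp))
        simpa using (encodeLetter_add_eq_zero b a).1 hab
      · simp only [Expr.eval_mul, Expr.eval_sub, Expr.eval_add, Expr.eval_one, Expr.eval_var,
          Expr.eval_get, hb, ha]
        have h3 := mul_self_pos.2 hab
        nlinarith

/-- The state while the equation is written: the stack `S` and the reduced word `W` have to be
multiplied to `V`. -/
structure HasStack (F : Frame n r) (f : ℕ → Rule n r) (q : ℕ)
    (V : FreeGroup (Option (Fin n))) (S : List (Option (Option (Fin n) × Bool) × ℕ))
    (W : List (Option (Fin n) × Bool)) (s : Store) : Prop where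
  rules : HasRules F f q s
  length_eq : s.v 35 = S.length
  stack : IsStack r (s.a 11) (s.a 12) S
  index_lt : ∀ x ∈ S, x.2 < q
  word : HasWord W s
  value : mk W * stackValue F f S = V

theorem HasStack.sem_unfoldStep_nil {V : FreeGroup (Option (Fin n))}
    {W : List (Option (Fin n) × Bool)} (h : HasStack F f q V [] W s) : unfoldStep.sem s = s := by
  rw [unfoldStep, Cmd.sem_ite, if_neg (by simp [h.length_eq])]
  rfl

theorem stackValue_cons (x : Option (Option (Fin n) × Bool) × ℕ)
    (S : List (Option (Option (Fin n) × Bool) × ℕ)) :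
    stackValue F f (x :: S) = mk x.1.toList * ruleValue F f x.2 * stackValue F f S := by
  simp [stackValue]

theorem HasRules.ruleValue_eq_one (h : HasRules F f q s) {c : ℕ} (hc : c < q)
    (hk : (f c).k = 0) : ruleValue F f c = 1 := by
  rcases Nat.eq_zero_or_pos c with rfl | hc'
  · exact h.symbol_zero.2.2.1
  · have := (h.valid c hc hc').fact
    rw [hk] at this
    exact this.pathValue_eq_one

theorem HasRules.sem_expandSymbol {V : FreeGroup (Option (Fin n))} {c : ℕ}
    {S : List (Option (Option (Fin n) × Bool) × ℕ)} {W : List (Option (Fin n) × Bool)}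
    (hr : HasRules F f q s) (h35 : s.v 35 = S.length) (h28 : s.v 28 = (r : ℤ) + 2 + c)
    (hc : 1 ≤ c) (hcq : c < q) (hst : IsStack r (s.a 11) (s.a 12) S) (hS : ∀ x ∈ S, x.2 < q)
    (hw : HasWord W s) (hv : FreeGroup.mk W * (ruleValue F f c * stackValue F f S) = V) :
    ∃ S', HasStack F f q V S' W (expandSymbol.sem s) ∧
      stackPotential F f S' < rulePotential F f c + stackPotential F f S := by
  have hk := hr.arr_k c hcq
  have e1 : (var 28 - (var 1 + 2) : Expr).eval s = c := by simp [h28, hr.r_eq]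
  have hs := hr.setVar (x := 23) (by omega) c
  rw [expandSymbol, Cmd.sem_seq, Cmd.sem_set, e1, Cmd.sem_ite]
  by_cases h0 : (f c).k = 0
  · rw [if_neg (by simp [hk, h0])]
    refine ⟨S, ⟨hs, by simp [h35], hst, hS,
      ⟨by simpa using hw.length_eq, hw.get, hw.reduced⟩, ?_⟩, ?_⟩
    · rw [← hv, hr.ruleValue_eq_one hcq h0, one_mul]
    · simp [stackPotential, rulePotential, h0]
  · rw [if_pos (by simp [hk]; omega)]
    have hva := hr.valid c hcq hc
    have hlt (y : Letter r ⊕ ℕ) (hy : SymbolLt y c) : symbolIndex y < q := by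
      rcases y with t | i
      · exact hr.q_pos
      · exact (hy i rfl).trans hcq
    -- The value of a rule is the product of `a`, its two symbols and `b`. Letter symbols have value
    -- `1`, so they get the index `0` like the empty word.
    refine ⟨((f c).a, symbolIndex (f c).y₁) :: (none, symbolIndex (f c).y₂) :: ((f c).b, 0) :: S,
      ⟨?_, ?_, ?_, ?_, ⟨?_, ?_, hw.reduced⟩, ?_⟩, ?_⟩
    · refine hs.of_eq (fun x hx => ?_) fun x hx => ?_
      · simp only [List.mem_cons, List.not_mem_nil, or_false] at hx
        rcases hx with rfl | rfl | rfl | rfl | rfl | rfl <;> simp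
      · simp only [List.mem_cons, List.not_mem_nil, or_false] at hx
        rcases hx with rfl | rfl | rfl | rfl | rfl | rfl | rfl | rfl | rfl | rfl | rfl | rfl <;>
          simp
    · simp [h35]
      ring
    · have a1 := hr.arr_y₁ c hcq hc
      have a2 := hr.arr_y₂ c hcq hc
      have a3 := hr.arr_a c hcq hc
      have a4 := hr.arr_b c hcq hc
      have b1 := encodeSymbol_eq (f c).y₁
      have b2 := encodeSymbol_eq (f c).y₂
      have n1 : (S.length : ℤ) + 1 + 1 = S.length + 2 := by ring
      refine ⟨?_, ?_, ?_, ?_, ?_, ?_, hst.congr fun i hi => ?_⟩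
      · simp [h35, a3, n1]
      · simpa [h35, a1, n1] using b1
      · simp [h35, optionCode]
      · simpa [h35, a2, n1, Function.update_apply] using b2
      · simp [h35, a4]
      · right
        simp [h35]
        omega
      · have m0 : (i : ℤ) ≠ S.length := by omega
        have m1 : (i : ℤ) ≠ S.length + 1 := by omega
        have m2 : (i : ℤ) ≠ S.length + 2 := by omega
        simp [h35, m0, m1, m2]
    · simp only [List.forall_mem_cons]
      exact ⟨hlt _ hva.lt₁, hlt _ hva.lt₂, hr.q_pos, hS⟩
    · simpa using hw.length_eq
    · simpa using hw.get
    · rw [← hv, stackValue_cons, stackValue_cons, stackValue_cons]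
      have e2 : ruleValue F f c = _ := hva.value_eq
      have e3 : ruleValue F f 0 = 1 := hr.symbol_zero.2.2.1
      rw [e2, hr.symbolValue_eq, hr.symbolValue_eq, e3]
      simp [mul_assoc, ← FreeGroup.one_eq_mk]
    · have := hr.potential_lt hc hcq h0
      simp only [stackPotential, List.map_cons, List.sum_cons]
      omega

theorem HasStack.sem_unfoldStep_cons {V : FreeGroup (Option (Fin n))}
    {x : Option (Option (Fin n) × Bool) × ℕ}
    {S : List (Option (Option (Fin n) × Bool) × ℕ)} {W : List (Option (Fin n) × Bool)}
    (h : HasStack F f q V (x :: S) W s) :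
    ∃ S' W', HasStack F f q V S' W' (unfoldStep.sem s) ∧
      stackPotential F f S' < stackPotential F f (x :: S) ∧ W'.length ≤ W.length + 1 := by
  obtain ⟨a, c⟩ := x
  have hcq : c < q := h.index_lt _ List.mem_cons_self
  obtain ⟨h1, h2, h3⟩ := h.stack
  simp only at h1 h2
  let s₁ := ((s.setVar 35 S.length).setVar 27 (optionCode a)).setVar 28 (s.a 12 S.length)
  have hs₁ : HasRules F f q s₁ :=
    ((h.rules.setVar (by omega) _).setVar (by omega) _).setVar (by omega) _
  have e : unfoldStep.sem s = (ite (var 27 * var 27) pushLetter skip ;;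
      ite (var 28 - (var 1 + 2)) expandSymbol skip).sem s₁ := by
    rw [unfoldStep, Cmd.sem_ite, if_pos (by simp [h.length_eq])]
    simp [h.length_eq, s₁, h1]
  have hw₁ : HasWord W s₁ := ⟨by simpa [s₁] using h.word.length_eq, h.word.get, h.word.reduced⟩
  obtain ⟨W', hW', hval, hlen⟩ : ∃ W', HasWord W' ((ite (var 27 * var 27) pushLetter skip).sem s₁) ∧
      FreeGroup.mk W' = FreeGroup.mk W * FreeGroup.mk a.toList ∧ W'.length ≤ W.length + 1 := by
    rcases a with _ | a
    · refine ⟨W, ?_, by simp [← FreeGroup.one_eq_mk], by omega⟩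
      rw [Cmd.sem_ite, if_neg (by simp [s₁, optionCode])]
      exact hw₁
    · rw [Cmd.sem_ite, if_pos]
      · exact hw₁.sem_pushLetter a (by simp [s₁, optionCode])
      · have := encodeLetter_ne_zero a
        simpa [s₁, optionCode] using this
  set s₂ := (ite (var 27 * var 27) pushLetter skip).sem s₁ with hs₂
  have hv (x : ℕ) (hx : x ∉ (ite (var 27 * var 27) pushLetter skip).vars) : s₂.v x = s₁.v x :=
    Cmd.sem_v _ hx _
  have ha (x : ℕ) (hx : x ∉ (ite (var 27 * var 27) pushLetter skip).arrs) : s₂.a x = s₁.a x :=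
    Cmd.sem_a _ hx _
  have hr₂ : HasRules F f q s₂ := by
    refine hs₁.of_eq (fun x hx => hv x ?_) fun x hx => ha x ?_
    · revert x
      decide
    · revert x
      decide
  have h28 : s₂.v 28 = s.a 12 S.length := (hv 28 (by decide)).trans (by simp [s₁])
  have h35 : s₂.v 35 = S.length := (hv 35 (by decide)).trans (by simp [s₁])
  have hst : IsStack r (s₂.a 11) (s₂.a 12) S := by
    rw [ha 11 (by decide), ha 12 (by decide)]
    exact h3
  have hV : FreeGroup.mk W' * (ruleValue F f c * stackValue F f S) = V := by
    rw [hval, ← h.value, stackValue_cons]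
    simp only [mul_assoc]
  have ev : (var 28 - (var 1 + 2) : Expr).eval s₂ = s.a 12 S.length - (r + 2) := by
    simp [h28, hr₂.r_eq]
  rw [e, Cmd.sem_seq, ← hs₂, Cmd.sem_ite, ev]
  by_cases hc : 0 < s.a 12 S.length - (r + 2)
  · rw [if_pos hc]
    have hc1 : 1 ≤ c := by omega
    have h12 : s.a 12 S.length = r + 2 + c := by omega
    obtain ⟨S', g1, g2⟩ := hr₂.sem_expandSymbol h35 (h28.trans h12) hc1 hcq hst
      (fun x hx => h.index_lt x (List.mem_cons_of_mem _ hx)) hW' hV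
    exact ⟨S', W', g1, by simpa [stackPotential] using g2, hlen⟩
  · rw [if_neg hc]
    have hc0 : c = 0 := by omega
    have e3 : ruleValue F f 0 = 1 := h.rules.symbol_zero.2.2.1
    refine ⟨S, W', ⟨hr₂, h35, hst, fun x hx => h.index_lt x (List.mem_cons_of_mem _ hx), hW', ?_⟩,
      ?_, hlen⟩
    · rw [← hV, hc0, e3, one_mul]
    · simp [stackPotential, hc0, rulePotential, h.rules.zero]

end FreeEq

namespace FreeEq

open RAM FreeGroup
open RAM.Expr (var get)
open RAM.Cmd (skip set put read write ite loop)

variable {n r : ℕ} {F : Frame n r} {f : ℕ → Rule n r} {q : ℕ} {s : Store}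

theorem ens_writeEquation (h : HasRules F f q s) {j : ℕ} (hj : IsTarget F f q j)
    (h34 : s.v 34 = j) (out : List ℤ) (hout : s.out = out) :
    writeEquation.Ens s (300 + 8 * ((2 * F.d + 1) * F.size) * 400) fun s' =>
      ∃ W : List (Option (Fin n) × Bool), s'.out = out ++ encodeWord W ∧ FreeGroup.IsReduced W ∧
        FreeGroup.mk W = ruleValue F f j := by
  obtain ⟨hj1, hjq, -, -, hk⟩ := hj
  have hjF : j ≤ F.size := by
    have := h.q_le
    unfold Frame.size
    omega
  have e3 : ruleValue F f 0 = 1 := h.symbol_zero.2.2.1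
  have E1 : (set 35 1 ;; put 11 0 0 ;; put 12 0 (var 1 + 2 + var 34) ;; set 36 0).Ens s 100
      fun s' => HasStack F f q (ruleValue F f j) [(none, j)] [] s' ∧ s'.out = out := by
    refine (Cmd.Ens.of_flat rfl ⟨⟨?_, ?_, ?_, ?_, ⟨?_, ?_, ?_⟩, ?_⟩, ?_⟩).mono (by decide) fun _ => id
    · refine h.of_eq (fun x hx => Cmd.sem_v _ ?_ _) fun x hx => Cmd.sem_a _ ?_ _
      · revert x
        decide
      · revert x
        decide
    · simp
    · exact ⟨by simp [optionCode], Or.inl (by simp [h.r_eq, h34]), trivial⟩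
    · simpa using hjq
    · simp
    · simp
    · simp
    · simp [stackValue, ← FreeGroup.one_eq_mk]
    · simpa using hout
  obtain ⟨N, hN⟩ : ∃ N, N = 8 * ((2 * F.d + 1) * F.size) := ⟨_, rfl⟩
  rw [← hN]
  refine (Cmd.Ens.ite (B := 290 + N * 400) (B' := 0) (fun _ => ?_) fun hpos => absurd hpos ?_).mono
    (by simp [Expr.cost]; omega) fun _ => id
  swap
  · simp [h34]
    omega
  have e : (set 35 1 ;; put 11 0 0 ;; put 12 0 (var 1 + 2 + var 34) ;; set 36 0 ;;
      loop 19 (8 * (var 4 * (var 5 * var 5 * var 4))) unfoldStep ;;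
      write (var 36) ;; loop 19 (var 36) (write (get 13 (var 19)))).Ens s (290 + N * 400) =
      ((set 35 1 ;; put 11 0 0 ;; put 12 0 (var 1 + 2 + var 34) ;; set 36 0) ;;
      loop 19 (8 * (var 4 * (var 5 * var 5 * var 4))) unfoldStep ;;
      write (var 36) ;; loop 19 (var 36) (write (get 13 (var 19)))).Ens s (290 + N * 400) := by
    funext Q
    simp [Cmd.Ens, Cmd.cost, Nat.add_assoc]
  rw [e]
  refine (E1.seq (B' := 190 + N * 400) ?_).mono (by omega) fun _ => id
  rintro s₁ ⟨h1, hout⟩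
  have E2 : (loop 19 (8 * (var 4 * (var 5 * var 5 * var 4))) unfoldStep).Ens s₁ (50 + N * 300)
      fun s' => ∃ W : List (Option (Fin n) × Bool), W.length ≤ N ∧ HasWord W s' ∧
        FreeGroup.mk W = ruleValue F f j ∧ s'.out = out := by
    have hr := h1.rules
    -- Each pass lowers the potential by at least one or finds the stack empty, and lengthens the
    -- word by at most one letter. So the stack is empty in the end, and `N` also bounds the length
    -- of the equation.
    refine (Cmd.Ens.loop (B := 290) (N := N) (fun i s' => ∃ S W,
      HasStack F f q (ruleValue F f j) S W s' ∧ (S = [] ∨ stackPotential F f S + i ≤ N) ∧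
      W.length ≤ i ∧ s'.out = out) ?_ ⟨_, _, h1, Or.inr ?_, le_rfl, hout⟩ ?_).mono ?_ ?_
    · simp [hr.e_eq, hr.m_eq, hN, Frame.size]
    · have hpos : 0 < F.size := by omega
      simp only [stackPotential, List.map_cons, List.map_nil, List.sum_cons, List.sum_nil,
        rulePotential, hk, hN]
      split
      · nlinarith
      · obtain ⟨d, hd⟩ := Nat.exists_eq_succ_of_ne_zero (by omega : F.d ≠ 0)
        -- The initial potential is at most `4 * ((4 * F.d - 2) * F.size + F.size)`, which is below
        -- `8 * (2 * F.d + 1) * F.size`.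
        rw [hd, show 2 * (2 * d.succ) - 2 = 4 * d + 2 by omega]
        nlinarith
    · rintro i hi s' ⟨S, W, k1, k2, k3, k4⟩
      have hs : HasStack F f q (ruleValue F f j) S W (s'.setVar 19 i) :=
        ⟨k1.rules.setVar (by omega) _, by simpa using k1.length_eq, k1.stack, k1.index_lt,
          ⟨by simpa using k1.word.length_eq, k1.word.get, k1.word.reduced⟩, k1.value⟩
      have hout' : (unfoldStep.sem (s'.setVar 19 i)).out = out := by
        rw [Cmd.sem_out _ rfl]
        exact k4
      rcases S with _ | ⟨x, S⟩
      · refine (Cmd.Ens.of_flat rfl ⟨[], W, ?_, Or.inl rfl, by omega, hout'⟩).mono (by decide)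
          fun _ => id
        rw [hs.sem_unfoldStep_nil]
        exact hs
      · obtain ⟨S', W', l1, l2, l3⟩ := hs.sem_unfoldStep_cons
        refine (Cmd.Ens.of_flat rfl ⟨S', W', l1, Or.inr ?_, by omega, hout'⟩).mono (by decide)
          fun _ => id
        have := k2.resolve_left (by simp)
        omega
    · have : (8 * (var 4 * (var 5 * var 5 * var 4)) : Expr).cost ≤ 40 := by decide
      omega
    · rintro s' ⟨S, W, k1, k2, k3, k4⟩
      have hS : S = [] := by
        refine k2.elim id fun k2 => ?_
        rcases S with _ | ⟨x, S⟩
        · rfl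
        · have := rulePotential_pos (F := F) (f := f) (c := x.2) fun h0 => by
            rw [h0]
            exact h.zero.2.2.1
          simp only [stackPotential, List.map_cons, List.sum_cons] at k2
          omega
      subst hS
      exact ⟨W, k3, k1.word, by simpa [stackValue] using k1.value, k4⟩
  refine (E2.seq (B' := 100 + N * 50) ?_).mono (by omega) fun _ => id
  rintro s₂ ⟨W, k1, k2, k3, k4⟩
  have E3 : (write (var 36)).Ens s₂ 10 fun s' => HasWord W s' ∧
      s'.out = out ++ [(W.length : ℤ)] :=
    (Cmd.Ens.of_flat rfl ⟨⟨k2.length_eq, k2.get, k2.reduced⟩, by simp [k4, k2.length_eq]⟩).mono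
      (by decide) fun _ => id
  refine (E3.seq (B' := 50 + N * 50) ?_).mono (by omega) fun _ => id
  rintro s₃ ⟨l1, l2⟩
  refine (Cmd.Ens.loop (B := 40) (N := W.length) (fun i s' => HasWord W s' ∧
    s'.out = out ++ (W.length : ℤ) :: (W.take i).map encodeLetter) (by simpa using l1.length_eq)
    ⟨l1, by simpa using l2⟩ ?_).mono ?_ ?_
  · rintro i hi s' ⟨m1, m2⟩
    refine (Cmd.Ens.of_flat rfl ⟨⟨by simpa using m1.length_eq, m1.get, m1.reduced⟩, ?_⟩).mono
      (by decide) fun _ => id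
    have e : (W.take (i + 1)).map encodeLetter =
        (W.take i).map encodeLetter ++ [encodeLetter W[i]] := by
      rw [List.take_add_one, List.getElem?_eq_getElem hi]
      simp only [Option.toList_some, List.map_append, List.map_cons, List.map_nil]
    rw [e]
    simp only [Cmd.sem_write, Expr.eval_get, Expr.eval_var, Store.setVar_v, if_true,
      Store.setVar_a, Store.setVar_out, m2, m1.get i hi, List.append_assoc, List.cons_append]
  · have : W.length * (40 + 7) ≤ N * 50 := Nat.mul_le_mul k1 (by omega)
    simp only [Expr.cost]
    omega
  · rintro s' ⟨m1, m2⟩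
    exact ⟨W, by rw [m2, List.take_length]; simp [encodeWord, withLength], m1.reduced, k3⟩

end FreeEq

namespace FreeEq

open RAM FreeGroup
open RAM.Expr (var get)
open RAM.Cmd (skip set put read write ite loop)

/-! ### Bounds for the running time -/

section Bounds

variable {n r L d M q R K D : ℕ}

theorem monomial_le (hR : 1 ≤ R) (hK : 1 ≤ K) (hD : 1 ≤ D) {a b c : ℕ} (ha : a ≤ 3) (hb : b ≤ 3)
    (hc : c ≤ 2) : R ^ a * K ^ b * D ^ c ≤ R ^ 3 * K ^ 3 * D ^ 2 :=
  Nat.mul_le_mul (Nat.mul_le_mul (Nat.pow_le_pow_right hR ha) (Nat.pow_le_pow_right hK hb))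
    (Nat.pow_le_pow_right hD hc)

theorem size_le (hM : M ≤ 8 * (R * K)) (hd : d ≤ D) (hD : 1 ≤ D) :
    M * M * (2 * d + 1) ≤ 192 * (R ^ 2 * K ^ 2 * D) := by
  calc M * M * (2 * d + 1) ≤ (8 * (R * K)) * (8 * (R * K)) * (3 * D) := by
        gcongr
        omega
    _ = 192 * (R ^ 2 * K ^ 2 * D) := by ring

theorem readInput_bound (hR : 1 ≤ R) (hK : 1 ≤ K) (hD : 1 ≤ D) (hr : r ≤ R) (hL : L ≤ K) :
    100 + (r + 1) * (410 + L * 200) ≤ 2000 * (R ^ 3 * K ^ 3 * D ^ 2) := by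
  have h1 := monomial_le hR hK hD (a := 0) (b := 0) (c := 0) (by omega) (by omega) (by omega)
  have h2 := monomial_le hR hK hD (a := 1) (b := 1) (c := 0) (by omega) (by omega) (by omega)
  have h3 : (r + 1) * (410 + L * 200) ≤ (2 * R) * (610 * K) := by
    gcongr <;> omega
  simp only [pow_zero, pow_one, mul_one] at h1 h2
  linarith

theorem initRules_bound (hR : 1 ≤ R) (hK : 1 ≤ K) (hD : 1 ≤ D) (hr : r ≤ R)
    (hM : M ≤ 8 * (R * K)) :
    100 + M * 200 + (2 * r + 3) * ((2 * r + 3) * 400 + 100) ≤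
      20000 * (R ^ 3 * K ^ 3 * D ^ 2) := by
  have h1 := monomial_le hR hK hD (a := 0) (b := 0) (c := 0) (by omega) (by omega) (by omega)
  have h2 := monomial_le hR hK hD (a := 1) (b := 1) (c := 0) (by omega) (by omega) (by omega)
  have h3 := monomial_le hR hK hD (a := 2) (b := 0) (c := 0) (by omega) (by omega) (by omega)
  have h4 : (2 * r + 3) * ((2 * r + 3) * 400 + 100) ≤ (5 * R) * ((5 * R) * 400 + 100 * R) := by
    gcongr <;> omega
  simp only [pow_zero, pow_one, mul_one] at h1 h2 h3
  nlinarith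

/-- The dominant term: `M * M * (2 * d + 1)` facts, each compared with `M * (2 * d + 1)` possible
partners. -/
theorem closeRules_bound (hR : 1 ≤ R) (hK : 1 ≤ K) (hD : 1 ≤ D) (hM : M ≤ 8 * (R * K))
    (hd : d ≤ D) :
    30 + M * M * (2 * d + 1) * (500 + M * ((2 * d + 1) * 500 + 100)) ≤
      3000000 * (R ^ 3 * K ^ 3 * D ^ 2) := by
  have h1 := monomial_le hR hK hD (a := 0) (b := 0) (c := 0) (by omega) (by omega) (by omega)
  have h2 : 500 + M * ((2 * d + 1) * 500 + 100) ≤ 13300 * (R * K * D) := by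
    have h3 : 1 ≤ R * K * D := Nat.mul_pos (Nat.mul_pos hR hK) hD
    have h4 : M * ((2 * d + 1) * 500 + 100) ≤ 8 * (R * K) * (1600 * D) := by
      gcongr
      omega
    linarith
  have h5 := Nat.mul_le_mul (size_le hM hd hD) h2
  simp only [pow_zero, mul_one] at h1
  have h6 : 192 * (R ^ 2 * K ^ 2 * D) * (13300 * (R * K * D)) =
      2553600 * (R ^ 3 * K ^ 3 * D ^ 2) := by ring
  linarith

theorem writeRules_bound (hR : 1 ≤ R) (hK : 1 ≤ K) (hD : 1 ≤ D) (hM : M ≤ 8 * (R * K))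
    (hd : d ≤ D) (hq : q ≤ M * M * (2 * d + 1) + 1) :
    200 + q * 100 ≤ 20000 * (R ^ 3 * K ^ 3 * D ^ 2) := by
  have h1 := monomial_le hR hK hD (a := 0) (b := 0) (c := 0) (by omega) (by omega) (by omega)
  have h2 := monomial_le hR hK hD (a := 2) (b := 2) (c := 1) (by omega) (by omega) (by omega)
  have h3 := size_le hM hd hD
  simp only [pow_zero, pow_one, mul_one] at h1 h2
  linarith

theorem writeEquation_bound (hR : 1 ≤ R) (hK : 1 ≤ K) (hD : 1 ≤ D) (hM : M ≤ 8 * (R * K))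
    (hd : d ≤ D) :
    300 + 8 * ((2 * d + 1) * (M * M * (2 * d + 1))) * 400 ≤
      2000000 * (R ^ 3 * K ^ 3 * D ^ 2) := by
  have h1 := monomial_le hR hK hD (a := 0) (b := 0) (c := 0) (by omega) (by omega) (by omega)
  have h2 := monomial_le hR hK hD (a := 2) (b := 2) (c := 2) (by omega) (by omega) (by omega)
  have h3 := Nat.mul_le_mul (show 2 * d + 1 ≤ 3 * D by omega) (size_le hM hd hD)
  have h4 : 3 * D * (192 * (R ^ 2 * K ^ 2 * D)) = 576 * (R ^ 2 * K ^ 2 * D ^ 2) := by ring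
  simp only [pow_zero, mul_one] at h1
  linarith

end Bounds

/-! ### The algorithm -/

variable {n r : ℕ}

theorem ens_decideCmd {w : Option (Fin r) → List (Fin n × Bool)} {d L R K D : ℕ}
    (hL : ∀ o, (w o).length ≤ L) (hR : 1 ≤ R) (hK : 1 ≤ K) (hD : 1 ≤ D) (hr : r ≤ R)
    (hLK : L ≤ K) (hd : d ≤ D) :
    decideCmd.Ens (Store.init ([(n : ℤ), (r : ℤ), (d : ℤ)] ++
      (List.range (r + 1)).flatMap fun j => wordCode (w (letterOf r j))))
      (3050000 * (R ^ 3 * K ^ 3 * D ^ 2)) fun s => ∃ (F : Frame n r) (f : ℕ → Rule n r) (q : ℕ),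
        F.w = w ∧ F.d = d ∧ F.T.length ≤ 8 * (R * K) ∧ HasRules F f q s ∧
        ((∃ j, IsTarget F f q j ∧ s.v 34 = j ∧ s.out = 1 :: encodeRules (ruleList f j)) ∨
        ¬ Derivable F.T F.st F.en (F.st (none, true)) (F.st (none, true)) (2 * d) ∧ s.v 34 ≤ 0 ∧
          s.out = [0]) := by
  have E1 := ens_readInput (n := n) (d := d) hL rfl
  -- The monomial becomes an atom, so that adding up the bounds of the phases is linear arithmetic.
  obtain ⟨X, hX⟩ : ∃ X, X = R ^ 3 * K ^ 3 * D ^ 2 := ⟨_, rfl⟩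
  have b1 := readInput_bound hR hK hD hr hLK
  rw [← hX] at b1 ⊢
  refine (Cmd.Ens.seq (B := 2000 * X) (B' := 3045000 * X) (Q := fun s =>
    HasInput n w d (r + 1) s ∧ s.out = [])
    ⟨E1.1.trans b1, E1.2, Cmd.sem_out _ rfl _⟩ ?_).mono (by omega) fun _ => id
  rintro s ⟨h1, hout⟩
  obtain ⟨F, rfl, rfl, h2, hpos, hM⟩ := h1.exists_frame hL
  have hM : F.T.length ≤ 8 * (R * K) := by
    have : (r + 1) * (L + 1) ≤ (2 * R) * (2 * K) := by gcongr <;> omega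
    linarith
  have b2 := initRules_bound hR hK hD hr hM
  have b3 := closeRules_bound hR hK hD hM hd
  rw [← hX] at b2 b3
  have E2 := ens_initRules h2 h1.arr hpos
  refine (Cmd.Ens.seq (B := 20000 * X) (B' := 3020000 * X) (Q := fun s' => (∃ f q,
    HasRules F f q s' ∧ (∀ p < F.T.length, Known f q p p 0) ∧ SilentKnown F f q fun _ _ => True) ∧
    s'.out = []) ⟨E2.1.trans b2, E2.2, (Cmd.sem_out _ rfl _).trans hout⟩ ?_).mono (by omega)
    fun _ => id
  rintro s ⟨⟨f, q, h3, h4, h5⟩, hout⟩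
  have E3 := ens_closeRules h3
  refine (Cmd.Ens.seq (B := 3000000 * X) (B' := 20000 * X) (Q := fun s' => (∃ f' q',
    HasRules F f' q' s' ∧ Extends f q f' q' ∧ Processed F f' q' q') ∧ s'.out = [])
    ⟨E3.1.trans b3, E3.2, (Cmd.sem_out _ rfl _).trans hout⟩ ?_).mono (by omega) fun _ => id
  rintro s ⟨⟨f', q', k1, k2, k3⟩, hout⟩
  have b4 := writeRules_bound hR hK hD hM hd k1.q_le
  rw [← hX] at b4
  refine (ens_writeRules k1 hout).mono b4 ?_
  rintro s' ⟨l1, l2⟩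
  refine ⟨F, f', q', rfl, rfl, hM, l1, l2.imp id fun ⟨m1, m2⟩ => ⟨fun hder => m1 ?_, m2⟩⟩
  exact k3.known (fun p hp => (h4 p hp).mono k2) (h5.mono k2) hder le_rfl

theorem length_inputWord_le {H : Subgroup (FreeGroup (Fin n))} (b : FreeGroupBasis (Fin r) H)
    (g : FreeGroup (Fin n)) (o : Option (Fin r)) : (inputWord b g o).length ≤ maxLength b g := by
  rcases o with _ | i
  · exact le_max_right _ _
  · exact (Finset.le_sup (f := fun i => (b i : FreeGroup (Fin n)).norm) (Finset.mem_univ i)).trans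
      (le_max_left _ _)

theorem bound_le_mul {A R K D e₁ e₂ e₃ N c C : ℕ} (hN : 1 ≤ N) (hR : 1 ≤ R) (hK : 1 ≤ K)
    (hD : 1 ≤ D) (h₁ : 3 ≤ e₁) (h₂ : 3 ≤ e₂) (h₃ : 2 ≤ e₃) (hA : A ≤ c * (R ^ 3 * K ^ 3 * D ^ 2))
    (hc : c ≤ C) : A ≤ C * (N * R ^ e₁ * K ^ e₂ * D ^ e₃) := by
  refine hA.trans (Nat.mul_le_mul hc (Nat.mul_le_mul (Nat.mul_le_mul ?_
    (Nat.pow_le_pow_right hK h₂)) (Nat.pow_le_pow_right hD h₃)))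
  exact (Nat.pow_le_pow_right hR h₁).trans (Nat.le_mul_of_pos_left _ hN)

end FreeEq

/-! ### The main theorem: assembly of correctness, completeness and running time. -/

theorem mainTheorem4 :
    ∃ (P : RAM.Program) (C : ℕ),
      ∀ (n r : ℕ) (H : Subgroup (FreeGroup (Fin n))) (b : FreeGroupBasis (Fin r) H)
        (g : FreeGroup (Fin n)) (d : ℕ),
        -- if there is no equation of degree `d`, the machine writes `0` and halts
        (FreeEq.equationsOfDegree b g d = ∅ →
          ∃ t : ℕ,
            t ≤ C * (max n 1 * max r 1 ^ 15 * max (FreeEq.maxLength b g) 1 ^ 3 * max d 1 ^ 6) ∧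
            RAM.HaltsWith P (FreeEq.encodeInput b g d) t [0]) ∧
        -- otherwise it writes `1`, then rules `G` describing an equation of degree `d`,
        -- and then an explicit equation `W` of degree `d`
        (FreeEq.equationsOfDegree b g d ≠ ∅ →
          ∃ (G : FreeEq.Rules r) (W : List (Option (Fin n) × Bool)) (t₁ t₂ : ℕ),
            t₁ ≤ C * (max n 1 * max r 1 ^ 15 * max (FreeEq.maxLength b g) 1 ^ 3 * max d 1 ^ 6) ∧
            RAM.HasWritten P (FreeEq.encodeInput b g d) t₁ (1 :: FreeEq.encodeRules G) ∧
            G.WellFormed ∧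
            FreeGroup.IsCyclicallyReduced G.word ∧
            FreeEq.ofWord b G.word ∈ FreeEq.equationsOfDegree b g d ∧
            t₂ ≤ C * (max n 1 * max r 1 ^ 15 * max (FreeEq.maxLength b g) 1 ^ 11 *
              max d 1 ^ 10) ∧
            RAM.HaltsWith P (FreeEq.encodeInput b g d) t₂
              (1 :: FreeEq.encodeRules G ++ FreeEq.encodeWord W) ∧
            FreeGroup.IsReduced W ∧
            ∃ w ∈ FreeEq.equationsOfDegree b g d, FreeEq.toAmbient H w = FreeGroup.mk W) := by
  -- The decision phase needs `3050000` and the explicit equation `2000000` times the monomial.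
  refine ⟨FreeEq.solver, 6000000, fun n r H b g d => ?_⟩
  have hn : 1 ≤ max n 1 := le_max_right _ _
  have hR : 1 ≤ max r 1 := le_max_right _ _
  have hK : 1 ≤ max (FreeEq.maxLength b g) 1 := le_max_right _ _
  have hD : 1 ≤ max d 1 := le_max_right _ _
  have E := FreeEq.ens_decideCmd (n := n) (d := d) (FreeEq.length_inputWord_le b g) hR hK hD
    (le_max_left _ _) (le_max_left _ _) (le_max_left _ _)
  rw [← FreeEq.encodeInput_eq] at E
  have hrun := RAM.run_code_seq FreeEq.decideCmd FreeEq.writeEquation (FreeEq.encodeInput b g d)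
  have hhalt := RAM.haltsWith_code (FreeEq.decideCmd.seq FreeEq.writeEquation)
    (FreeEq.encodeInput b g d)
  obtain ⟨hcost, F, f, q, hw, hd, hM, hr, htarget⟩ := E
  rw [RAM.Cmd.sem_seq, RAM.Cmd.cost] at hhalt
  generalize FreeEq.decideCmd.sem (RAM.Store.init (FreeEq.encodeInput b g d)) = s at *
  rcases htarget with ⟨j, hj, h34, hout⟩ | ⟨hder, h34, hout⟩
  · have hfact := (hr.valid j hj.2.1 hj.1).fact
    rw [hj.2.2.1, hj.2.2.2.1, hj.2.2.2.2] at hfact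
    obtain ⟨hcyc, hcount, hone, hvalue⟩ := hfact.closed F.layout trivial
    rw [hw] at hone
    have hmem := FreeEq.ofWord_mem b g hcyc hone
    rw [hcount, hd] at hmem
    have hword := FreeEq.word_ruleList hr hj.2.1
    refine ⟨fun h => absurd hmem (h ▸ Set.notMem_empty _), fun _ => ?_⟩
    obtain ⟨hcost', W, hout', hred, hW⟩ := FreeEq.ens_writeEquation hr hj h34 _ hout
    have hcost'' := hcost'.trans (FreeEq.writeEquation_bound hR hK hD hM (hd ▸ le_max_left d 1))
    rw [hout] at hrun
    rw [hout'] at hhalt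
    refine ⟨FreeEq.ruleList f j, W, _, _,
      FreeEq.bound_le_mul hn hR hK hD (by norm_num) (by norm_num) (by norm_num) hcost (by norm_num),
      hrun, FreeEq.wellFormed_ruleList hr hj.2.1, hword ▸ hcyc, hword ▸ hmem,
      FreeEq.bound_le_mul hn hR hK hD (by norm_num) (by norm_num) (by norm_num)
        (c := 3050000 + 2000000) ?_ (by norm_num), hhalt, hred, _, hmem, ?_⟩
    · rw [add_mul]
      exact Nat.add_le_add hcost hcost''
    · rw [FreeEq.toAmbient_ofWord (g := g), hW, FreeEq.ruleValue, hj.2.2.1, hj.2.2.2.1, hvalue, hw]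
  -- Without a target rule the second phase is a single failing test, so the machine halts within
  -- the time of the decision phase up to a constant.
  · have hend : FreeEq.writeEquation.Ens s 5 fun s' => s'.out = [0] := by
      refine (RAM.Cmd.Ens.ite (B := 0) (B' := 0) (fun hpos => absurd hpos (by simpa using h34)) fun _ =>
        RAM.Cmd.Ens.of_flat rfl hout).mono (by decide) fun _ => id
    refine ⟨fun _ => ⟨_, ?_, hend.2 ▸ hhalt⟩, fun h => absurd ?_ hder⟩
    · refine FreeEq.bound_le_mul hn hR hK hD (by norm_num) (by norm_num) (by norm_num)
        (c := 3050000 + 5) ?_ (by norm_num)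
      rw [add_mul]
      refine Nat.add_le_add hcost (hend.1.trans (Nat.le_mul_of_pos_right _ ?_))
      positivity
    · obtain ⟨y, hy⟩ := Set.nonempty_iff_ne_empty.2 h
      obtain ⟨c, hc, h1, rfl⟩ := FreeEq.exists_word_of_mem b g hy
      have hlayout := F.layout
      rw [hw] at hlayout
      exact FreeEq.derivable_of_word hlayout hc h1
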